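/- Let $\overline{\mathbb R}=[-\infty,\infty]$ with its usual order topology and let $\overline{\mathbb R}^2$ have the product topology. Let $\mathcal B_c(\overline{\mathbb R}^2)$ be the set of continuous $F:\overline{\mathbb R}^2\to\mathbb R$ with $F(-\infty,s)=F(s,-\infty)=0$ for all $s\in\overline{\mathbb R}$, and let $\mathcal A_c(\mathbb R^2)$ be the set of distributions $f\in\mathcal D'(\mathbb R^2)$ with $f=\partial_1\partial_2F$ for some $F\in\mathcal B_c(\overline{\mathbb R}^2)$. This $F$ is unique; it is called the primitive of $f$, and $\|f\|=\|F\|_\infty$. For $g:\overline{\mathbb R}^2\to\mathbb R$ let $V_{12}g=\sup\sum_i|g(a_i,c_i)+g(b_i,d_i)-g(a_i,d_i)-g(b_i,c_i)|$, the supremum being over all finite families of nonoverlapping intervals $[a_i,b_i]\times[c_i,d_i]$ with union $\overline{\mathbb R}^2$, and let $V_1g(\cdot,y)$, $V_2g(x,\cdot)$ be the one-variable total variations over $\overline{\mathbb R}$. Let $\mathcal{HKBV}(\overline{\mathbb R}^2)$ be the set of all $g$ such that $V_{12}g$, $V_1g(\cdot,y_0)$ and $V_2g(x_0,\cdot)$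 are finite for some $x_0,y_0\in\overline{\mathbb R}$, and put $\|g\|_{bv}=\|g\|_\infty+\sup_y V_1g(\cdot,y)+\sup_x V_2g(x,\cdot)+V_{12}g$ (sup norm and suprema over all points of $\overline{\mathbb R}^2$ and $\overline{\mathbb R}$), which is then finite. For $f\in\mathcal A_c(\mathbb R^2)$ with primitive $F$ and $g\in\mathcal{HKBV}(\overline{\mathbb R}^2)$ the integral of $fg$ is defined by $$\int_{-\infty}^\infty\!\int_{-\infty}^\infty fg=F(\infty,\infty)g(\infty,\infty)-\int_{-\infty}^\infty F(x,\infty)\,d_1g(x,\infty)-\int_{-\infty}^\infty F(\infty,y)\,d_2g(\infty,y)+\int_{-\infty}^\infty\!\int_{-\infty}^\infty F\,d_{12}g$$ with Henstock--Stieltjes integrals on $\overline{\mathbb R}$ and $\overline{\mathbb R}^2$. For $(x,y)\in\mathbb R^2$ let $f(x-\cdot,y-\cdot)$ denote the distribution $\partial_1\partial_2\Psi$, where $\Psi(s,t)=F(x-s,y-t)$ for $(s,t)\in\mathbb R^2$, and define $$f*g(x,y)=\int_{-\infty}^\infty\!\int_{-\infty}^\infty f(x-s,y-t)\,g(s,t)\,dt\,ds,\qquad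 g*f(x,y)=\int_{-\infty}^\infty\!\int_{-\infty}^\infty f(s,t)\,g(x-s,y-t)\,dt\,ds .$$ **Theorem.** Let $f\in\mathcal A_c(\mathbb R^2)$ have primitive $F\in\mathcal B_c(\overline{\mathbb R}^2)$ and let $g\in\mathcal{HKBV}(\overline{\mathbb R}^2)$. (a) $f*g$ exists (with a uniquely determined value) at every point of $\mathbb R^2$. (b) $g*f$ exists at every point of $\mathbb R^2$ (with a uniquely determined value), and $f*g=g*f$. (c) $\sup_{\mathbb R^2}|f*g|\le\|f\|\,\|g\|_{bv}<\infty$. (d) $f*g$ has a continuous extension to $\overline{\mathbb R}^2$. For each choice of signs $\epsilon_1,\epsilon_2\in\{+,-\}$ the limit $g(\epsilon_1\infty,\epsilon_2\infty):=\lim_{x\to\epsilon_1\infty,\,y\to\epsilon_2\infty}g(x,y)$, taken over $(x,y)\in\mathbb R^2$, exists, and $$\lim_{\substack{x\to\epsilon_1\infty\\ y\to\epsilon_2\infty}}f*g(x,y)=g(\epsilon_1\infty,\epsilon_2\infty)\,F(\infty,\infty).$$ (e) Let $h\in L^1(\mathbb R^2)$, and let $g*h(x,y)=\int_{\mathbb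 R^2}g(x-s,y-t)h(s,t)\,dt\,ds$ for $(x,y)\in\overline{\mathbb R}^2$ (with $\pm\infty-s=\pm\infty$) and $(f*g)*h(x,y)=\int_{\mathbb R^2}(f*g)(x-s,y-t)h(s,t)\,dt\,ds$ for $(x,y)\in\mathbb R^2$. These Lebesgue integrals exist, $g*h\in\mathcal{HKBV}(\overline{\mathbb R}^2)$, $f*(g*h)$ exists (with a uniquely determined value) at every point of $\mathbb R^2$, and $f*(g*h)=(f*g)*h$ on $\mathbb R^2$; this function has a continuous extension to $\overline{\mathbb R}^2$. -/

import Mathlib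

open Set Filter Topology MeasureTheory
open scoped ENNReal Distributions LineDeriv

noncomputable section

/-- Real points of the extended real plane `[-∞, ∞] × [-∞, ∞]`. -/
def toExt (p : ℝ × ℝ) : EReal × EReal := ((p.1 : EReal), (p.2 : EReal))

/-! ### Integrable distributions and their primitives -/

/-- The distribution on the plane given by a (locally integrable) function,
`φ ↦ ∫ u φ`. -/
def distOfFun (u : ℝ × ℝ → ℝ) : 𝓓'((⊤ : TopologicalSpace.Opens (ℝ × ℝ)), ℝ) :=
  TestFunction.integralAgainstBilinCLM (ContinuousLinearMap.mul ℝ ℝ) volume u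

/-- The distributional derivative `∂₁₂ = ∂₁ ∂₂`. -/
def partial12 (T : 𝓓'((⊤ : TopologicalSpace.Opens (ℝ × ℝ)), ℝ)) :
    𝓓'((⊤ : TopologicalSpace.Opens (ℝ × ℝ)), ℝ) :=
  ∂_{((1 : ℝ), (0 : ℝ))} (∂_{((0 : ℝ), (1 : ℝ))} T)

/-- The continuous functions on the extended plane that vanish when a coordinate is `-∞`. -/
def BcPlane : Set C(EReal × EReal, ℝ) :=
  {F | ∀ s : EReal, F (⊥, s) = 0 ∧ F (s, ⊥) = 0}

/-- `F` is a primitive of the distribution `f`. -/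
def IsPrimitive (f : 𝓓'((⊤ : TopologicalSpace.Opens (ℝ × ℝ)), ℝ))
    (F : C(EReal × EReal, ℝ)) : Prop :=
  F ∈ BcPlane ∧ f = partial12 (distOfFun fun p => F (toExt p))

/-- The distributions that have a continuous primitive integral. -/
def AcPlane : Set 𝓓'((⊤ : TopologicalSpace.Opens (ℝ × ℝ)), ℝ) :=
  {f | ∃ F, IsPrimitive f F}

open Classical in
/-- The (unique) primitive of an integrable distribution; `0` for other distributions. -/
def primitive (f : 𝓓'((⊤ : TopologicalSpace.Opens (ℝ × ℝ)), ℝ)) : C(EReal × EReal, ℝ) :=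
  if h : ∃ F, IsPrimitive f F then h.choose else 0

/-- The Alexiewicz norm: the uniform norm of the primitive. -/
def alexNorm (f : 𝓓'((⊤ : TopologicalSpace.Opens (ℝ × ℝ)), ℝ)) : ℝ := ‖primitive f‖

/-- For `p = (x, y)`, the distribution `(s, t) ↦ f (x - s, y - t)`, that is, `∂₁₂` of
`(s, t) ↦ F (x - s, y - t)`, where `F` is the primitive of `f`. -/
def reflectDist (f : 𝓓'((⊤ : TopologicalSpace.Opens (ℝ × ℝ)), ℝ)) (p : ℝ × ℝ) :
    𝓓'((⊤ : TopologicalSpace.Opens (ℝ × ℝ)), ℝ) :=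
  partial12 (distOfFun fun q => primitive f (toExt (p - q)))

/-! ### Intervals, divisions and Hardy--Krause variation -/

/-- The interval `[a, b] × [c, d]` in the extended plane. -/
structure ExtRect where
  a : EReal
  b : EReal
  c : EReal
  d : EReal

/-- The points of the interval. -/
def ExtRect.carrier (R : ExtRect) : Set (EReal × EReal) := Icc R.a R.b ×ˢ Icc R.c R.d

/-- The open interval `(a, b) × (c, d)`. Two intervals have an intersection of planar measure
zero if and only if their open intervals are disjoint. -/
def ExtRect.openPart (R : ExtRect) : Set (EReal × EReal) := Ioo R.a R.b ×ˢ Ioo R.c R.d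

/-- The increment `g(a,c) + g(b,d) - g(a,d) - g(b,c)`. -/
def ExtRect.incr (g : EReal × EReal → ℝ) (R : ExtRect) : ℝ :=
  g (R.a, R.c) + g (R.b, R.d) - g (R.a, R.d) - g (R.b, R.c)

/-- The whole extended plane. -/
def extPlane : ExtRect := ⟨⊥, ⊤, ⊥, ⊤⟩

/-- A finite family of nonoverlapping intervals whose union is `R`. -/
def IsDivision (R : ExtRect) {n : ℕ} (I : Fin n → ExtRect) : Prop :=
  (∀ i, (I i).a ≤ (I i).b ∧ (I i).c ≤ (I i).d) ∧
  (∀ i j, i ≠ j → Disjoint (I i).openPart (I j).openPart) ∧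
  ⋃ i, (I i).carrier = R.carrier

/-- The Vitali variation `V₁₂ g`. -/
def vitaliVariation (g : EReal × EReal → ℝ) : ℝ≥0∞ :=
  ⨆ (n : ℕ) (I : Fin n → ExtRect) (_ : IsDivision extPlane I), ∑ i, ‖(I i).incr g‖ₑ

/-- The one-variable variation `V₁ g(·, y)`. -/
def variation1 (g : EReal × EReal → ℝ) (y : EReal) : ℝ≥0∞ :=
  eVariationOn (fun x => g (x, y)) univ

/-- The one-variable variation `V₂ g(x, ·)`. -/
def variation2 (g : EReal × EReal → ℝ) (x : EReal) : ℝ≥0∞ :=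
  eVariationOn (fun y => g (x, y)) univ

/-- Functions of finite Hardy--Krause variation on the extended plane. -/
def HKBV (g : EReal × EReal → ℝ) : Prop :=
  vitaliVariation g < ∞ ∧ (∃ y₀, variation1 g y₀ < ∞) ∧ (∃ x₀, variation2 g x₀ < ∞)

/-- `‖g‖_bv = ‖g‖_∞ + ‖V₁ g‖_∞ + ‖V₂ g‖_∞ + V₁₂ g`. -/
def bvENorm (g : EReal × EReal → ℝ) : ℝ≥0∞ :=
  (⨆ p, ‖g p‖ₑ) + (⨆ y, variation1 g y) + (⨆ x, variation2 g x) + vitaliVariation g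

/-! ### Henstock--Stieltjes integrals -/

/-- A gauge on the extended plane; the neighbourhoods of real points consist of real points. -/
def IsGauge2 (γ : EReal × EReal → Set (EReal × EReal)) : Prop :=
  ∀ p, IsOpen (γ p) ∧ p ∈ γ p ∧
    (p ∈ Ioo (⊥ : EReal) ⊤ ×ˢ Ioo (⊥ : EReal) ⊤ → γ p ⊆ Ioo (⊥ : EReal) ⊤ ×ˢ Ioo (⊥ : EReal) ⊤)

/-- The Henstock--Stieltjes integral `∫_R F d₁₂g` exists and has the value `A`. -/
def HasHS2 (F g : EReal × EReal → ℝ) (R : ExtRect) (A : ℝ) : Prop :=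
  ∀ ε > 0, ∃ γ, IsGauge2 γ ∧
    ∀ (n : ℕ) (I : Fin n → ExtRect) (z : Fin n → EReal × EReal), IsDivision R I →
      (∀ i, z i ∈ (I i).carrier ∧ (I i).carrier ⊆ γ (z i)) →
      |∑ i, F (z i) * (I i).incr g - A| < ε

/-- A gauge on the extended line. -/
def IsGauge1 (γ : EReal → Set EReal) : Prop :=
  ∀ x, IsOpen (γ x) ∧ x ∈ γ x ∧ (x ∈ Ioo (⊥ : EReal) ⊤ → γ x ⊆ Ioo (⊥ : EReal) ⊤)

/-- The Henstock--Stieltjes integral `∫_a^b F dg` exists and has the value `A`. -/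
def HasHS1 (F g : EReal → ℝ) (a b : EReal) (A : ℝ) : Prop :=
  ∀ ε > 0, ∃ γ, IsGauge1 γ ∧
    ∀ (n : ℕ) (u v z : Fin n → EReal), (∀ i, u i ≤ v i) →
      (∀ i j, i ≠ j → Disjoint (Ioo (u i) (v i)) (Ioo (u j) (v j))) →
      ⋃ i, Icc (u i) (v i) = Icc a b →
      (∀ i, z i ∈ Icc (u i) (v i) ∧ Icc (u i) (v i) ⊆ γ (z i)) →
      |∑ i, F (z i) * (g (v i) - g (u i)) - A| < ε

/-! ### The integral of a product, and convolutions -/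

/-- The integral `∫_R f g` of the product of an integrable distribution `f` and a function `g` of
finite Hardy--Krause variation exists, by parts, and has the value `A`. -/
def HasIntegralMul (f : 𝓓'((⊤ : TopologicalSpace.Opens (ℝ × ℝ)), ℝ)) (g : EReal × EReal → ℝ)
    (R : ExtRect) (A : ℝ) : Prop :=
  HKBV g ∧ ∃ F : C(EReal × EReal, ℝ), IsPrimitive f F ∧ ∃ A₁ A₂ A₃ A₄ A₅ : ℝ,
    HasHS1 (fun x => F (x, R.d)) (fun x => g (x, R.d)) R.a R.b A₁ ∧
    HasHS1 (fun x => F (x, R.c)) (fun x => g (x, R.c)) R.a R.b A₂ ∧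
    HasHS1 (fun y => F (R.b, y)) (fun y => g (R.b, y)) R.c R.d A₃ ∧
    HasHS1 (fun y => F (R.a, y)) (fun y => g (R.a, y)) R.c R.d A₄ ∧
    HasHS2 F g R A₅ ∧
    A = R.incr (fun p => F p * g p) - A₁ + A₂ - A₃ + A₄ + A₅

open Classical in
/-- The value of `∫_R f g` (`0` if the integral does not exist). -/
def integralMul (f : 𝓓'((⊤ : TopologicalSpace.Opens (ℝ × ℝ)), ℝ)) (g : EReal × EReal → ℝ)
    (R : ExtRect) : ℝ :=
  if h : ∃ A, HasIntegralMul f g R A then h.choose else 0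

/-- For `p = (x, y)`, the function `(s, t) ↦ g (x - s, y - t)` on the extended plane. -/
def reflectFun (g : EReal × EReal → ℝ) (p : ℝ × ℝ) (q : EReal × EReal) : ℝ :=
  g ((p.1 : EReal) - q.1, (p.2 : EReal) - q.2)

/-- `(f ∗ g)(x, y) = ∬ f(x - s, y - t) g(s, t) dt ds`. -/
def convDF (f : 𝓓'((⊤ : TopologicalSpace.Opens (ℝ × ℝ)), ℝ)) (g : EReal × EReal → ℝ)
    (p : ℝ × ℝ) : ℝ :=
  integralMul (reflectDist f p) g extPlane

/-- `(g ∗ f)(x, y) = ∬ f(s, t) g(x - s, y - t) dt ds`. -/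
def convFD (g : EReal × EReal → ℝ) (f : 𝓓'((⊤ : TopologicalSpace.Opens (ℝ × ℝ)), ℝ))
    (p : ℝ × ℝ) : ℝ :=
  integralMul f (reflectFun g p) extPlane

/-- The convolution of a function on the extended plane with a Lebesgue integrable function on the
plane, as a function on the extended plane:
`(g ∗ h)(x, y) = ∬ g(x - s, y - t) h(s, t) dt ds`, where `±∞ - s = ±∞`. -/
def convExt (g : EReal × EReal → ℝ) (h : ℝ × ℝ → ℝ) (p : EReal × EReal) : ℝ :=
  ∫ q : ℝ × ℝ, g (p.1 - (q.1 : EReal), p.2 - (q.2 : EReal)) * h q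

/-- The convolution of functions on the plane:
`(u ∗ h)(x, y) = ∬ u(x - s, y - t) h(s, t) dt ds`. -/
def convPlane (u h : ℝ × ℝ → ℝ) (p : ℝ × ℝ) : ℝ :=
  ∫ q : ℝ × ℝ, u (p - q) * h q

end

/-! Everything reduces to one linear functional of the primitive. Let `cutTop g` be `g` made zero on
the two upper edges of the extended plane, and `cutReal g` be `g` made zero at all infinite points.
The boundary terms in the definition of ∬ f g account exactly for the passage from `g` to `cutTop
g`, so ∬ f g = ∬ F d₁₂(cutTop g) (`stieltjes_cutTop`). As F vanishes on the lower edges, `cutTop g`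
may be replaced by `cutReal g` (`stieltjes_cutTop_eq_cutReal`). Thus g∗f(p) = ∬ F d₁₂(cutReal g(p −
·)), which is `convFun F g p`. The primitive of f(p − ·) is F(p − ·) plus functions of one variable.
The latter integrate to zero against d₁₂ of a function that vanishes at all infinite points, and a
reflection turns what is left into the same functional (`stieltjes_bcPart_reflectMap`). This gives
f∗g = g∗f.

The Stieltjes integral exists because F is continuous on a compact space and the integrator has
finite Vitali variation: Riemann sums of two divisions are compared on their common refinement
(`abs_riemannSum_sub_le`), which requires increments to be additive over divisions that need not be
grids (`IsDiv.sum_incr`). Values are unique by Cousin's lemma and by uniqueness of the primitive.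
The integral is at most ‖F‖ times the Vitali variation, and that of `cutTop g` is at most ‖g‖_bv.
This is the norm inequality, and it makes `convFun F g p` continuous in F uniformly in p.

By this uniformity, the limits in (d) and the identity in (e) need only be checked for F in a set
with dense span. By Stone–Weierstrass the products u(x)v(y), with u and v positive powers of a
sigmoid, are such a set (`bcPart_induction`). For them, summation by parts turns the Stieltjes
integral into the Lebesgue integral ∬ u′(s)v′(t) g(p − (s,t)) (`stieltjes_tensor`,
`convFun_tensor`). Limits then follow from dominated convergence and associativity from Fubini.

The regularity of g that this uses comes from one inequality: |g(p) − g(q)| ≤ |α(p₁) − α(q₁)| +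
|β(p₂) − β(q₂)| with α, β monotone (`HKBV.exists_modulus`). It holds because x ↦ g(x, ·) has finite
variation even in the uniform norm. Hence g is measurable, continuous almost everywhere on the real
plane, and has limits at the four corners. -/

/-! ### Divisions of intervals and additivity of increments -/

/-- A nonoverlapping family of intervals with union `R`, over an arbitrary index type. -/
def IsDiv {ι : Type*} (R : ExtRect) (I : ι → ExtRect) : Prop :=
  (∀ i, (I i).a ≤ (I i).b ∧ (I i).c ≤ (I i).d) ∧
  (∀ i j, i ≠ j → Disjoint (I i).openPart (I j).openPart) ∧
  ⋃ i, (I i).carrier = R.carrier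

theorem isDivision_iff_isDiv {R : ExtRect} {n : ℕ} {I : Fin n → ExtRect} :
    IsDivision R I ↔ IsDiv R I := Iff.rfl

theorem IsDiv.comp_equiv {ι κ : Type*} {R : ExtRect} {I : ι → ExtRect} (h : IsDiv R I)
    (e : κ ≃ ι) : IsDiv R (I ∘ e) := by
  refine ⟨fun i => h.1 _, fun i j hij => h.2.1 _ _ (e.injective.ne hij), ?_⟩
  rw [← h.2.2]
  exact e.surjective.iUnion_comp fun i => (I i).carrier

/-- The half-open interval `(a, b] × (c, d]`. -/
def ExtRect.halfOpen (R : ExtRect) : Set (EReal × EReal) := Ioc R.a R.b ×ˢ Ioc R.c R.d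

/-- A point slightly to the left of s decides which half-open intervals contain s, with no ambiguity
at end points. It is what links half-open intervals to divisions, which are disjoint only on open
intervals and cover only by closed ones. -/
theorem exists_left_point {ι : Type*} [Finite ι] (a b : ι → EReal) {s : EReal} (hs : s ≠ ⊥) :
    ∃ x, ∀ i, (s ∈ Ioc (a i) (b i) → x ∈ Ioo (a i) (b i)) ∧
      (x ∈ Icc (a i) (b i) → s ∈ Ioc (a i) (b i)) := by
  have hne : (𝓝[<] s).NeBot := nhdsLT_neBot_of_exists_lt ⟨⊥, bot_lt_iff_ne_bot.2 hs⟩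
  have h : ∀ᶠ x in 𝓝[<] s, ∀ i, (s ∈ Ioc (a i) (b i) → x ∈ Ioo (a i) (b i)) ∧
      (x ∈ Icc (a i) (b i) → s ∈ Ioc (a i) (b i)) := by
    rw [eventually_all]
    intro i
    have hlt : ∀ᶠ x in 𝓝[<] s, x < s := self_mem_nhdsWithin
    by_cases h1 : a i < s
    · have ha : ∀ᶠ x in 𝓝[<] s, a i < x := nhdsWithin_le_nhds (lt_mem_nhds h1)
      by_cases h2 : s ≤ b i
      · filter_upwards [ha, hlt] with x hx hxs
        exact ⟨fun _ => ⟨hx, hxs.trans_le h2⟩, fun _ => ⟨h1, h2⟩⟩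
      · have hb : ∀ᶠ x in 𝓝[<] s, b i < x := nhdsWithin_le_nhds (lt_mem_nhds (not_le.1 h2))
        filter_upwards [hb] with x hx
        exact ⟨fun h => absurd h.2 h2, fun h => absurd h.2 (not_le.2 hx)⟩
    · filter_upwards [hlt] with x hxs
      exact ⟨fun h => absurd h.1 h1, fun h => absurd (h.1.trans_lt hxs) h1⟩
  exact h.exists

/-- The half-open versions of the intervals of a division partition the half-open version of `R`:
moving p slightly down and to the left puts it in the open part of exactly those intervals whose
half-open version contains p. -/
theorem IsDiv.sum_indicator_halfOpen {ι : Type*} [Fintype ι] {R : ExtRect} {I : ι → ExtRect}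
    (h : IsDiv R I) (p : EReal × EReal) (m : ℝ) :
    (∑ i, (I i).halfOpen.indicator (fun _ => m) p) = R.halfOpen.indicator (fun _ => m) p := by
  classical
  by_cases hp : p.1 = ⊥ ∨ p.2 = ⊥
  · have key : ∀ Q : ExtRect, p ∉ Q.halfOpen := by
      rintro Q ⟨h1, h2⟩
      rcases hp with hp | hp
      · exact not_lt_bot (hp ▸ h1.1)
      · exact not_lt_bot (hp ▸ h2.1)
    simp [key]
  · push Not at hp
    -- `R` is added to the family as `none`, so that a single shifted point serves `R` and all the
    -- `I i`.
    let J : Option ι → ExtRect := fun o => o.elim R I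
    obtain ⟨x, hx⟩ := exists_left_point (fun o => (J o).a) (fun o => (J o).b) hp.1
    obtain ⟨y, hy⟩ := exists_left_point (fun o => (J o).c) (fun o => (J o).d) hp.2
    have h1 : ∀ o, p ∈ (J o).halfOpen → (x, y) ∈ (J o).openPart :=
      fun o ho => ⟨(hx o).1 ho.1, (hy o).1 ho.2⟩
    have h2 : ∀ o, (x, y) ∈ (J o).carrier → p ∈ (J o).halfOpen :=
      fun o ho => ⟨(hx o).2 ho.1, (hy o).2 ho.2⟩
    have h3 : ∀ o, p ∈ (J o).halfOpen → (x, y) ∈ (J o).carrier := fun o ho =>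
      ⟨Ioo_subset_Icc_self (h1 o ho).1, Ioo_subset_Icc_self (h1 o ho).2⟩
    by_cases hR : p ∈ R.halfOpen
    · have hxy : (x, y) ∈ ⋃ i, (I i).carrier := h.2.2 ▸ h3 none hR
      obtain ⟨i, hi⟩ := mem_iUnion.1 hxy
      have hpi : p ∈ (I i).halfOpen := h2 (some i) hi
      rw [Finset.sum_eq_single i, indicator_of_mem hpi, indicator_of_mem hR]
      · intro j _ hji
        refine indicator_of_notMem (fun hj => ?_) _
        exact disjoint_left.1 (h.2.1 j i hji) (h1 (some j) hj) (h1 (some i) hpi)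
      · simp
    · rw [indicator_of_notMem hR]
      refine Finset.sum_eq_zero fun i _ => indicator_of_notMem (fun hi => hR ?_) _
      refine h2 none ?_
      change (x, y) ∈ R.carrier
      rw [← h.2.2]
      exact mem_iUnion.2 ⟨i, h3 (some i) hi⟩

/-- On a finite set every function is the distribution function of point masses, namely its jumps
from one point to the next. The values lie in a group so that the second variable can be carried
along as a parameter. -/
theorem exists_atoms {V : Type*} [AddCommGroup V] (φ : EReal → V) (X : Finset EReal) :
    ∃ m : EReal → V, ∀ a ∈ X, ∀ b ∈ X, a ≤ b →
      φ b - φ a = ∑ s ∈ X, (Ioc a b).indicator m s := by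
  classical
  induction X using Finset.induction_on_max with
  | empty => exact ⟨0, by simp⟩
  | insert x X hx ih =>
    obtain ⟨m, hm⟩ := ih
    have hxX : x ∉ X := fun h => lt_irrefl _ (hx x h)
    by_cases hX : X.Nonempty
    · set M := X.max' hX
      have hM : M ∈ X := X.max'_mem hX
      refine ⟨Function.update m x (φ x - φ M), fun a ha b hb hab => ?_⟩
      have hcongr : ∀ b', ∑ s ∈ X, (Ioc a b').indicator (Function.update m x (φ x - φ M)) s =
          ∑ s ∈ X, (Ioc a b').indicator m s := by
        intro b'
        refine Finset.sum_congr rfl fun s hs => ?_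
        have : s ≠ x := fun h => hxX (h ▸ hs)
        by_cases h : s ∈ Ioc a b' <;> simp [h, this]
      rw [Finset.sum_insert hxX, hcongr]
      rcases Finset.mem_insert.1 hb with rfl | hb
      · rcases Finset.mem_insert.1 ha with rfl | ha
        · simp
        · have h1 : ∑ s ∈ X, (Ioc a b).indicator m s = ∑ s ∈ X, (Ioc a M).indicator m s := by
            refine Finset.sum_congr rfl fun s hs => ?_
            have hsM : s ≤ M := X.le_max' s hs
            have hsb : s ≤ b := (hx s hs).le
            by_cases h : a < s <;> simp [indicator, h, hsM, hsb]
          rw [h1, ← hm a ha M hM (X.le_max' a ha), indicator_of_mem (show b ∈ Ioc a b from ⟨hx a ha, le_rfl⟩)]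
          simp
      · have hbx : b < x := hx b hb
        rcases Finset.mem_insert.1 ha with rfl | ha
        · exact absurd hab (not_le.2 hbx)
        · rw [indicator_of_notMem (fun h => absurd h.2 (not_le.2 hbx)), zero_add, hm a ha b hb hab]
    · rw [Finset.not_nonempty_iff_eq_empty] at hX
      subst hX
      exact ⟨0, by simp⟩

/-- Taking jumps in one variable and then in the other represents increments on a finite grid by a
signed discrete measure. Additivity over divisions thereby becomes the partition property of
half-open intervals. -/
theorem exists_atoms_prod (g : EReal × EReal → ℝ) (X Y : Finset EReal) :
    ∃ m : EReal × EReal → ℝ, ∀ R : ExtRect, R.a ∈ X → R.b ∈ X → R.c ∈ Y → R.d ∈ Y →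
      R.a ≤ R.b → R.c ≤ R.d →
      R.incr g = ∑ p ∈ X ×ˢ Y, R.halfOpen.indicator (fun _ => m p) p := by
  classical
  obtain ⟨m₁, h₁⟩ := exists_atoms (fun x => fun y => g (x, y)) X
  obtain ⟨m₂, h₂⟩ := exists_atoms (fun y => fun x => m₁ x y) Y
  refine ⟨fun p => m₂ p.2 p.1, fun R ha hb hc hd hab hcd => ?_⟩
  have e₁ : ∀ y, g (R.b, y) - g (R.a, y) = ∑ s ∈ X, (Ioc R.a R.b).indicator (fun s => m₁ s y) s := by
    intro y
    have := congrFun (h₁ _ ha _ hb hab) y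
    simp only [Pi.sub_apply, Finset.sum_apply] at this
    rw [this]
    refine Finset.sum_congr rfl fun s _ => ?_
    by_cases h : s ∈ Ioc R.a R.b <;> simp [h]
  have e₂ : ∀ x, m₁ x R.d - m₁ x R.c =
      ∑ t ∈ Y, (Ioc R.c R.d).indicator (fun t => m₂ t x) t := by
    intro x
    have := congrFun (h₂ _ hc _ hd hcd) x
    simp only [Pi.sub_apply, Finset.sum_apply] at this
    rw [this]
    refine Finset.sum_congr rfl fun s _ => ?_
    by_cases h : s ∈ Ioc R.c R.d <;> simp [h]
  have e₃ : R.incr g = (g (R.b, R.d) - g (R.a, R.d)) - (g (R.b, R.c) - g (R.a, R.c)) := by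
    simp only [ExtRect.incr]; ring
  rw [e₃, e₁, e₁, ← Finset.sum_sub_distrib, Finset.sum_product]
  refine Finset.sum_congr rfl fun s _ => ?_
  by_cases h : s ∈ Ioc R.a R.b
  · rw [indicator_of_mem h, indicator_of_mem h, e₂]
    refine Finset.sum_congr rfl fun t _ => ?_
    by_cases h' : t ∈ Ioc R.c R.d
    · rw [indicator_of_mem h', indicator_of_mem (show (s, t) ∈ R.halfOpen from ⟨h, h'⟩)]
    · rw [indicator_of_notMem h', indicator_of_notMem fun hh => h' hh.2]
  · rw [indicator_of_notMem h, indicator_of_notMem h, sub_zero]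
    exact (Finset.sum_eq_zero fun t _ => indicator_of_notMem (fun hh => h hh.1) _).symm

/-- Increments are additive over divisions. -/
theorem IsDiv.sum_incr {ι : Type*} [Fintype ι] {R : ExtRect} {I : ι → ExtRect} (h : IsDiv R I)
    (hab : R.a ≤ R.b) (hcd : R.c ≤ R.d) (g : EReal × EReal → ℝ) :
    ∑ i, (I i).incr g = R.incr g := by
  classical
  let X : Finset EReal := insert R.a (insert R.b (Finset.univ.image (fun i => (I i).a) ∪
    Finset.univ.image (fun i => (I i).b)))
  let Y : Finset EReal := insert R.c (insert R.d (Finset.univ.image (fun i => (I i).c) ∪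
    Finset.univ.image (fun i => (I i).d)))
  obtain ⟨m, hm⟩ := exists_atoms_prod g X Y
  rw [hm R (by simp [X]) (by simp [X]) (by simp [Y]) (by simp [Y]) hab hcd]
  have : ∀ i, (I i).incr g =
      ∑ p ∈ X ×ˢ Y, (I i).halfOpen.indicator (fun _ => m p) p := fun i =>
    hm (I i) (by simp [X]) (by simp [X]) (by simp [Y]) (by simp [Y]) (h.1 i).1 (h.1 i).2
  simp_rw [this]
  rw [Finset.sum_comm]
  exact Finset.sum_congr rfl fun p _ => h.sum_indicator_halfOpen p (m p)

/-! ### Restriction of an interval to another one -/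

/-- The interval obtained from `R` by moving the end points into `J`; it is the intersection
of `R` and `J` if this is nonempty, and degenerate otherwise. -/
noncomputable def ExtRect.clamp (R J : ExtRect) : ExtRect :=
  ⟨max J.a (min R.a J.b), max J.a (min R.b J.b), max J.c (min R.c J.d), max J.c (min R.d J.d)⟩

theorem clamp_Icc_subset {a b A B : EReal} (hAB : A ≤ B) :
    Icc (max A (min a B)) (max A (min b B)) ⊆ Icc A B := fun _ hx =>
  ⟨(le_max_left _ _).trans hx.1, hx.2.trans (max_le hAB (min_le_right _ _))⟩

theorem clamp_Ioo_subset {a b A B : EReal} (hAB : A ≤ B) :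
    Ioo (max A (min a B)) (max A (min b B)) ⊆ Ioo a b ∩ Ioo A B := by
  rintro x ⟨h1, h2⟩
  have hxB : x < B := h2.trans_le (max_le hAB (min_le_right _ _))
  have hAx : A < x := (le_max_left _ _).trans_lt h1
  have h3 := (le_max_right _ _).trans_lt h1
  refine ⟨⟨(min_lt_iff.1 h3).resolve_right (not_lt.2 hxB.le), ?_⟩, hAx, hxB⟩
  exact ((lt_max_iff.1 h2).resolve_left (not_lt.2 hAx.le)).trans_le (min_le_left _ _)

theorem mem_clamp_Icc {a b A B x : EReal} (h : x ∈ Icc a b) (h' : x ∈ Icc A B) :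
    x ∈ Icc (max A (min a B)) (max A (min b B)) :=
  ⟨max_le h'.1 (min_le_of_left_le h.1), le_max_of_le_right (le_min h.2 h'.2)⟩

theorem clamp_mono {a b A B : EReal} (hab : a ≤ b) : max A (min a B) ≤ max A (min b B) :=
  max_le_max le_rfl (min_le_min hab le_rfl)

theorem IsDiv.clamp {ι : Type*} {I : ι → ExtRect} {R J : ExtRect} (h : IsDiv R I)
    (hab : J.a ≤ J.b) (hcd : J.c ≤ J.d) (hJ : J.carrier ⊆ R.carrier) :
    IsDiv J fun i => (I i).clamp J := by
  refine ⟨fun i => ⟨clamp_mono (h.1 i).1, clamp_mono (h.1 i).2⟩, fun i j hij => ?_, ?_⟩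
  · refine (h.2.1 i j hij).mono ?_ ?_ <;>
    exact fun p hp => ⟨(clamp_Ioo_subset hab hp.1).1, (clamp_Ioo_subset hcd hp.2).1⟩
  · refine subset_antisymm (iUnion_subset fun i => ?_) fun p hp => ?_
    · exact fun p hp => ⟨clamp_Icc_subset hab hp.1, clamp_Icc_subset hcd hp.2⟩
    · have := hJ hp
      rw [← h.2.2] at this
      obtain ⟨i, hi⟩ := mem_iUnion.1 this
      exact mem_iUnion.2 ⟨i, mem_clamp_Icc hi.1 hp.1, mem_clamp_Icc hi.2 hp.2⟩

/-- Either the two intervals meet and both clampings are their intersection, or both clampings are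
degenerate. -/
theorem clamp_comm_or {a b A B : EReal} (hab : a ≤ b) (hAB : A ≤ B) :
    (max A (min a B) = max a (min A b) ∧ max A (min b B) = max a (min B b)) ∨
    (max A (min a B) = max A (min b B) ∧ max a (min A b) = max a (min B b)) := by
  rcases lt_or_ge b A with h | h
  · right
    rw [max_eq_left (min_le_of_left_le (hab.trans h.le)), max_eq_left (min_le_of_left_le h.le),
      min_eq_right h.le, min_eq_right (h.le.trans hAB)]
    exact ⟨rfl, rfl⟩
  rcases lt_or_ge B a with h' | h'
  · right
    rw [min_eq_right h'.le, min_eq_right (h'.le.trans hab), max_eq_left (min_le_of_left_le h'.le),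
      max_eq_left (min_le_of_left_le (hAB.trans h'.le))]
    exact ⟨rfl, rfl⟩
  · left
    rw [min_eq_left h', min_eq_left h, max_comm, max_eq_right (le_min h hAB),
      max_eq_right (le_min h' hab), min_comm]
    exact ⟨rfl, rfl⟩

theorem incr_clamp_comm {R J : ExtRect} (h₁ : R.a ≤ R.b) (h₂ : R.c ≤ R.d) (h₃ : J.a ≤ J.b)
    (h₄ : J.c ≤ J.d) (g : EReal × EReal → ℝ) : (R.clamp J).incr g = (J.clamp R).incr g := by
  rcases clamp_comm_or h₁ h₃ with h | h
  · rcases clamp_comm_or h₂ h₄ with h' | h'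
    · simp only [ExtRect.clamp, ExtRect.incr, h.1, h.2, h'.1, h'.2]
    · simp only [ExtRect.clamp, ExtRect.incr, h.1, h.2, h'.1, h'.2]
      ring
  · simp only [ExtRect.clamp, ExtRect.incr, h.1, h.2]
    ring

theorem subset_extPlane (s : Set (EReal × EReal)) : s ⊆ extPlane.carrier := fun _ _ =>
  ⟨⟨bot_le, le_top⟩, ⟨bot_le, le_top⟩⟩

/-- This is the common refinement. Pairs of cells that do not meet contribute degenerate intervals,
whose increments are zero. -/
theorem IsDiv.refine {ι κ : Type*} {I : ι → ExtRect} {K : κ → ExtRect} (hI : IsDiv extPlane I)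
    (hK : IsDiv extPlane K) : IsDiv extPlane fun q : ι × κ => (I q.1).clamp (K q.2) := by
  refine ⟨fun q => ⟨clamp_mono (hI.1 _).1, clamp_mono (hI.1 _).2⟩, fun q q' hq => ?_, ?_⟩
  · rw [disjoint_left]
    intro p hp hp'
    have e1 : q.1 = q'.1 := by
      by_contra hne
      exact disjoint_left.1 (hI.2.1 _ _ hne)
        ⟨(clamp_Ioo_subset (hK.1 _).1 hp.1).1, (clamp_Ioo_subset (hK.1 _).2 hp.2).1⟩
        ⟨(clamp_Ioo_subset (hK.1 _).1 hp'.1).1, (clamp_Ioo_subset (hK.1 _).2 hp'.2).1⟩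
    have e2 : q.2 = q'.2 := by
      by_contra hne
      exact disjoint_left.1 (hK.2.1 _ _ hne)
        ⟨(clamp_Ioo_subset (hK.1 _).1 hp.1).2, (clamp_Ioo_subset (hK.1 _).2 hp.2).2⟩
        ⟨(clamp_Ioo_subset (hK.1 _).1 hp'.1).2, (clamp_Ioo_subset (hK.1 _).2 hp'.2).2⟩
    exact hq (Prod.ext e1 e2)
  · refine subset_antisymm (subset_extPlane _) fun p hp => ?_
    obtain ⟨i, hi⟩ := mem_iUnion.1 (hI.2.2 ▸ hp)
    obtain ⟨k, hk⟩ := mem_iUnion.1 (hK.2.2 ▸ hp)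
    exact mem_iUnion.2 ⟨(i, k), mem_clamp_Icc hi.1 hk.1, mem_clamp_Icc hi.2 hk.2⟩

/-! ### The Vitali variation -/

theorem IsDiv.sum_enorm_le_vitaliVariation {ι : Type*} [Fintype ι] {I : ι → ExtRect}
    (h : IsDiv extPlane I) (g : EReal × EReal → ℝ) :
    ∑ i, ‖(I i).incr g‖ₑ ≤ vitaliVariation g := by
  let e := (Fintype.equivFin ι).symm
  have h' : IsDivision extPlane (I ∘ e) := h.comp_equiv e
  rw [← e.sum_comp]
  exact le_iSup₂_of_le (Fintype.card ι) (I ∘ e) (le_iSup_of_le h' le_rfl)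

theorem IsDiv.sum_abs_le_vitaliVariation {ι : Type*} [Fintype ι] {I : ι → ExtRect}
    (h : IsDiv extPlane I) {g : EReal × EReal → ℝ} (hg : vitaliVariation g < ∞) :
    ∑ i, |(I i).incr g| ≤ (vitaliVariation g).toReal := by
  have := ENNReal.toReal_mono hg.ne (h.sum_enorm_le_vitaliVariation g)
  rw [ENNReal.toReal_sum (by simp)] at this
  simpa using this

theorem vitaliVariation_le {g : EReal × EReal → ℝ} {C : ℝ≥0∞}
    (h : ∀ (n : ℕ) (I : Fin n → ExtRect), IsDivision extPlane I → ∑ i, ‖(I i).incr g‖ₑ ≤ C) :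
    vitaliVariation g ≤ C :=
  iSup₂_le fun n I => iSup_le fun hI => h n I hI

/-- The increments of `G` are additive, so the sums over every division are bounded by the single
total increment of `G`. -/
theorem vitaliVariation_le_incr {g G : EReal × EReal → ℝ}
    (h : ∀ R : ExtRect, R.a ≤ R.b → R.c ≤ R.d → |R.incr g| ≤ R.incr G) :
    vitaliVariation g ≤ ENNReal.ofReal (extPlane.incr G) := by
  refine vitaliVariation_le fun n I hI => ?_
  have hI' : IsDiv extPlane I := hI
  rw [← hI'.sum_incr bot_le bot_le G, ENNReal.ofReal_sum_of_nonneg fun i _ =>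
    (abs_nonneg _).trans (h _ (hI.1 i).1 (hI.1 i).2)]
  refine Finset.sum_le_sum fun i _ => ?_
  rw [Real.enorm_eq_ofReal_abs]
  exact ENNReal.ofReal_le_ofReal (h _ (hI.1 i).1 (hI.1 i).2)

theorem ExtRect.incr_add (R : ExtRect) (g h : EReal × EReal → ℝ) :
    R.incr (g + h) = R.incr g + R.incr h := by
  simp only [ExtRect.incr, Pi.add_apply]; ring

theorem ExtRect.incr_sub (R : ExtRect) (g h : EReal × EReal → ℝ) :
    R.incr (g - h) = R.incr g - R.incr h := by
  simp only [ExtRect.incr, Pi.sub_apply]; ring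

theorem vitaliVariation_add_le (g h : EReal × EReal → ℝ) :
    vitaliVariation (g + h) ≤ vitaliVariation g + vitaliVariation h := by
  refine vitaliVariation_le fun n I hI => ?_
  have hI' : IsDiv extPlane I := hI
  calc ∑ i, ‖(I i).incr (g + h)‖ₑ ≤ ∑ i, (‖(I i).incr g‖ₑ + ‖(I i).incr h‖ₑ) :=
        Finset.sum_le_sum fun i _ => by rw [ExtRect.incr_add]; exact enorm_add_le _ _
    _ ≤ _ := by
        rw [Finset.sum_add_distrib]
        exact add_le_add (hI'.sum_enorm_le_vitaliVariation g) (hI'.sum_enorm_le_vitaliVariation h)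

theorem vitaliVariation_neg (g : EReal × EReal → ℝ) :
    vitaliVariation (-g) = vitaliVariation g := by
  have : ∀ R : ExtRect, ‖R.incr (-g)‖ₑ = ‖R.incr g‖ₑ := fun R => by
    rw [← enorm_neg (R.incr g)]
    congr 1
    simp only [ExtRect.incr, Pi.neg_apply]; ring
  simp only [vitaliVariation, this]

theorem vitaliVariation_sub_le (g h : EReal × EReal → ℝ) :
    vitaliVariation (g - h) ≤ vitaliVariation g + vitaliVariation h := by
  rw [sub_eq_add_neg, ← vitaliVariation_neg h]
  exact vitaliVariation_add_le _ _

/-! ### Divisions of the line and fine divisions -/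

/-- A nonoverlapping family of intervals `[u i, v i]` with union the extended line. -/
def IsLineDiv {ι : Type*} (u v : ι → EReal) : Prop :=
  (∀ i, u i ≤ v i) ∧ (∀ i j, i ≠ j → Disjoint (Ioo (u i) (v i)) (Ioo (u j) (v j))) ∧
    ⋃ i, Icc (u i) (v i) = Icc ⊥ ⊤

theorem isLineDiv_of_monotone {t : ℕ → EReal} (ht : Monotone t) {n : ℕ} (h0 : t 0 = ⊥)
    (hn : t n = ⊤) : IsLineDiv (fun i : Fin n => t i) (fun i : Fin n => t (i + 1)) := by
  refine ⟨fun i => ht (Nat.le_succ _), ?_, ?_⟩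
  · have key : ∀ i j : ℕ, i < j → Disjoint (Ioo (t i) (t (i + 1))) (Ioo (t j) (t (j + 1))) := by
      intro i j hij
      rw [disjoint_left]
      intro x hx hx'
      exact lt_irrefl _ ((hx.2.trans_le (ht hij)).trans hx'.1)
    intro i j hij
    rcases lt_or_gt_of_ne (fun h => hij (Fin.ext h) : (i : ℕ) ≠ j) with h | h
    · exact key _ _ h
    · exact (key _ _ h).symm
  · refine subset_antisymm (fun _ _ => ⟨bot_le, le_top⟩) fun x _ => ?_
    have hn0 : n ≠ 0 := by
      rintro rfl
      exact bot_ne_top (h0.symm.trans hn)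
    have hex : ∃ k, x ≤ t k := ⟨n, hn ▸ le_top⟩
    classical
    rcases hk : Nat.find hex with _ | k
    · have : x ≤ t 0 := hk ▸ Nat.find_spec hex
      exact mem_iUnion.2 ⟨⟨0, Nat.pos_of_ne_zero hn0⟩, h0.le.trans bot_le,
        this.trans (ht (Nat.zero_le _))⟩
    · have h1 : x ≤ t (k + 1) := hk ▸ Nat.find_spec hex
      have h2 : ¬ x ≤ t k := Nat.find_min hex (by omega)
      have h3 : Nat.find hex ≤ n := Nat.find_min' hex (hn ▸ le_top)
      exact mem_iUnion.2 ⟨⟨k, by omega⟩, (not_le.1 h2).le, h1⟩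

/-- The division of the second axis may change from strip to strip; grids alone would not suffice
below. -/
theorem IsLineDiv.prod {ι : Type*} {κ : ι → Type*} {u v : ι → EReal} (h : IsLineDiv u v)
    {c d : ∀ i, κ i → EReal} (h' : ∀ i, IsLineDiv (c i) (d i)) :
    IsDiv extPlane fun q : Σ i, κ i => ⟨u q.1, v q.1, c q.1 q.2, d q.1 q.2⟩ := by
  refine ⟨fun q => ⟨h.1 _, (h' _).1 _⟩, ?_, ?_⟩
  · rintro ⟨i, j⟩ ⟨i', j'⟩ hne
    rw [disjoint_left]
    rintro p ⟨h1, h2⟩ ⟨h3, h4⟩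
    by_cases hi : i = i'
    · subst hi
      have : j ≠ j' := fun h => hne (by rw [h])
      exact disjoint_left.1 ((h' i).2.1 j j' this) h2 h4
    · exact disjoint_left.1 (h.2.1 i i' hi) h1 h3
  · refine subset_antisymm (subset_extPlane _) fun p _ => ?_
    have h1 : p.1 ∈ ⋃ i, Icc (u i) (v i) := h.2.2 ▸ ⟨bot_le, le_top⟩
    obtain ⟨i, hi⟩ := mem_iUnion.1 h1
    have h2 : p.2 ∈ ⋃ j, Icc (c i j) (d i j) := (h' i).2.2 ▸ ⟨bot_le, le_top⟩
    obtain ⟨j, hj⟩ := mem_iUnion.1 h2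
    exact mem_iUnion.2 ⟨⟨i, j⟩, hi, hj⟩

theorem isLineDiv_univ : IsLineDiv (fun _ : Unit => (⊥ : EReal)) fun _ => ⊤ :=
  ⟨fun _ => bot_le, fun i j h => absurd (Subsingleton.elim i j) h,
    by rw [iUnion_const]⟩

/-- Cousin's lemma on the extended line. -/
theorem exists_fine_seq {γ : EReal → Set EReal} (hγ : ∀ x, IsOpen (γ x) ∧ x ∈ γ x) :
    ∃ (n : ℕ) (t : ℕ → EReal), Monotone t ∧ t 0 = ⊥ ∧ t n = ⊤ ∧
      ∀ i < n, ∃ z ∈ Icc (t i) (t (i + 1)), Icc (t i) (t (i + 1)) ⊆ γ z := by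
  -- `S` is the set of x for which [−∞, x] has a fine division. It contains its supremum, and it can
  -- be extended beyond any of its points other than +∞.
  let S : Set EReal := {x | ∃ (n : ℕ) (t : ℕ → EReal), Monotone t ∧ t 0 = ⊥ ∧ t n = x ∧
      ∀ i < n, ∃ z ∈ Icc (t i) (t (i + 1)), Icc (t i) (t (i + 1)) ⊆ γ z}
  have hbot : ⊥ ∈ S := ⟨0, fun _ => ⊥, monotone_const, rfl, rfl, by simp⟩
  have step : ∀ x y z, x ∈ S → x ≤ y → z ∈ Icc x y → Icc x y ⊆ γ z → y ∈ S := by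
    rintro x y z ⟨n, t, ht, h0, hn, h⟩ hxy hz hsub
    have hle : ∀ i ≤ n, t i ≤ y := fun i hi => (ht hi).trans (hn.le.trans hxy)
    refine ⟨n + 1, fun i => if i ≤ n then t i else y, ?_, by simp [h0], by simp, ?_⟩
    · intro i j hij
      by_cases hj : j ≤ n
      · simp [hj, hij.trans hj, ht hij]
      · by_cases hi : i ≤ n <;> simp [hi, hj, hle]
    · intro i hi
      rcases Nat.lt_succ_iff_lt_or_eq.1 hi with hi' | rfl
      · have : i + 1 ≤ n := hi'
        simpa [hi'.le, this] using h i hi'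
      · simp only [le_refl, if_true, Nat.succ_le_iff, lt_irrefl, if_false, hn]
        exact ⟨z, hz, hsub⟩
  set s := sSup S with hs
  have hsS : s ∈ S := by
    by_cases hsb : s = ⊥
    · rwa [hsb]
    · obtain ⟨l, hl, hsub⟩ := exists_Ioc_subset_of_mem_nhds ((hγ s).1.mem_nhds (hγ s).2)
        ⟨⊥, bot_lt_iff_ne_bot.2 hsb⟩
      obtain ⟨x, hx, hlx⟩ := lt_sSup_iff.1 hl
      have hxs : x ≤ s := le_sSup hx
      exact step x s s hx hxs ⟨hxs, le_rfl⟩ fun y hy => hsub ⟨hlx.trans_le hy.1, hy.2⟩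
  have hst : s = ⊤ := by
    by_contra hne
    obtain ⟨l, hl, hsub⟩ := exists_Ico_subset_of_mem_nhds ((hγ s).1.mem_nhds (hγ s).2)
      ⟨⊤, lt_top_iff_ne_top.2 hne⟩
    obtain ⟨y, hy, hyl⟩ := exists_between hl
    have : y ∈ S := step s y s hsS hy.le ⟨le_rfl, hy.le⟩ fun w hw => hsub ⟨hw.1, hw.2.trans_lt hyl⟩
    exact absurd (le_sSup this) (not_le.2 hy)
  exact hst ▸ hsS

/-- Cousin's lemma on the extended plane. -/
theorem exists_fine_isDiv {γ : EReal × EReal → Set (EReal × EReal)}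
    (hγ : ∀ p, IsOpen (γ p) ∧ p ∈ γ p) :
    ∃ (n : ℕ) (I : Fin n → ExtRect) (z : Fin n → EReal × EReal), IsDivision extPlane I ∧
      ∀ i, z i ∈ (I i).carrier ∧ (I i).carrier ⊆ γ (z i) := by
  have hUV : ∀ x y, ∃ U V : Set EReal, IsOpen U ∧ IsOpen V ∧ x ∈ U ∧ y ∈ V ∧
      U ×ˢ V ⊆ γ (x, y) := fun x y => isOpen_prod_iff.1 (hγ (x, y)).1 x y (hγ (x, y)).2
  choose U V hU hV hxU hyV hsub using hUV
  -- For each x, Cousin's lemma on the vertical line through x gives finitely many tags. The finite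
  -- intersection of the corresponding neighbourhoods of x is the gauge for the horizontal line.
  choose m t ht h0 hm z hz hzγ using fun x => exists_fine_seq fun y => ⟨hV x y, hyV x y⟩
  obtain ⟨n, s, hs, hs0, hsn, hs'⟩ := exists_fine_seq
    (γ := fun x => ⋂ j : Fin (m x), U x (z x j j.2)) fun x =>
      ⟨isOpen_iInter_of_finite fun j => hU _ _, mem_iInter.2 fun j => hxU _ _⟩
  choose w hw hwγ using hs'
  have hdiv := (isLineDiv_of_monotone hs hs0 hsn).prod
    (κ := fun i : Fin n => Fin (m (w i i.2))) (fun i => isLineDiv_of_monotone (ht (w i i.2)) (h0 _) (hm _))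
  let e := (Fintype.equivFin (Σ i : Fin n, Fin (m (w i i.2)))).symm
  refine ⟨_, _, fun k => (w _ (e k).1.2, z _ _ (e k).2.2), hdiv.comp_equiv e, fun k => ⟨?_, ?_⟩⟩
  · exact ⟨hw _ (e k).1.2, hz _ _ (e k).2.2⟩
  · intro p hp
    exact hsub _ _ ⟨mem_iInter.1 (hwγ _ (e k).1.2 hp.1) (e k).2, hzγ _ _ (e k).2.2 hp.2⟩

theorem exists_small_oscillation {F : EReal × EReal → ℝ} (hF : Continuous F) {δ : ℝ}
    (hδ : 0 < δ) : ∃ (n : ℕ) (I : Fin n → ExtRect), IsDiv extPlane I ∧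
      ∀ i, ∀ p ∈ (I i).carrier, ∀ q ∈ (I i).carrier, |F p - F q| ≤ δ := by
  obtain ⟨n, I, z, hI, hz⟩ := exists_fine_isDiv
    (γ := fun p => {q | |F q - F p| < δ / 2}) fun p =>
      ⟨isOpen_lt (by fun_prop) continuous_const, by simp [hδ]⟩
  refine ⟨n, I, hI, fun i p hp q hq => ?_⟩
  have h1 : |F p - F (z i)| < δ / 2 := (hz i).2 hp
  have h2 : |F q - F (z i)| < δ / 2 := (hz i).2 hq
  rw [abs_sub_comm] at h2
  have := abs_sub_le (F p) (F (z i)) (F q)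
  linarith

theorem exists_small_oscillation_line {φ : EReal → ℝ} (hφ : Continuous φ) {δ : ℝ}
    (hδ : 0 < δ) : ∃ (n : ℕ) (t : ℕ → EReal), Monotone t ∧ t 0 = ⊥ ∧ t n = ⊤ ∧
      ∀ i < n, ∀ x ∈ Icc (t i) (t (i + 1)), ∀ y ∈ Icc (t i) (t (i + 1)), |φ x - φ y| ≤ δ := by
  obtain ⟨n, t, ht, h0, hn, h⟩ := exists_fine_seq
    (γ := fun p => {q | |φ q - φ p| < δ / 2}) fun p =>
      ⟨isOpen_lt (by fun_prop) continuous_const, by simp [hδ]⟩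
  refine ⟨n, t, ht, h0, hn, fun i hi p hp q hq => ?_⟩
  obtain ⟨z, -, hz⟩ := h i hi
  have h1 : |φ p - φ z| < δ / 2 := hz hp
  have h2 : |φ q - φ z| < δ / 2 := hz hq
  rw [abs_sub_comm] at h2
  have := abs_sub_le (φ p) (φ z) (φ q)
  linarith

/-! ### Existence and uniqueness of Stieltjes integrals on the plane -/

/-- `A` approximates the Riemann--Stieltjes sums of `∫ F d₁₂g` to within the oscillation of `F` on
the intervals of the division, times the variation of `g`. -/
def IsRiemannLimit (F g : EReal × EReal → ℝ) (A : ℝ) : Prop :=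
  ∀ (ι : Type) [Fintype ι] (I : ι → ExtRect) (z : ι → EReal × EReal) (δ : ℝ), IsDiv extPlane I →
    (∀ i, z i ∈ (I i).carrier) → (∀ i, ∀ p ∈ (I i).carrier, |F p - F (z i)| ≤ δ) →
    |∑ i, F (z i) * (I i).incr g - A| ≤ δ * (vitaliVariation g).toReal

/-- Degenerate intervals have zero increment. This matters for clamped cells, which may lie outside
one of the two intervals when these do not meet. -/
theorem exists_mem_openPart_of_incr_ne_zero {R : ExtRect} {g : EReal × EReal → ℝ}
    (h1 : R.a ≤ R.b) (h2 : R.c ≤ R.d) (h : R.incr g ≠ 0) : ∃ p, p ∈ R.openPart := by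
  have hab : R.a < R.b := h1.lt_of_ne fun e => h (by simp only [ExtRect.incr, e]; ring)
  have hcd : R.c < R.d := h2.lt_of_ne fun e => h (by simp only [ExtRect.incr, e]; ring)
  obtain ⟨x, hx⟩ := exists_between hab
  obtain ⟨y, hy⟩ := exists_between hcd
  exact ⟨(x, y), hx, hy⟩

/-- Both sums are rewritten over the common refinement. A cell with nonzero increment has a point
common to both parent intervals, so there the two tag values of F differ by at most δ + η. -/
theorem abs_riemannSum_sub_le {F g : EReal × EReal → ℝ} (hg : vitaliVariation g < ∞)
    {ι κ : Type*} [Fintype ι] [Fintype κ] {I : ι → ExtRect} {K : κ → ExtRect}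
    {z : ι → EReal × EReal} {w : κ → EReal × EReal} {δ η : ℝ} (hI : IsDiv extPlane I)
    (hK : IsDiv extPlane K) (hz : ∀ i, ∀ p ∈ (I i).carrier, |F p - F (z i)| ≤ δ)
    (hw : ∀ k, ∀ p ∈ (K k).carrier, |F p - F (w k)| ≤ η) (hδ : 0 ≤ δ) (hη : 0 ≤ η) :
    |∑ i, F (z i) * (I i).incr g - ∑ k, F (w k) * (K k).incr g| ≤
      (δ + η) * (vitaliVariation g).toReal := by
  have e1 : ∀ i, (I i).incr g = ∑ k, ((I i).clamp (K k)).incr g := fun i => by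
    rw [← (hK.clamp (hI.1 i).1 (hI.1 i).2 (subset_extPlane _)).sum_incr (hI.1 i).1 (hI.1 i).2]
    exact Finset.sum_congr rfl fun k _ =>
      incr_clamp_comm (hK.1 k).1 (hK.1 k).2 (hI.1 i).1 (hI.1 i).2 g
  have e2 : ∀ k, (K k).incr g = ∑ i, ((I i).clamp (K k)).incr g := fun k =>
    ((hI.clamp (hK.1 k).1 (hK.1 k).2 (subset_extPlane _)).sum_incr (hK.1 k).1 (hK.1 k).2 g).symm
  have e3 : ∑ i, F (z i) * (I i).incr g - ∑ k, F (w k) * (K k).incr g =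
      ∑ q : ι × κ, (F (z q.1) - F (w q.2)) * ((I q.1).clamp (K q.2)).incr g := by
    simp_rw [sub_mul]
    rw [Finset.sum_sub_distrib]
    congr 1
    · rw [Fintype.sum_prod_type]
      refine Finset.sum_congr rfl fun i _ => ?_
      rw [e1, Finset.mul_sum]
    · rw [Fintype.sum_prod_type_right]
      refine Finset.sum_congr rfl fun k _ => ?_
      rw [e2, Finset.mul_sum]
  rw [e3]
  have hdiv := hI.refine hK
  calc |∑ q : ι × κ, (F (z q.1) - F (w q.2)) * ((I q.1).clamp (K q.2)).incr g|
      ≤ ∑ q : ι × κ, |(F (z q.1) - F (w q.2)) * ((I q.1).clamp (K q.2)).incr g| :=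
        Finset.abs_sum_le_sum_abs _ _
    _ ≤ ∑ q : ι × κ, (δ + η) * |((I q.1).clamp (K q.2)).incr g| := by
        refine Finset.sum_le_sum fun q _ => ?_
        rw [abs_mul]
        by_cases h0 : ((I q.1).clamp (K q.2)).incr g = 0
        · simp [h0]
        · obtain ⟨p, hp⟩ := exists_mem_openPart_of_incr_ne_zero (hdiv.1 q).1 (hdiv.1 q).2 h0
          have p1 := clamp_Ioo_subset (hK.1 q.2).1 hp.1
          have p2 := clamp_Ioo_subset (hK.1 q.2).2 hp.2
          have h1 := hz q.1 p ⟨Ioo_subset_Icc_self p1.1, Ioo_subset_Icc_self p2.1⟩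
          have h2 := hw q.2 p ⟨Ioo_subset_Icc_self p1.2, Ioo_subset_Icc_self p2.2⟩
          rw [abs_sub_comm] at h1
          have h3 := abs_sub_le (F (z q.1)) (F p) (F (w q.2))
          exact mul_le_mul_of_nonneg_right (by linarith) (abs_nonneg _)
    _ ≤ _ := by
        rw [← Finset.mul_sum]
        exact mul_le_mul_of_nonneg_left (hdiv.sum_abs_le_vitaliVariation hg) (by linarith)

theorem IsDiv.nonempty {ι : Type*} {I : ι → ExtRect} (h : IsDiv extPlane I) : Nonempty ι := by
  have : ((⊥, ⊥) : EReal × EReal) ∈ ⋃ i, (I i).carrier := h.2.2 ▸ subset_extPlane univ (mem_univ _)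
  exact ⟨(mem_iUnion.1 this).choose⟩

theorem IsDiv.lowerLeft_mem {ι : Type*} {R : ExtRect} {I : ι → ExtRect} (h : IsDiv R I) (i : ι) :
    ((I i).a, (I i).c) ∈ (I i).carrier :=
  ⟨⟨le_rfl, (h.1 i).1⟩, ⟨le_rfl, (h.1 i).2⟩⟩

theorem IsDiv.upperRight_mem {ι : Type*} {R : ExtRect} {I : ι → ExtRect} (h : IsDiv R I) (i : ι) :
    ((I i).b, (I i).d) ∈ (I i).carrier :=
  ⟨⟨(h.1 i).1, le_rfl⟩, ⟨(h.1 i).2, le_rfl⟩⟩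

/-- The Riemann sums along divisions of oscillation 1/(n+1) form a Cauchy sequence, and every other
sum is compared with them. -/
theorem exists_isRiemannLimit {F g : EReal × EReal → ℝ} (hF : Continuous F)
    (hg : vitaliVariation g < ∞) : ∃ A, IsRiemannLimit F g A := by
  have hpos : ∀ n : ℕ, (0 : ℝ) < 1 / ((n : ℝ) + 1) := fun n => by positivity
  choose m I hI hosc using fun n => exists_small_oscillation hF (hpos n)
  set V := (vitaliVariation g).toReal with hV
  have hV0 : 0 ≤ V := ENNReal.toReal_nonneg
  let S : ℕ → ℝ := fun n => ∑ i, F ((I n i).a, (I n i).c) * (I n i).incr g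
  have hlim : Tendsto (fun n : ℕ => 1 / ((n : ℝ) + 1)) atTop (𝓝 0) :=
    tendsto_one_div_add_atTop_nhds_zero_nat
  have hSS : ∀ k l, |S k - S l| ≤ (1 / ((k : ℝ) + 1) + 1 / ((l : ℝ) + 1)) * V := fun k l =>
    abs_riemannSum_sub_le hg (hI k) (hI l) (fun i p hp => hosc k i p hp _ ((hI k).lowerLeft_mem i))
      (fun i p hp => hosc l i p hp _ ((hI l).lowerLeft_mem i)) (hpos k).le (hpos l).le
  have hcau : CauchySeq S := by
    refine cauchySeq_of_le_tendsto_0 (fun n => (1 / ((n : ℝ) + 1) + 1 / ((n : ℝ) + 1)) * V) ?_ ?_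
    · intro k l N hk hl
      rw [Real.dist_eq]
      refine (hSS k l).trans (mul_le_mul_of_nonneg_right (add_le_add ?_ ?_) hV0)
      · exact one_div_le_one_div_of_le (by positivity) (by exact_mod_cast Nat.succ_le_succ hk)
      · exact one_div_le_one_div_of_le (by positivity) (by exact_mod_cast Nat.succ_le_succ hl)
    · simpa using (hlim.add hlim).mul_const V
  obtain ⟨A, hA⟩ := cauchySeq_tendsto_of_complete hcau
  refine ⟨A, fun ι _ J z δ hJ hz hδ => ?_⟩
  have hδ0 : 0 ≤ δ := (abs_nonneg _).trans (hδ hJ.nonempty.some _ (hz _))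
  have h1 : ∀ n, |∑ i, F (z i) * (J i).incr g - S n| ≤ (δ + 1 / ((n : ℝ) + 1)) * V := fun n =>
    abs_riemannSum_sub_le hg hJ (hI n) hδ
      (fun i p hp => hosc n i p hp _ ((hI n).lowerLeft_mem i)) hδ0 (hpos n).le
  have h2 : Tendsto (fun n => |∑ i, F (z i) * (J i).incr g - S n|) atTop
      (𝓝 |∑ i, F (z i) * (J i).incr g - A|) := (tendsto_const_nhds.sub hA).abs
  have h3 : Tendsto (fun n : ℕ => (δ + 1 / ((n : ℝ) + 1)) * V) atTop (𝓝 (δ * V)) := by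
    simpa using (hlim.const_add δ).mul_const V
  exact le_of_tendsto_of_tendsto' h2 h3 h1

theorem IsRiemannLimit.hasHS2 {F g : EReal × EReal → ℝ} (hF : Continuous F) {A : ℝ}
    (h : IsRiemannLimit F g A) : HasHS2 F g extPlane A := by
  intro ε hε
  set V := (vitaliVariation g).toReal with hV
  have hV0 : 0 ≤ V := ENNReal.toReal_nonneg
  let U : Set (EReal × EReal) := Ioo (⊥ : EReal) ⊤ ×ˢ Ioo (⊥ : EReal) ⊤
  have hδ : 0 < ε / (V + 1) := by positivity
  -- The gauge makes F oscillate by less than ε/(V+1) about the tag; V + 1 allows V = 0 and makes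
  -- the final inequality strict. The second set confines neighbourhoods of real points to real
  -- points.
  refine ⟨fun p => {q | |F q - F p| < ε / (V + 1)} ∩ {q | p ∈ U → q ∈ U}, fun p => ⟨?_, ?_, ?_⟩, ?_⟩
  · refine (isOpen_lt (by fun_prop) continuous_const).inter ?_
    by_cases hp : p ∈ U
    · simpa [hp] using isOpen_Ioo.prod isOpen_Ioo
    · simp [hp]
  · simp [hδ]
  · exact fun hp q hq => hq.2 hp
  · intro n I z hI hz
    have := h (Fin n) I z (ε / (V + 1)) hI (fun i => (hz i).1) fun i p hp => ((hz i).2 hp).1.le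
    refine this.trans_lt ?_
    rw [div_mul_eq_mul_div, div_lt_iff₀ (by positivity)]
    nlinarith

/-- Cousin's lemma provides a division fine for both gauges, and its sum is close to both values. -/
theorem HasHS2.unique {F g : EReal × EReal → ℝ} {A B : ℝ} (hA : HasHS2 F g extPlane A)
    (hB : HasHS2 F g extPlane B) : A = B := by
  by_contra hne
  have hpos : 0 < |A - B| / 2 := by have := abs_pos.2 (sub_ne_zero.2 hne); linarith
  obtain ⟨γ, hγ, h⟩ := hA _ hpos
  obtain ⟨γ', hγ', h'⟩ := hB _ hpos
  obtain ⟨n, I, z, hI, hz⟩ := exists_fine_isDiv (γ := fun p => γ p ∩ γ' p) fun p =>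
    ⟨(hγ p).1.inter (hγ' p).1, (hγ p).2.1, (hγ' p).2.1⟩
  have h1 := h n I z hI fun i => ⟨(hz i).1, (hz i).2.trans inter_subset_left⟩
  have h2 := h' n I z hI fun i => ⟨(hz i).1, (hz i).2.trans inter_subset_right⟩
  rw [abs_sub_comm] at h1
  have h3 := abs_sub_le A (∑ i, F (z i) * (I i).incr g) B
  linarith

theorem IsGauge2.inter {γ γ' : EReal × EReal → Set (EReal × EReal)} (h : IsGauge2 γ)
    (h' : IsGauge2 γ') : IsGauge2 fun p => γ p ∩ γ' p := fun p =>
  ⟨(h p).1.inter (h' p).1, ⟨(h p).2.1, (h' p).2.1⟩,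
    fun hp => inter_subset_left.trans ((h p).2.2 hp)⟩

/-- The relation is required of single summands, so the lemma serves linearity in the integrand and
in the integrator alike. -/
theorem HasHS2.linear {F g F' g' F'' g'' : EReal × EReal → ℝ} {R : ExtRect} {A A' c c' : ℝ}
    (h : HasHS2 F g R A) (h' : HasHS2 F' g' R A')
    (hlin : ∀ z (Q : ExtRect), F'' z * Q.incr g'' = c * (F z * Q.incr g) + c' * (F' z * Q.incr g')) :
    HasHS2 F'' g'' R (c * A + c' * A') := by
  intro ε hε
  have hpos : 0 < ε / (|c| + |c'| + 1) := by positivity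
  obtain ⟨γ, hγ, h1⟩ := h _ hpos
  obtain ⟨γ', hγ', h2⟩ := h' _ hpos
  refine ⟨_, hγ.inter hγ', fun n I z hI hz => ?_⟩
  have h3 := h1 n I z hI fun i => ⟨(hz i).1, (hz i).2.trans inter_subset_left⟩
  have h4 := h2 n I z hI fun i => ⟨(hz i).1, (hz i).2.trans inter_subset_right⟩
  have e : ∑ i, F'' (z i) * (I i).incr g'' - (c * A + c' * A') =
      c * (∑ i, F (z i) * (I i).incr g - A) + c' * (∑ i, F' (z i) * (I i).incr g' - A') := by
    simp_rw [hlin, Finset.sum_add_distrib, ← Finset.mul_sum]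
    ring
  rw [e]
  calc _ ≤ |c| * |∑ i, F (z i) * (I i).incr g - A| + |c'| * |∑ i, F' (z i) * (I i).incr g' - A'| := by
        rw [← abs_mul, ← abs_mul]; exact abs_add_le _ _
    _ ≤ |c| * (ε / (|c| + |c'| + 1)) + |c'| * (ε / (|c| + |c'| + 1)) := by gcongr
    _ < ε := by
        rw [← add_mul, mul_div_assoc', div_lt_iff₀ (by positivity)]
        nlinarith [abs_nonneg c, abs_nonneg c']

/-! ### The Stieltjes integral as a bilinear functional -/

open Classical in
/-- The Stieltjes integral of a continuous function `F` with respect to `d₁₂g` over the extended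
plane (`0` if it does not exist). -/
noncomputable def stieltjes (F : C(EReal × EReal, ℝ)) (g : EReal × EReal → ℝ) : ℝ :=
  if h : ∃ A, HasHS2 F g extPlane A then h.choose else 0

theorem HasHS2.stieltjes_eq {F : C(EReal × EReal, ℝ)} {g : EReal × EReal → ℝ} {A : ℝ}
    (h : HasHS2 F g extPlane A) : stieltjes F g = A := by
  have hex : ∃ A, HasHS2 F g extPlane A := ⟨A, h⟩
  rw [stieltjes, dif_pos hex]
  exact hex.choose_spec.unique h

section

variable {g g' : EReal × EReal → ℝ}

theorem isRiemannLimit_stieltjes (F : C(EReal × EReal, ℝ)) (hg : vitaliVariation g < ∞) :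
    IsRiemannLimit F g (stieltjes F g) := by
  obtain ⟨A, hA⟩ := exists_isRiemannLimit F.continuous hg
  rwa [(hA.hasHS2 F.continuous).stieltjes_eq]

theorem hasHS2_stieltjes (F : C(EReal × EReal, ℝ)) (hg : vitaliVariation g < ∞) :
    HasHS2 F g extPlane (stieltjes F g) :=
  (isRiemannLimit_stieltjes F hg).hasHS2 F.continuous

theorem stieltjes_add (F F' : C(EReal × EReal, ℝ)) (hg : vitaliVariation g < ∞) :
    stieltjes (F + F') g = stieltjes F g + stieltjes F' g := by
  have := (hasHS2_stieltjes F hg).linear (F'' := (F + F' : C(EReal × EReal, ℝ))) (g'' := g)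
    (c := 1) (c' := 1) (hasHS2_stieltjes F' hg)
    fun z Q => by simp only [ContinuousMap.add_apply]; ring
  simpa using this.stieltjes_eq

theorem stieltjes_smul (c : ℝ) (F : C(EReal × EReal, ℝ)) (hg : vitaliVariation g < ∞) :
    stieltjes (c • F) g = c * stieltjes F g := by
  have := (hasHS2_stieltjes F hg).linear (F'' := (c • F : C(EReal × EReal, ℝ))) (g'' := g)
    (c := c) (c' := 0) (hasHS2_stieltjes F hg)
    fun z Q => by simp only [ContinuousMap.smul_apply, smul_eq_mul]; ring
  simpa using this.stieltjes_eq

theorem stieltjes_sub (F F' : C(EReal × EReal, ℝ)) (hg : vitaliVariation g < ∞) :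
    stieltjes (F - F') g = stieltjes F g - stieltjes F' g := by
  have := (hasHS2_stieltjes F hg).linear (F'' := (F - F' : C(EReal × EReal, ℝ))) (g'' := g)
    (c := 1) (c' := -1) (hasHS2_stieltjes F' hg)
    fun z Q => by simp only [ContinuousMap.sub_apply]; ring
  simpa [← sub_eq_add_neg] using this.stieltjes_eq

theorem stieltjes_add_right (F : C(EReal × EReal, ℝ)) (hg : vitaliVariation g < ∞)
    (hg' : vitaliVariation g' < ∞) :
    stieltjes F (g + g') = stieltjes F g + stieltjes F g' := by
  have := (hasHS2_stieltjes F hg).linear (F'' := F) (g'' := g + g')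
    (c := 1) (c' := 1) (hasHS2_stieltjes F hg')
    fun z Q => by rw [ExtRect.incr_add]; ring
  simpa using this.stieltjes_eq

theorem stieltjes_sub_right (F : C(EReal × EReal, ℝ)) (hg : vitaliVariation g < ∞)
    (hg' : vitaliVariation g' < ∞) :
    stieltjes F (g - g') = stieltjes F g - stieltjes F g' := by
  have := (hasHS2_stieltjes F hg).linear (F'' := F) (g'' := g - g')
    (c := 1) (c' := -1) (hasHS2_stieltjes F hg')
    fun z Q => by rw [ExtRect.incr_sub]; ring
  simpa [← sub_eq_add_neg] using this.stieltjes_eq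

/-- A Stieltjes integral can be computed from tags chosen in sufficiently fine divisions. -/
theorem stieltjes_eq_of_forall_div (F : C(EReal × EReal, ℝ)) (hg : vitaliVariation g < ∞) {A : ℝ}
    (h : ∀ δ > 0, ∃ (ι : Type) (_ : Fintype ι) (I : ι → ExtRect) (z : ι → EReal × EReal),
      IsDiv extPlane I ∧ (∀ i, z i ∈ (I i).carrier) ∧
      (∀ i, ∀ p ∈ (I i).carrier, |F p - F (z i)| ≤ δ) ∧
      |∑ i, F (z i) * (I i).incr g - A| ≤ δ * (vitaliVariation g).toReal) :
    stieltjes F g = A := by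
  set V := (vitaliVariation g).toReal with hV
  have hV0 : 0 ≤ V := ENNReal.toReal_nonneg
  refine eq_of_abs_sub_le_all fun ε hε => ?_
  obtain ⟨ι, _, I, z, hI, hz, hδ, hA⟩ := h (ε / (2 * (V + 1))) (by positivity)
  have h1 := isRiemannLimit_stieltjes F hg ι I z _ hI hz hδ
  rw [abs_sub_comm] at h1
  have h2 := abs_sub_le (stieltjes F g) (∑ i, F (z i) * (I i).incr g) A
  have h3 : ε / (2 * (V + 1)) * V ≤ ε / 2 := by
    rw [div_mul_eq_mul_div, div_le_div_iff₀ (by positivity) (by positivity)]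
    nlinarith
  linarith

theorem abs_stieltjes_le (F : C(EReal × EReal, ℝ)) (hg : vitaliVariation g < ∞) :
    |stieltjes F g| ≤ ‖F‖ * (vitaliVariation g).toReal := by
  set V := (vitaliVariation g).toReal with hV
  have hV0 : 0 ≤ V := ENNReal.toReal_nonneg
  refine le_of_forall_pos_le_add fun ε hε => ?_
  obtain ⟨n, I, hI, hosc⟩ := exists_small_oscillation F.continuous
    (show 0 < ε / (V + 1) by positivity)
  have h1 := isRiemannLimit_stieltjes F hg (Fin n) I (fun i => ((I i).a, (I i).c)) _ hI
    hI.lowerLeft_mem fun i p hp => hosc i p hp _ (hI.lowerLeft_mem i)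
  have h2 : |∑ i, F ((I i).a, (I i).c) * (I i).incr g| ≤ ‖F‖ * V := by
    calc _ ≤ ∑ i, |F ((I i).a, (I i).c) * (I i).incr g| := Finset.abs_sum_le_sum_abs _ _
      _ ≤ ∑ i, ‖F‖ * |(I i).incr g| := by
        refine Finset.sum_le_sum fun i _ => ?_
        rw [abs_mul]
        exact mul_le_mul_of_nonneg_right (F.norm_coe_le_norm _) (abs_nonneg _)
      _ ≤ _ := by
        rw [← Finset.mul_sum]
        exact mul_le_mul_of_nonneg_left (hI.sum_abs_le_vitaliVariation hg) (norm_nonneg _)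
  have h3 : ε / (V + 1) * V ≤ ε := by
    rw [div_mul_eq_mul_div, div_le_iff₀ (by positivity)]
    nlinarith
  have h4 := abs_sub_abs_le_abs_sub (stieltjes F g) (∑ i, F ((I i).a, (I i).c) * (I i).incr g)
  rw [abs_sub_comm (stieltjes F g)] at h4
  linarith

end

/-! ### Reflections and exchange of the coordinates -/

/-- The point x is real, so x − (±∞) = ∓∞ and the involution extends to the infinite points. -/
theorem reflection_reflection (x : ℝ) (s : EReal) : (x : EReal) - ((x : EReal) - s) = s := by
  induction s with
  | bot => simp
  | coe s => norm_cast; rw [sub_sub_cancel]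
  | top => simp

theorem reflection_involutive (x : ℝ) : Function.Involutive fun s : EReal => (x : EReal) - s :=
  reflection_reflection x

theorem reflection_antitone (x : ℝ) : Antitone fun s : EReal => (x : EReal) - s :=
  fun _ _ h => EReal.sub_le_sub le_rfl h

theorem reflection_le_iff (x : ℝ) {s t : EReal} : (x : EReal) - s ≤ t ↔ (x : EReal) - t ≤ s := by
  constructor <;> intro h
  · simpa only [reflection_involutive x s] using reflection_antitone x h
  · simpa only [reflection_involutive x t] using reflection_antitone x h

theorem le_reflection_iff (x : ℝ) {s t : EReal} : s ≤ (x : EReal) - t ↔ t ≤ (x : EReal) - s := by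
  constructor <;> intro h
  · simpa only [reflection_involutive x t] using reflection_antitone x h
  · simpa only [reflection_involutive x s] using reflection_antitone x h

theorem reflection_lt_iff (x : ℝ) {s t : EReal} : (x : EReal) - s < t ↔ (x : EReal) - t < s := by
  rw [← not_le, le_reflection_iff, not_le]

theorem lt_reflection_iff (x : ℝ) {s t : EReal} : s < (x : EReal) - t ↔ t < (x : EReal) - s := by
  rw [← not_le, reflection_le_iff, not_le]

theorem continuous_reflection (x : ℝ) : Continuous fun s : EReal => (x : EReal) - s := by
  rw [continuous_iff_continuousAt]
  intro s
  have h : ContinuousAt (fun p : EReal × EReal => p.1 + p.2) ((x : EReal), -s) :=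
    EReal.continuousAt_add (Or.inl (EReal.coe_ne_top x)) (Or.inl (EReal.coe_ne_bot x))
  exact ContinuousAt.comp (f := fun s : EReal => ((x : EReal), -s)) h (by fun_prop)

theorem reflection_eq_bot_iff (x : ℝ) {s : EReal} : (x : EReal) - s = ⊥ ↔ s = ⊤ := by
  rw [(reflection_involutive x).eq_iff]; simp

theorem reflection_eq_top_iff (x : ℝ) {s : EReal} : (x : EReal) - s = ⊤ ↔ s = ⊥ := by
  rw [(reflection_involutive x).eq_iff]; simp

/-- The point reflection `q ↦ p - q` of the extended plane. -/
noncomputable def pointReflection (p : ℝ × ℝ) (q : EReal × EReal) : EReal × EReal :=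
  ((p.1 : EReal) - q.1, (p.2 : EReal) - q.2)

theorem pointReflection_involutive (p : ℝ × ℝ) : Function.Involutive (pointReflection p) :=
  fun q => Prod.ext (reflection_involutive p.1 q.1) (reflection_involutive p.2 q.2)

theorem continuous_pointReflection (p : ℝ × ℝ) : Continuous (pointReflection p) :=
  ((continuous_reflection p.1).comp continuous_fst).prodMk
    ((continuous_reflection p.2).comp continuous_snd)

theorem pointReflection_toExt (p q : ℝ × ℝ) : pointReflection p (toExt q) = toExt (p - q) := by
  simp [pointReflection, toExt]

theorem reflectFun_eq (g : EReal × EReal → ℝ) (p : ℝ × ℝ) :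
    reflectFun g p = g ∘ pointReflection p := rfl

/-- The image of an interval under a point reflection. -/
noncomputable def ExtRect.reflect (p : ℝ × ℝ) (R : ExtRect) : ExtRect :=
  ⟨(p.1 : EReal) - R.b, (p.1 : EReal) - R.a, (p.2 : EReal) - R.d, (p.2 : EReal) - R.c⟩

theorem mem_carrier_reflect {p : ℝ × ℝ} {R : ExtRect} {q : EReal × EReal} :
    q ∈ (R.reflect p).carrier ↔ pointReflection p q ∈ R.carrier := by
  simp only [ExtRect.carrier, ExtRect.reflect, pointReflection, mem_prod, mem_Icc]
  rw [reflection_le_iff p.1 (s := R.b), le_reflection_iff p.1 (t := R.a),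
    reflection_le_iff p.2 (s := R.d), le_reflection_iff p.2 (t := R.c)]
  tauto

theorem mem_openPart_reflect {p : ℝ × ℝ} {R : ExtRect} {q : EReal × EReal} :
    q ∈ (R.reflect p).openPart ↔ pointReflection p q ∈ R.openPart := by
  simp only [ExtRect.openPart, ExtRect.reflect, pointReflection, mem_prod, mem_Ioo]
  rw [reflection_lt_iff p.1 (s := R.b), lt_reflection_iff p.1 (t := R.a),
    reflection_lt_iff p.2 (s := R.d), lt_reflection_iff p.2 (t := R.c)]
  tauto

theorem incr_reflect (p : ℝ × ℝ) (R : ExtRect) (g : EReal × EReal → ℝ) :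
    (R.reflect p).incr g = R.incr (reflectFun g p) := by
  simp only [ExtRect.incr, ExtRect.reflect, reflectFun]; ring

theorem IsDiv.reflect {ι : Type*} {I : ι → ExtRect} (h : IsDiv extPlane I) (p : ℝ × ℝ) :
    IsDiv extPlane fun i => (I i).reflect p := by
  refine ⟨fun i => ⟨reflection_antitone _ (h.1 i).1, reflection_antitone _ (h.1 i).2⟩, ?_, ?_⟩
  · intro i j hij
    rw [disjoint_left]
    intro q hq hq'
    exact disjoint_left.1 (h.2.1 i j hij) (mem_openPart_reflect.1 hq) (mem_openPart_reflect.1 hq')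
  · refine subset_antisymm (subset_extPlane _) fun q _ => ?_
    have : pointReflection p q ∈ ⋃ i, (I i).carrier := h.2.2 ▸ subset_extPlane univ (mem_univ _)
    obtain ⟨i, hi⟩ := mem_iUnion.1 this
    exact mem_iUnion.2 ⟨i, mem_carrier_reflect.2 hi⟩

theorem vitaliVariation_reflectFun_le (g : EReal × EReal → ℝ) (p : ℝ × ℝ) :
    vitaliVariation (reflectFun g p) ≤ vitaliVariation g := by
  refine vitaliVariation_le fun n I hI => ?_
  have hI' : IsDiv extPlane I := hI
  simp_rw [← incr_reflect]
  exact (hI'.reflect p).sum_enorm_le_vitaliVariation g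

theorem variation1_reflectFun (g : EReal × EReal → ℝ) (p : ℝ × ℝ) (y : EReal) :
    variation1 (reflectFun g p) y = variation1 g ((p.2 : EReal) - y) := by
  have := eVariationOn.comp_eq_of_antitoneOn (fun x => g (x, (p.2 : EReal) - y)) (t := univ)
    (fun s : EReal => (p.1 : EReal) - s) ((reflection_antitone p.1).antitoneOn _)
  rwa [image_univ, (reflection_involutive p.1).surjective.range_eq] at this

theorem variation2_reflectFun (g : EReal × EReal → ℝ) (p : ℝ × ℝ) (x : EReal) :
    variation2 (reflectFun g p) x = variation2 g ((p.1 : EReal) - x) := by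
  have := eVariationOn.comp_eq_of_antitoneOn (fun y => g ((p.1 : EReal) - x, y)) (t := univ)
    (fun s : EReal => (p.2 : EReal) - s) ((reflection_antitone p.2).antitoneOn _)
  rwa [image_univ, (reflection_involutive p.2).surjective.range_eq] at this

theorem HKBV.reflectFun {g : EReal × EReal → ℝ} (hg : HKBV g) (p : ℝ × ℝ) :
    HKBV (reflectFun g p) := by
  obtain ⟨h, ⟨y, hy⟩, x, hx⟩ := hg
  refine ⟨(vitaliVariation_reflectFun_le g p).trans_lt h, ⟨(p.2 : EReal) - y, ?_⟩,
    (p.1 : EReal) - x, ?_⟩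
  · rwa [variation1_reflectFun, reflection_reflection]
  · rwa [variation2_reflectFun, reflection_reflection]

theorem bvENorm_reflectFun_le (g : EReal × EReal → ℝ) (p : ℝ × ℝ) :
    bvENorm (reflectFun g p) ≤ bvENorm g := by
  refine add_le_add (add_le_add (add_le_add ?_ ?_) ?_) (vitaliVariation_reflectFun_le g p)
  · exact iSup_le fun q => le_iSup (fun q => ‖g q‖ₑ) (pointReflection p q)
  · exact iSup_le fun y => (variation1_reflectFun g p y).le.trans (le_iSup (variation1 g) _)
  · exact iSup_le fun y => (variation2_reflectFun g p y).le.trans (le_iSup (variation2 g) _)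

/-- The image of an interval under the exchange of the coordinates. -/
def ExtRect.swap (R : ExtRect) : ExtRect := ⟨R.c, R.d, R.a, R.b⟩

theorem IsDiv.swap {ι : Type*} {I : ι → ExtRect} (h : IsDiv extPlane I) :
    IsDiv extPlane fun i => (I i).swap := by
  refine ⟨fun i => ⟨(h.1 i).2, (h.1 i).1⟩, fun i j hij => ?_, ?_⟩
  · rw [disjoint_left]
    intro q hq hq'
    exact disjoint_left.1 (h.2.1 i j hij) (show q.swap ∈ _ from ⟨hq.2, hq.1⟩) ⟨hq'.2, hq'.1⟩
  · refine subset_antisymm (subset_extPlane _) fun q _ => ?_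
    have : q.swap ∈ ⋃ i, (I i).carrier := h.2.2 ▸ subset_extPlane univ (mem_univ _)
    obtain ⟨i, hi⟩ := mem_iUnion.1 this
    exact mem_iUnion.2 ⟨i, hi.2, hi.1⟩

theorem vitaliVariation_swap_le (g : EReal × EReal → ℝ) :
    vitaliVariation (g ∘ Prod.swap) ≤ vitaliVariation g := by
  refine vitaliVariation_le fun n I hI => ?_
  have hI' : IsDiv extPlane I := hI
  have : ∀ R : ExtRect, R.incr (g ∘ Prod.swap) = R.swap.incr g := fun R => by
    simp only [ExtRect.incr, ExtRect.swap, Function.comp, Prod.swap]; ring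
  simp_rw [this]
  exact hI'.swap.sum_enorm_le_vitaliVariation g

theorem HKBV.swap {g : EReal × EReal → ℝ} (hg : HKBV g) : HKBV (g ∘ Prod.swap) :=
  ⟨(vitaliVariation_swap_le g).trans_lt hg.1, hg.2.2, hg.2.1⟩

/-! ### One-variable variations of functions of finite Hardy--Krause variation -/

/-- Each summand is the increment of `g` over the part of the i-th strip between the heights y₀ and
yᵢ. These rectangles lie in different strips, so they belong to one division even though the heights
vary with i. -/
theorem sum_enorm_increments_le (g : EReal × EReal → ℝ) (y₀ : EReal) {u : ℕ → EReal}
    (hu : Monotone u) (y : ℕ → EReal) (n : ℕ) :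
    ∑ i ∈ Finset.range n, ‖g (u (i + 1), y i) - g (u i, y i) -
      (g (u (i + 1), y₀) - g (u i, y₀))‖ₑ ≤ vitaliVariation g := by
  -- The points u₀, …, uₙ are framed by −∞ and +∞, so strip i of the sum is strip i + 1 of the
  -- division. This is the reason for the index i − 1 in `w`.
  let t : ℕ → EReal := fun k => if k = 0 then ⊥ else if k ≤ n + 1 then u (k - 1) else ⊤
  have ht : Monotone t := by
    refine monotone_nat_of_le_succ fun k => ?_
    by_cases h0 : k = 0
    · simp [t, h0]
    · by_cases h1 : k + 1 ≤ n + 1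
      · have h2 : k ≤ n + 1 := by omega
        simp only [t, h0, h1, h2, if_true, if_false, Nat.succ_ne_zero]
        exact hu (by omega)
      · simp [t, show ¬ k ≤ n by omega]
  let w : ℕ → ℕ → EReal := fun i j => if j = 0 then ⊥ else if j = 1 then min y₀ (y (i - 1)) else
    if j = 2 then max y₀ (y (i - 1)) else ⊤
  have hw : ∀ i, Monotone (w i) := fun i => by
    refine monotone_nat_of_le_succ fun j => ?_
    rcases j with _ | _ | _ | j
    · simp [w]
    · simp [w]
    · simp [w]
    · simp [w]
  have hdiv := (isLineDiv_of_monotone ht (n := n + 2) (by simp [t]) (by simp [t])).prod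
    (κ := fun _ => Fin 3) fun i => isLineDiv_of_monotone (hw i) (n := 3) (by simp [w]) (by simp [w])
  refine le_trans ?_ (hdiv.sum_enorm_le_vitaliVariation g)
  rw [Fintype.sum_sigma, Fin.sum_univ_succ]
  refine le_add_of_nonneg_of_le zero_le ?_
  rw [Fin.sum_univ_castSucc, Finset.sum_range]
  refine le_add_of_le_of_nonneg ?_ zero_le
  refine Finset.sum_le_sum fun i _ => ?_
  rw [Fin.sum_univ_three]
  refine le_add_of_le_of_nonneg (le_add_of_nonneg_of_le zero_le (le_of_eq ?_)) zero_le
  have e1 : (i : ℕ) + 1 ≤ n + 1 := by omega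
  have e2 : (i : ℕ) + 1 + 1 ≤ n + 1 := by omega
  simp only [ExtRect.incr, t, w, Fin.val_succ, Fin.val_castSucc, Fin.val_one, if_pos e1, if_pos e2,
    Nat.succ_ne_zero, if_false, Nat.add_sub_cancel, if_true, one_ne_zero]
  rcases le_total y₀ (y i) with h | h
  · simp only [min_eq_left h, max_eq_right h, Nat.reduceAdd, OfNat.ofNat_ne_one, if_false]
    congr 1; ring
  · simp only [min_eq_right h, max_eq_left h, Nat.reduceAdd, OfNat.ofNat_ne_one, if_false]
    rw [← enorm_neg]
    congr 1; ring

/-- Because the heights y i are arbitrary, this also controls the variation of x ↦ g(x, ·) in the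
uniform norm; see `HKBV.exists_modulus_fst`. -/
theorem sum_edist_le (g : EReal × EReal → ℝ) (y₀ : EReal) {u : ℕ → EReal}
    (hu : Monotone u) (y : ℕ → EReal) (n : ℕ) :
    ∑ i ∈ Finset.range n, edist (g (u (i + 1), y i)) (g (u i, y i)) ≤
      variation1 g y₀ + vitaliVariation g := by
  have h1 := eVariationOn.sum_le (f := fun x => g (x, y₀)) (s := univ) (n := n) hu (by simp)
  refine le_trans ?_ (add_le_add h1 (sum_enorm_increments_le g y₀ hu y n))
  rw [← Finset.sum_add_distrib]
  refine Finset.sum_le_sum fun i _ => ?_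
  rw [edist_eq_enorm_sub, edist_eq_enorm_sub]
  refine le_trans (le_of_eq ?_) (enorm_add_le _ _)
  congr 1; ring

theorem variation1_le (g : EReal × EReal → ℝ) (y₀ y : EReal) :
    variation1 g y ≤ variation1 g y₀ + vitaliVariation g :=
  iSup_le fun q => sum_edist_le g y₀ q.2.2.1 (fun _ => y) q.1

theorem variation2_le (g : EReal × EReal → ℝ) (x₀ x : EReal) :
    variation2 g x ≤ variation2 g x₀ + vitaliVariation g :=
  (variation1_le (g ∘ Prod.swap) x₀ x).trans (add_le_add le_rfl (vitaliVariation_swap_le g))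

theorem HKBV.variation1_lt_top {g : EReal × EReal → ℝ} (hg : HKBV g) (y : EReal) :
    variation1 g y < ∞ := by
  obtain ⟨h, ⟨y₀, hy⟩, -⟩ := hg
  exact (variation1_le g y₀ y).trans_lt (ENNReal.add_lt_top.2 ⟨hy, h⟩)

theorem HKBV.variation2_lt_top {g : EReal × EReal → ℝ} (hg : HKBV g) (x : EReal) :
    variation2 g x < ∞ := by
  obtain ⟨h, -, x₀, hx⟩ := hg
  exact (variation2_le g x₀ x).trans_lt (ENNReal.add_lt_top.2 ⟨hx, h⟩)

theorem HKBV.bvENorm_lt_top {g : EReal × EReal → ℝ} (hg : HKBV g) : bvENorm g < ∞ := by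
  have h1 : ⨆ y, variation1 g y < ∞ := (iSup_le fun y => variation1_le g ⊤ y).trans_lt
    (ENNReal.add_lt_top.2 ⟨hg.variation1_lt_top ⊤, hg.1⟩)
  have h2 : ⨆ x, variation2 g x < ∞ := (iSup_le fun x => variation2_le g ⊤ x).trans_lt
    (ENNReal.add_lt_top.2 ⟨hg.variation2_lt_top ⊤, hg.1⟩)
  have h3 : ⨆ p, ‖g p‖ₑ < ∞ := by
    -- Every point is joined to (+∞, +∞) by a vertical and then a horizontal segment.
    refine lt_of_le_of_lt (b := ‖g (⊤, ⊤)‖ₑ + (⨆ x, variation2 g x) + variation1 g ⊤) ?_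
      (ENNReal.add_lt_top.2 ⟨ENNReal.add_lt_top.2 ⟨enorm_lt_top, h2⟩, hg.variation1_lt_top ⊤⟩)
    refine iSup_le fun p => ?_
    have e1 : edist (g p) (g (p.1, ⊤)) ≤ variation2 g p.1 :=
      eVariationOn.edist_le (fun y => g (p.1, y)) (mem_univ p.2) (mem_univ ⊤)
    have e2 : edist (g (p.1, ⊤)) (g (⊤, ⊤)) ≤ variation1 g ⊤ :=
      eVariationOn.edist_le (fun x => g (x, ⊤)) (mem_univ p.1) (mem_univ ⊤)
    rw [edist_eq_enorm_sub] at e1 e2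
    calc ‖g p‖ₑ = ‖g (⊤, ⊤) + (g p - g (p.1, ⊤)) + (g (p.1, ⊤) - g (⊤, ⊤))‖ₑ := by congr 1; ring
      _ ≤ _ := (enorm_add_le _ _).trans (add_le_add (enorm_add_le _ _) le_rfl)
      _ ≤ _ := add_le_add (add_le_add le_rfl (e1.trans (le_iSup (variation2 g) _))) e2
  exact ENNReal.add_lt_top.2 ⟨ENNReal.add_lt_top.2 ⟨ENNReal.add_lt_top.2 ⟨h3, h1⟩, h2⟩, hg.1⟩

/-- The function α is the variation function of ψ from −∞. A general target space is needed for
values in a space of functions with the uniform distance. -/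
theorem exists_monotone_edist_bound {E : Type*} [PseudoEMetricSpace E] {ψ : EReal → E}
    (hψ : eVariationOn ψ univ < ∞) :
    ∃ α : EReal → ℝ, Monotone α ∧
      (∀ x y, x ≤ y → edist (ψ y) (ψ x) ≤ ENNReal.ofReal (α y - α x)) ∧
      ENNReal.ofReal (α ⊤ - α ⊥) ≤ eVariationOn ψ univ := by
  have hl : LocallyBoundedVariationOn ψ univ :=
    BoundedVariationOn.locallyBoundedVariationOn hψ.ne
  refine ⟨variationOnFromTo ψ univ ⊥, ?_, ?_, ?_⟩
  · exact monotoneOn_univ.1 (variationOnFromTo.monotoneOn hl (mem_univ _))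
  · intro x y hxy
    have := variationOnFromTo.add hl (mem_univ ⊥) (mem_univ x) (mem_univ y)
    rw [← this, add_sub_cancel_left, variationOnFromTo.eq_of_le _ _ hxy,
      ENNReal.ofReal_toReal (hl x y (mem_univ _) (mem_univ _))]
    exact eVariationOn.edist_le ψ ⟨mem_univ _, hxy, le_rfl⟩ ⟨mem_univ _, le_rfl, hxy⟩
  · rw [variationOnFromTo.self, sub_zero, variationOnFromTo.eq_of_le _ _ bot_le]
    exact ENNReal.ofReal_toReal_le.trans (eVariationOn.mono _ (subset_univ _))

theorem exists_monotone_bound {ψ : EReal → ℝ} (hψ : eVariationOn ψ univ < ∞) :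
    ∃ α : EReal → ℝ, Monotone α ∧ (∀ x y, x ≤ y → |ψ y - ψ x| ≤ α y - α x) ∧
      ENNReal.ofReal (α ⊤ - α ⊥) ≤ eVariationOn ψ univ := by
  obtain ⟨α, hα, h, h'⟩ := exists_monotone_edist_bound hψ
  refine ⟨α, hα, fun x y hxy => ?_, h'⟩
  have := h x y hxy
  rwa [edist_dist, ENNReal.ofReal_le_ofReal_iff (sub_nonneg.2 (hα hxy)), Real.dist_eq] at this

/-! ### Functions concentrated on the boundary of the extended plane -/

section

variable {g : EReal × EReal → ℝ}

open Classical in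
/-- The function `ψ` placed on the edge `{t = ⊤}`. -/
noncomputable def edgeFst (ψ : EReal → ℝ) (p : EReal × EReal) : ℝ := if p.2 = ⊤ then ψ p.1 else 0

open Classical in
/-- The function `ψ` placed on the edge `{s = ⊤}`. -/
noncomputable def edgeSnd (ψ : EReal → ℝ) (p : EReal × EReal) : ℝ := if p.1 = ⊤ then ψ p.2 else 0

open Classical in
/-- The function with value `c` at `(⊤, ⊤)` and zero elsewhere. -/
noncomputable def cornerFun (c : ℝ) (p : EReal × EReal) : ℝ := if p.1 = ⊤ ∧ p.2 = ⊤ then c else 0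

open Classical in
/-- The function `g` made zero on the edges `{s = ⊤}` and `{t = ⊤}`. -/
noncomputable def cutTop (g : EReal × EReal → ℝ) (p : EReal × EReal) : ℝ :=
  if p.1 = ⊤ ∨ p.2 = ⊤ then 0 else g p

open Classical in
/-- The function `g` made zero at all points that have an infinite coordinate. -/
noncomputable def cutReal (g : EReal × EReal → ℝ) (p : EReal × EReal) : ℝ :=
  if (p.1 = ⊤ ∨ p.2 = ⊤) ∨ (p.1 = ⊥ ∨ p.2 = ⊥) then 0 else g p

theorem cutReal_toExt (g : EReal × EReal → ℝ) (q : ℝ × ℝ) : cutReal g (toExt q) = g (toExt q) := by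
  simp [cutReal, toExt]

theorem cutTop_eq (g : EReal × EReal → ℝ) :
    cutTop g = g - edgeFst (fun s => g (s, ⊤)) - edgeSnd (fun t => g (⊤, t)) +
      cornerFun (g (⊤, ⊤)) := by
  ext ⟨s, t⟩
  simp only [cutTop, edgeFst, edgeSnd, cornerFun, Pi.add_apply, Pi.sub_apply]
  by_cases hs : s = ⊤ <;> by_cases ht : t = ⊤ <;> simp [hs, ht]

/-- Only intervals that reach the edge from below have a nonzero increment, and it is an increment
of ψ. The same function built from a monotone α dominates it. -/
theorem vitaliVariation_edgeFst_le {ψ : EReal → ℝ} (hψ : eVariationOn ψ univ < ∞) :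
    vitaliVariation (edgeFst ψ) ≤ eVariationOn ψ univ := by
  obtain ⟨α, hα, hb, htot⟩ := exists_monotone_bound hψ
  refine (vitaliVariation_le_incr (G := edgeFst α) fun R h1 h2 => ?_).trans ?_
  · have h3 := hb R.a R.b h1
    by_cases hd : R.d = ⊤
    · by_cases hc : R.c = ⊤
      · simp [ExtRect.incr, edgeFst, hd, hc]
      · simpa [ExtRect.incr, edgeFst, hd, hc] using h3
    · have hc : R.c ≠ ⊤ := fun h => hd (top_le_iff.1 (h ▸ h2))
      simp [ExtRect.incr, edgeFst, hd, hc]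
  · refine le_trans (le_of_eq ?_) htot
    simp [ExtRect.incr, edgeFst, extPlane]

theorem edgeSnd_eq (ψ : EReal → ℝ) : edgeSnd ψ = edgeFst ψ ∘ Prod.swap := rfl

theorem vitaliVariation_edgeSnd_le {ψ : EReal → ℝ} (hψ : eVariationOn ψ univ < ∞) :
    vitaliVariation (edgeSnd ψ) ≤ eVariationOn ψ univ := by
  rw [edgeSnd_eq]
  exact (vitaliVariation_swap_le _).trans (vitaliVariation_edgeFst_le hψ)

theorem incr_cornerFun {R : ExtRect} (h1 : R.a ≤ R.b) (h2 : R.c ≤ R.d) (c : ℝ) :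
    R.incr (cornerFun c) = if R.b = ⊤ ∧ R.d = ⊤ ∧ R.a ≠ ⊤ ∧ R.c ≠ ⊤ then c else 0 := by
  have ha : R.a = ⊤ → R.b = ⊤ := fun h => top_le_iff.1 (h ▸ h1)
  have hc : R.c = ⊤ → R.d = ⊤ := fun h => top_le_iff.1 (h ▸ h2)
  by_cases h3 : R.a = ⊤ <;> by_cases h4 : R.b = ⊤ <;> by_cases h5 : R.c = ⊤ <;>
    by_cases h6 : R.d = ⊤ <;> simp_all [ExtRect.incr, cornerFun]

theorem vitaliVariation_cornerFun_le (c : ℝ) : vitaliVariation (cornerFun c) ≤ ‖c‖ₑ := by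
  refine (vitaliVariation_le_incr (G := cornerFun |c|) fun R h1 h2 => ?_).trans ?_
  · rw [incr_cornerFun h1 h2, incr_cornerFun h1 h2]
    split_ifs <;> simp
  · rw [incr_cornerFun (by exact bot_le) (by exact bot_le), Real.enorm_eq_ofReal_abs]
    simp [extPlane]

/-- The four terms of the inclusion–exclusion formula `cutTop_eq` are bounded by the four terms of
the norm, so the constant is one. -/
theorem vitaliVariation_cutTop_le (hg : HKBV g) : vitaliVariation (cutTop g) ≤ bvENorm g := by
  rw [cutTop_eq]
  refine (vitaliVariation_add_le _ _).trans <| (add_le_add (vitaliVariation_sub_le _ _)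
    (vitaliVariation_cornerFun_le _)).trans <| (add_le_add (add_le_add
    (vitaliVariation_sub_le _ _) (vitaliVariation_edgeSnd_le (hg.variation2_lt_top ⊤)))
    le_rfl).trans <| (add_le_add (add_le_add (add_le_add le_rfl
    (vitaliVariation_edgeFst_le (hg.variation1_lt_top ⊤))) le_rfl) le_rfl).trans ?_
  calc _ = ‖g (⊤, ⊤)‖ₑ + variation1 g ⊤ + variation2 g ⊤ + vitaliVariation g := by
        rw [variation1, variation2]; ring
    _ ≤ _ := add_le_add (add_le_add (add_le_add (le_iSup (fun p => ‖g p‖ₑ) _)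
        (le_iSup (variation1 g) _)) (le_iSup (variation2 g) _)) le_rfl

theorem vitaliVariation_cutTop_lt_top (hg : HKBV g) : vitaliVariation (cutTop g) < ∞ :=
  (vitaliVariation_cutTop_le hg).trans_lt hg.bvENorm_lt_top

theorem HKBV.cutTop (hg : HKBV g) : HKBV (cutTop g) := by
  refine ⟨vitaliVariation_cutTop_lt_top hg, ⟨⊤, ?_⟩, ⊤, ?_⟩
  · rw [variation1, eVariationOn.constant_on]
    · simp
    · rintro _ ⟨x, -, rfl⟩ _ ⟨y, -, rfl⟩; simp [_root_.cutTop]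
  · rw [variation2, eVariationOn.constant_on]
    · simp
    · rintro _ ⟨x, -, rfl⟩ _ ⟨y, -, rfl⟩; simp [_root_.cutTop]

/-- The reflection in the origin exchanges lower and upper edges, so cutting the lower edges is a
cut of upper edges between two reflections. -/
theorem cutReal_eq (g : EReal × EReal → ℝ) :
    cutReal g = reflectFun (cutTop (reflectFun (cutTop g) 0)) 0 := by
  ext p
  have e : (((0 : ℝ) : EReal) - (((0 : ℝ) : EReal) - p.1),
      ((0 : ℝ) : EReal) - (((0 : ℝ) : EReal) - p.2)) = p := by
    rw [reflection_reflection, reflection_reflection]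
  simp only [cutReal, reflectFun, cutTop, Prod.fst_zero, Prod.snd_zero, e,
    reflection_eq_top_iff]
  by_cases h1 : p.1 = ⊤ ∨ p.2 = ⊤ <;> by_cases h2 : p.1 = ⊥ ∨ p.2 = ⊥ <;>
    simp [h1, h2]

theorem vitaliVariation_cutReal_lt_top (hg : HKBV g) : vitaliVariation (cutReal g) < ∞ := by
  rw [cutReal_eq]
  exact ((hg.cutTop.reflectFun 0).cutTop.reflectFun 0).1

theorem cutReal_reflectFun (g : EReal × EReal → ℝ) (p : ℝ × ℝ) :
    reflectFun (cutReal g) p = cutReal (reflectFun g p) := by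
  ext q
  simp only [reflectFun, cutReal, reflection_eq_top_iff, reflection_eq_bot_iff]
  by_cases h1 : q.1 = ⊤ ∨ q.2 = ⊤ <;> by_cases h2 : q.1 = ⊥ ∨ q.2 = ⊥ <;> simp [h1, h2]

/-! ### Special values of Stieltjes integrals -/

/-- The tags may be put at the upper right corners. This evaluates integrators carried by the upper
edges, whose nonzero increments occur on intervals with a corner there. -/
theorem stieltjes_eq_zero_of_upperRight (F : C(EReal × EReal, ℝ)) (hg : vitaliVariation g < ∞)
    (h : ∀ R : ExtRect, R.a ≤ R.b → R.c ≤ R.d → F (R.b, R.d) * R.incr g = 0) :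
    stieltjes F g = 0 := by
  refine stieltjes_eq_of_forall_div F hg fun δ hδ => ?_
  obtain ⟨n, I, hI, hosc⟩ := exists_small_oscillation F.continuous hδ
  refine ⟨Fin n, inferInstance, I, fun i => ((I i).b, (I i).d), hI, hI.upperRight_mem,
    fun i p hp => hosc i p hp _ (hI.upperRight_mem i), ?_⟩
  rw [Finset.sum_eq_zero fun i _ => h (I i) (hI.1 i).1 (hI.1 i).2]
  simpa using mul_nonneg hδ.le ENNReal.toReal_nonneg

theorem stieltjes_eq_zero_of_lowerLeft (F : C(EReal × EReal, ℝ)) (hg : vitaliVariation g < ∞)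
    (h : ∀ R : ExtRect, R.a ≤ R.b → R.c ≤ R.d → F (R.a, R.c) * R.incr g = 0) :
    stieltjes F g = 0 := by
  refine stieltjes_eq_of_forall_div F hg fun δ hδ => ?_
  obtain ⟨n, I, hI, hosc⟩ := exists_small_oscillation F.continuous hδ
  refine ⟨Fin n, inferInstance, I, fun i => ((I i).a, (I i).c), hI, hI.lowerLeft_mem,
    fun i p hp => hosc i p hp _ (hI.lowerLeft_mem i), ?_⟩
  rw [Finset.sum_eq_zero fun i _ => h (I i) (hI.1 i).1 (hI.1 i).2]
  simpa using mul_nonneg hδ.le ENNReal.toReal_nonneg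

theorem stieltjes_const (c : ℝ) (hg : vitaliVariation g < ∞) :
    stieltjes (ContinuousMap.const _ c) g = c * extPlane.incr g := by
  refine stieltjes_eq_of_forall_div _ hg fun δ hδ => ?_
  refine ⟨Unit, inferInstance, fun _ => extPlane, fun _ => (⊥, ⊥), ⟨fun _ => ⟨bot_le, bot_le⟩,
    fun i j h => absurd (Subsingleton.elim i j) h, by rw [iUnion_const]⟩,
    fun _ => subset_extPlane univ (mem_univ _), by simp [hδ.le], ?_⟩
  simpa using mul_nonneg hδ.le ENNReal.toReal_nonneg

/-- A division of the line into intervals gives a division of the plane into full vertical strips,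
and the increment of `g` over such a strip is an increment of ψ. -/
theorem hasHS1_fst (F : C(EReal × EReal, ℝ)) (hg : vitaliVariation g < ∞) {φ ψ : EReal → ℝ}
    (hφ : ∀ s t, F (s, t) = φ s) (hψ : ∀ s, ψ s = g (s, ⊤) - g (s, ⊥)) :
    HasHS1 φ ψ ⊥ ⊤ (stieltjes F g) := by
  intro ε hε
  set V := (vitaliVariation g).toReal with hV
  have hV0 : 0 ≤ V := ENNReal.toReal_nonneg
  have hδ : 0 < ε / (V + 1) := by positivity
  have hc : Continuous φ := by
    have : φ = fun s => F (s, ⊥) := funext fun s => (hφ s ⊥).symm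
    rw [this]; fun_prop
  let U : Set EReal := Ioo (⊥ : EReal) ⊤
  refine ⟨fun p => {q | |φ q - φ p| < ε / (V + 1)} ∩ {q | p ∈ U → q ∈ U}, fun p => ⟨?_, ?_, ?_⟩, ?_⟩
  · refine (isOpen_lt (by fun_prop) continuous_const).inter ?_
    by_cases hp : p ∈ U
    · simpa [hp] using isOpen_Ioo
    · simp [hp]
  · simp [hδ]
  · exact fun hp q hq => hq.2 hp
  · intro n u v z h1 h2 h3 hz
    have hdiv := IsLineDiv.prod (κ := fun _ => Unit) ⟨h1, h2, h3⟩ fun _ => isLineDiv_univ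
    have := isRiemannLimit_stieltjes F hg _ _ (fun q => (z q.1, ⊥)) (ε / (V + 1)) hdiv
      (fun q => ⟨(hz q.1).1, bot_le, bot_le⟩) fun q p hp => by
        rw [show F p = φ p.1 from hφ _ _, hφ]
        exact ((hz q.1).2 hp.1).1.le
    rw [Fintype.sum_sigma] at this
    have e : ∀ i, φ (z i) * (ψ (v i) - ψ (u i)) = ∑ _ : Unit, F (z i, ⊥) *
        (⟨u i, v i, ⊥, ⊤⟩ : ExtRect).incr g := fun i => by
      simp only [hφ, hψ, ExtRect.incr, Finset.univ_unique, Finset.sum_singleton]; ring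
    simp_rw [e]
    refine this.trans_lt ?_
    rw [div_mul_eq_mul_div, div_lt_iff₀ (by positivity)]
    nlinarith

theorem hasHS1_snd (F : C(EReal × EReal, ℝ)) (hg : vitaliVariation g < ∞) {φ ψ : EReal → ℝ}
    (hφ : ∀ s t, F (s, t) = φ t) (hψ : ∀ t, ψ t = g (⊤, t) - g (⊥, t)) :
    HasHS1 φ ψ ⊥ ⊤ (stieltjes F g) := by
  intro ε hε
  set V := (vitaliVariation g).toReal with hV
  have hV0 : 0 ≤ V := ENNReal.toReal_nonneg
  have hδ : 0 < ε / (V + 1) := by positivity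
  have hc : Continuous φ := by
    have : φ = fun t => F (⊥, t) := funext fun t => (hφ ⊥ t).symm
    rw [this]; fun_prop
  let U : Set EReal := Ioo (⊥ : EReal) ⊤
  refine ⟨fun p => {q | |φ q - φ p| < ε / (V + 1)} ∩ {q | p ∈ U → q ∈ U}, fun p => ⟨?_, ?_, ?_⟩, ?_⟩
  · refine (isOpen_lt (by fun_prop) continuous_const).inter ?_
    by_cases hp : p ∈ U
    · simpa [hp] using isOpen_Ioo
    · simp [hp]
  · simp [hδ]
  · exact fun hp q hq => hq.2 hp
  · intro n u v z h1 h2 h3 hz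
    have hdiv := isLineDiv_univ.prod (κ := fun _ => Fin n) (c := fun _ => u) (d := fun _ => v)
      fun _ => ⟨h1, h2, h3⟩
    have := isRiemannLimit_stieltjes F hg _ _ (fun q => (⊥, z q.2)) (ε / (V + 1)) hdiv
      (fun q => ⟨⟨bot_le, bot_le⟩, (hz q.2).1⟩) fun q p hp => by
        rw [show F p = φ p.2 from hφ _ _, hφ]
        exact ((hz q.2).2 hp.2).1.le
    rw [Fintype.sum_sigma, Fintype.sum_unique] at this
    have e : ∀ i, φ (z i) * (ψ (v i) - ψ (u i)) = F (⊥, z i) *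
        (⟨⊥, ⊤, u i, v i⟩ : ExtRect).incr g := fun i => by
      simp only [hφ, hψ, ExtRect.incr]; ring
    simp_rw [e]
    refine this.trans_lt ?_
    rw [div_mul_eq_mul_div, div_lt_iff₀ (by positivity)]
    nlinarith

theorem HasHS1.unique {φ ψ : EReal → ℝ} {A B : ℝ} (hA : HasHS1 φ ψ ⊥ ⊤ A)
    (hB : HasHS1 φ ψ ⊥ ⊤ B) : A = B := by
  by_contra hne
  have hpos : 0 < |A - B| / 2 := by have := abs_pos.2 (sub_ne_zero.2 hne); linarith
  obtain ⟨γ, hγ, h⟩ := hA _ hpos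
  obtain ⟨γ', hγ', h'⟩ := hB _ hpos
  obtain ⟨n, t, ht, h0, hn, hz⟩ := exists_fine_seq (γ := fun p => γ p ∩ γ' p) fun p =>
    ⟨(hγ p).1.inter (hγ' p).1, (hγ p).2.1, (hγ' p).2.1⟩
  choose z hz hsub using hz
  obtain ⟨d1, d2, d3⟩ := isLineDiv_of_monotone ht h0 hn
  have h1 := h n _ _ (fun i => z i i.2) d1 d2 d3
    fun i => ⟨hz i i.2, (hsub i i.2).trans inter_subset_left⟩
  have h2 := h' n _ _ (fun i => z i i.2) d1 d2 d3
    fun i => ⟨hz i i.2, (hsub i i.2).trans inter_subset_right⟩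
  rw [abs_sub_comm] at h1
  have h3 := abs_sub_le A (∑ i : Fin n, φ (z i i.2) * (ψ (t (i + 1)) - ψ (t i))) B
  linarith

theorem hasHS1_zero {φ : EReal → ℝ} (hφ : ∀ s, φ s = 0) (ψ : EReal → ℝ) : HasHS1 φ ψ ⊥ ⊤ 0 := by
  intro ε hε
  refine ⟨fun x => {q | x ∈ Ioo (⊥ : EReal) ⊤ → q ∈ Ioo (⊥ : EReal) ⊤}, fun x => ⟨?_, ?_, ?_⟩, ?_⟩
  · by_cases hx : x ∈ Ioo (⊥ : EReal) ⊤
    · simp only [hx, true_imp_iff]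
      exact isOpen_Ioo
    · simp [hx]
  · exact fun h => h
  · exact fun hx q hq => hq hx
  · intros
    simpa [hφ] using hε

theorem stieltjes_eq_zero_of_snd (F : C(EReal × EReal, ℝ)) (hg : vitaliVariation g < ∞)
    (hF : ∀ s t, F (s, t) = F (⊥, t)) (h : ∀ t, g (⊤, t) = g (⊥, t)) : stieltjes F g = 0 := by
  have h1 := hasHS1_snd F hg (φ := fun t => F (⊥, t)) (ψ := fun _ => 0) hF (by simp [h])
  -- With a constant integrator all sums vanish, so any gauge will do; one is borrowed from
  -- `hasHS1_zero`.
  refine h1.unique fun ε hε => ?_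
  obtain ⟨γ, hγ, -⟩ := hasHS1_zero (φ := fun _ => 0) (fun _ => rfl) (fun _ => 0) ε hε
  exact ⟨γ, hγ, by intros; simpa using hε⟩

theorem stieltjes_eq_zero_of_fst (F : C(EReal × EReal, ℝ)) (hg : vitaliVariation g < ∞)
    (hF : ∀ s t, F (s, t) = F (s, ⊥)) (h : ∀ s, g (s, ⊤) = g (s, ⊥)) : stieltjes F g = 0 := by
  have h1 := hasHS1_fst F hg (φ := fun s => F (s, ⊥)) (ψ := fun _ => 0) hF (by simp [h])
  refine h1.unique fun ε hε => ?_
  obtain ⟨γ, hγ, -⟩ := hasHS1_zero (φ := fun _ => 0) (fun _ => rfl) (fun _ => 0) ε hε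
  exact ⟨γ, hγ, by intros; simpa using hε⟩

/-- Reflecting both coordinates preserves the sign of increments, so the change of variables has no
sign. -/
theorem stieltjes_comp_pointReflection (F : C(EReal × EReal, ℝ)) (hg : vitaliVariation g < ∞)
    (p : ℝ × ℝ) :
    stieltjes (F.comp ⟨pointReflection p, continuous_pointReflection p⟩) g =
      stieltjes F (reflectFun g p) := by
  refine stieltjes_eq_of_forall_div _ hg fun δ hδ => ?_
  obtain ⟨n, I, hI, hosc⟩ := exists_small_oscillation F.continuous hδ
  have hg' := (vitaliVariation_reflectFun_le g p).trans_lt hg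
  have h1 := isRiemannLimit_stieltjes F hg' (Fin n) I (fun i => ((I i).a, (I i).c)) δ hI
    hI.lowerLeft_mem fun i q hq => hosc i q hq _ (hI.lowerLeft_mem i)
  refine ⟨Fin n, inferInstance, fun i => (I i).reflect p,
    fun i => pointReflection p ((I i).a, (I i).c), hI.reflect p, fun i => ?_, fun i q hq => ?_, ?_⟩
  · rw [mem_carrier_reflect, pointReflection_involutive p]
    exact hI.lowerLeft_mem i
  · simp only [ContinuousMap.comp_apply, ContinuousMap.coe_mk, pointReflection_involutive p _]
    exact hosc i _ (mem_carrier_reflect.1 hq) _ (hI.lowerLeft_mem i)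
  · simp only [ContinuousMap.comp_apply, ContinuousMap.coe_mk, pointReflection_involutive p _,
      incr_reflect]
    exact h1.trans (mul_le_mul_of_nonneg_left
      (ENNReal.toReal_mono hg.ne (vitaliVariation_reflectFun_le g p)) hδ.le)

/-- The difference of the integrators lives on the lower edges. With tags at lower left corners,
either the tag lies on a lower edge, where F is zero, or the increment is zero. -/
theorem stieltjes_cutTop_eq_cutReal {F : C(EReal × EReal, ℝ)} (hF : F ∈ BcPlane) (hg : HKBV g) :
    stieltjes F (cutTop g) = stieltjes F (cutReal g) := by
  have h1 := vitaliVariation_cutTop_lt_top hg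
  have h2 := vitaliVariation_cutReal_lt_top hg
  rw [← sub_eq_zero, ← stieltjes_sub_right F h1 h2]
  refine stieltjes_eq_zero_of_lowerLeft F
    ((vitaliVariation_sub_le _ _).trans_lt (ENNReal.add_lt_top.2 ⟨h1, h2⟩)) fun R hab hcd => ?_
  by_cases ha : R.a = ⊥
  · rw [ha, (hF _).1, zero_mul]
  by_cases hc : R.c = ⊥
  · rw [hc, (hF _).2, zero_mul]
  have hb : R.b ≠ ⊥ := fun h => ha (le_bot_iff.1 (h ▸ hab))
  have hd : R.d ≠ ⊥ := fun h => hc (le_bot_iff.1 (h ▸ hcd))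
  have key : ∀ s t : EReal, s ≠ ⊥ → t ≠ ⊥ → (cutTop g - cutReal g) (s, t) = 0 := by
    intro s t hs ht
    simp [cutTop, cutReal, hs, ht]
  simp [ExtRect.incr, key, ha, hb, hc, hd]

/-- Integration by parts: the integral of `f g` is the Stieltjes integral of the primitive of `f`
with respect to `g` made zero on the upper edges. -/
theorem stieltjes_cutTop (F : C(EReal × EReal, ℝ)) (hg : HKBV g) :
    ∃ A₁ A₃ : ℝ, HasHS1 (fun x => F (x, ⊤)) (fun x => g (x, ⊤)) ⊥ ⊤ A₁ ∧
      HasHS1 (fun y => F (⊤, y)) (fun y => g (⊤, y)) ⊥ ⊤ A₃ ∧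
      stieltjes F (cutTop g) = F (⊤, ⊤) * g (⊤, ⊤) - A₁ - A₃ + stieltjes F g := by
  let F₁ : C(EReal × EReal, ℝ) := F.comp ⟨fun p => (p.1, ⊤), by fun_prop⟩
  let F₃ : C(EReal × EReal, ℝ) := F.comp ⟨fun p => (⊤, p.2), by fun_prop⟩
  let c : C(EReal × EReal, ℝ) := ContinuousMap.const _ (F (⊤, ⊤))
  let e₁ := edgeFst fun s => g (s, ⊤)
  let e₃ := edgeSnd fun t => g (⊤, t)
  let e₄ := cornerFun (g (⊤, ⊤))
  have v₁ : vitaliVariation e₁ < ∞ := (vitaliVariation_edgeFst_le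
    (hg.variation1_lt_top ⊤)).trans_lt (hg.variation1_lt_top ⊤)
  have v₃ : vitaliVariation e₃ < ∞ := (vitaliVariation_edgeSnd_le
    (hg.variation2_lt_top ⊤)).trans_lt (hg.variation2_lt_top ⊤)
  have v₄ : vitaliVariation e₄ < ∞ := (vitaliVariation_cornerFun_le _).trans_lt enorm_lt_top
  -- Only the values of F on the edge t = +∞ matter, so F may be replaced by the function of s that
  -- it induces there; likewise for the other edge and the corner.
  have h₁ : stieltjes F e₁ = stieltjes F₁ e₁ := by
    rw [← sub_eq_zero, ← stieltjes_sub F F₁ v₁]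
    refine stieltjes_eq_zero_of_upperRight _ v₁ fun R hab hcd => ?_
    by_cases hd : R.d = ⊤
    · simp [F₁, hd]
    · have hc : R.c ≠ ⊤ := fun h => hd (top_le_iff.1 (h ▸ hcd))
      simp [ExtRect.incr, e₁, edgeFst, hd, hc]
  have h₃ : stieltjes F e₃ = stieltjes F₃ e₃ := by
    rw [← sub_eq_zero, ← stieltjes_sub F F₃ v₃]
    refine stieltjes_eq_zero_of_upperRight _ v₃ fun R hab hcd => ?_
    by_cases hd : R.b = ⊤
    · simp [F₃, hd]
    · have hc : R.a ≠ ⊤ := fun h => hd (top_le_iff.1 (h ▸ hab))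
      simp [ExtRect.incr, e₃, edgeSnd, hd, hc]
  have h₄ : stieltjes F e₄ = F (⊤, ⊤) * g (⊤, ⊤) := by
    have : stieltjes F e₄ = stieltjes c e₄ := by
      rw [← sub_eq_zero, ← stieltjes_sub F c v₄]
      refine stieltjes_eq_zero_of_upperRight _ v₄ fun R hab hcd => ?_
      rw [incr_cornerFun hab hcd]
      split_ifs with h
      · simp [c, h.1, h.2.1]
      · simp
    rw [this, stieltjes_const _ v₄, incr_cornerFun (by exact bot_le) (by exact bot_le)]
    simp [extPlane]
  refine ⟨stieltjes F₁ e₁, stieltjes F₃ e₃, hasHS1_fst F₁ v₁ (fun _ _ => rfl) fun s => ?_,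
    hasHS1_snd F₃ v₃ (fun _ _ => rfl) fun t => ?_, ?_⟩
  · simp [e₁, edgeFst]
  · simp [e₃, edgeSnd]
  · have v5 := (vitaliVariation_sub_le g e₁).trans_lt (ENNReal.add_lt_top.2 ⟨hg.1, v₁⟩)
    have v6 := (vitaliVariation_sub_le (g - e₁) e₃).trans_lt (ENNReal.add_lt_top.2 ⟨v5, v₃⟩)
    rw [cutTop_eq, stieltjes_add_right F v6 v₄, stieltjes_sub_right F v5 v₃,
      stieltjes_sub_right F hg.1 v₁, h₁, h₃, h₄]
    ring

/-- On the lower edges F is zero: the integrals over them vanish, and only the corner (+∞, +∞)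
survives in the boundary increment. -/
theorem hasIntegralMul_iff {f : 𝓓'((⊤ : TopologicalSpace.Opens (ℝ × ℝ)), ℝ)}
    {F : C(EReal × EReal, ℝ)} (hF : IsPrimitive f F) (huniq : ∀ F', IsPrimitive f F' → F' = F)
    (hg : HKBV g) {A : ℝ} :
    HasIntegralMul f g extPlane A ↔ A = stieltjes F (cutTop g) := by
  obtain ⟨B₁, B₃, hB₁, hB₃, hB⟩ := stieltjes_cutTop F hg
  have hF1 : ∀ s, F (s, ⊥) = 0 := fun s => (hF.1 s).2
  have hF2 : ∀ s, F (⊥, s) = 0 := fun s => (hF.1 s).1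
  have e : extPlane.incr (fun p => F p * g p) = F (⊤, ⊤) * g (⊤, ⊤) := by
    simp [ExtRect.incr, extPlane, hF1, hF2]
  constructor
  · rintro ⟨-, F', hF', A₁, A₂, A₃, A₄, A₅, h1, h2, h3, h4, h5, rfl⟩
    obtain rfl := huniq F' hF'
    rw [e, hB, h1.unique hB₁, h3.unique hB₃, h2.unique (hasHS1_zero hF1 _),
      h4.unique (hasHS1_zero hF2 _), h5.stieltjes_eq]
    ring
  · rintro rfl
    refine ⟨hg, F, hF, B₁, 0, B₃, 0, stieltjes F g, hB₁, hasHS1_zero hF1 _, hB₃, hasHS1_zero hF2 _,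
      hasHS2_stieltjes F hg.1, ?_⟩
    rw [e, hB]
    ring

end

/-! ### Primitives of distributions -/

/-- Test functions on the plane. -/
abbrev TestPlane := 𝓓((⊤ : TopologicalSpace.Opens (ℝ × ℝ)), ℝ)

theorem distOfFun_apply {u : ℝ × ℝ → ℝ} (hu : Continuous u)
    (φ : TestPlane) : distOfFun u φ = ∫ q, φ q * u q := by
  exact TestFunction.integralAgainstBilinCLM_eq_integral
    (hu.locallyIntegrable.locallyIntegrableOn _)

theorem partial12_distOfFun_apply {u : ℝ × ℝ → ℝ} (hu : Continuous u)
    (φ : TestPlane) :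
    partial12 (distOfFun u) φ =
      ∫ q, (∂_{((0 : ℝ), (1 : ℝ))} (∂_{((1 : ℝ), (0 : ℝ))} φ)) q * u q := by
  rw [partial12, Distribution.lineDerivOp_apply_apply, map_neg,
    Distribution.lineDerivOp_apply_apply, map_neg, neg_neg, distOfFun_apply hu]

theorem testFunction_lineDeriv (φ : TestPlane) (v q : ℝ × ℝ) :
    (∂_{v} φ) q = fderiv ℝ φ q v := by
  rw [TestFunction.lineDerivOp_eq_lineDerivCLM ℝ, TestFunction.lineDerivCLM_apply_of_le (by simp)]
  exact (φ.contDiff.differentiable (by simp)).differentiableAt.lineDeriv_eq_fderiv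

theorem testFunction_lineDeriv_comm (φ : TestPlane)
    (v w : ℝ × ℝ) : (∂_{v} (∂_{w} φ)) = ∂_{w} (∂_{v} φ) := by
  have key : ∀ (v w q : ℝ × ℝ), (∂_{v} (∂_{w} φ)) q = fderiv ℝ (fderiv ℝ φ) q v w := by
    intro v w q
    have h1 : ((∂_{w} φ : TestPlane) : ℝ × ℝ → ℝ) = fun q => fderiv ℝ φ q w :=
      funext fun q => testFunction_lineDeriv φ w q
    have h2 : DifferentiableAt ℝ (fderiv ℝ φ) q :=
      ((φ.contDiff.fderiv_right (m := 1)
      (by rw [one_add_one_eq_two]; exact ENat.LEInfty.out)).differentiable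
        (by simp)).differentiableAt
    rw [testFunction_lineDeriv, h1]
    have h3 := h2.hasFDerivAt.clm_apply (hasFDerivAt_const w q)
    rw [h3.fderiv]
    simp
  ext q
  rw [key, key]
  exact (φ.contDiff.contDiffAt.isSymmSndFDerivAt (by simp; exact ENat.LEInfty.out)).eq _ _

/-- Integration by parts moves the derivative to `u`, which is constant in the direction v. -/
theorem integral_testFunction_lineDeriv_mul {u : ℝ × ℝ → ℝ} (hu : Continuous u) (v : ℝ × ℝ)
    (h : ∀ q (t : ℝ), u (q + t • v) = u q)
    (φ : TestPlane) : ∫ q, (∂_{v} φ) q * u q = 0 := by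
  have h1 : ∀ q, HasLineDerivAt ℝ u 0 q v := fun q => by
    have : (fun t : ℝ => u (q + t • v)) = fun _ => u q := funext fun t => h q t
    rw [HasLineDerivAt, this]
    exact hasDerivAt_const _ _
  have h2 : ∀ q, HasLineDerivAt ℝ φ ((∂_{v} φ) q) q v := fun q => by
    rw [testFunction_lineDeriv]
    exact (φ.contDiff.differentiable (by simp)).differentiableAt.hasFDerivAt.hasLineDerivAt v
  have h3 : ∀ ψ : TestPlane, Integrable fun q => u q * ψ q :=
    fun ψ => (hu.mul ψ.continuous).integrable_of_hasCompactSupport ψ.hasCompactSupport.mul_left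
  have := integral_bilinear_hasLineDerivAt_right_eq_neg_left_of_integrable (μ := volume)
    (B := ContinuousLinearMap.mul ℝ ℝ) (f := u) (f' := fun _ => 0) (g := φ) (g' := (∂_{v} φ : TestPlane)) (v := v)
    (by simp) (h3 _) (h3 _) (fun q _ => h1 q) (fun q _ => h2 q)
  simpa [mul_comm] using this

theorem partial12_distOfFun_eq_of_sub {u w a b : ℝ × ℝ → ℝ} (hu : Continuous u) (ha : Continuous a)
    (hb : Continuous b) (ha' : ∀ q (t : ℝ), a (q + t • ((1 : ℝ), (0 : ℝ))) = a q)
    (hb' : ∀ q (t : ℝ), b (q + t • ((0 : ℝ), (1 : ℝ))) = b q) (hw : w = fun q => u q + a q + b q) :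
    partial12 (distOfFun w) = partial12 (distOfFun u) := by
  have hwc : Continuous w := by rw [hw]; fun_prop
  ext φ
  rw [partial12_distOfFun_apply hwc, partial12_distOfFun_apply hu]
  set ψ := ∂_{((0 : ℝ), (1 : ℝ))} (∂_{((1 : ℝ), (0 : ℝ))} φ) with hψ
  have h1 : ∫ q, ψ q * a q = 0 := by
    -- Since `a` is constant in the first variable, ∂₁ must be the outer derivative here.
    rw [hψ, testFunction_lineDeriv_comm]
    exact integral_testFunction_lineDeriv_mul ha _ ha' _
  have h2 : ∫ q, ψ q * b q = 0 := integral_testFunction_lineDeriv_mul hb _ hb' _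
  have h3 : ∀ u : ℝ × ℝ → ℝ, Continuous u → Integrable fun q => ψ q * u q := fun u hu =>
    (ψ.continuous.mul hu).integrable_of_hasCompactSupport ψ.hasCompactSupport.mul_right
  simp only [hw, mul_add]
  have h4 : Integrable fun q => ψ q * u q + ψ q * a q := (h3 u hu).add (h3 a ha)
  rw [integral_add h4 (h3 b hb), integral_add (h3 u hu) (h3 a ha), h1, h2]
  ring

/-- The product `χ₁ ⊗ χ₂` of test functions on the line. -/
noncomputable def tensorTest {χ₁ χ₂ : ℝ → ℝ} (h₁ : ContDiff ℝ ((⊤ : ℕ∞) : WithTop ℕ∞) χ₁)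
    (h₂ : ContDiff ℝ ((⊤ : ℕ∞) : WithTop ℕ∞) χ₂) (hc₁ : HasCompactSupport χ₁)
    (hc₂ : HasCompactSupport χ₂) : TestPlane :=
  ⟨fun p => χ₁ p.1 * χ₂ p.2, (h₁.comp contDiff_fst).mul (h₂.comp contDiff_snd),
    HasCompactSupport.intro (hc₁.isCompact.prod hc₂.isCompact) fun p hp => by
      by_cases h : p.1 ∈ tsupport χ₁
      · have h' : p.2 ∉ tsupport χ₂ := fun h' => hp ⟨h, h'⟩
        rw [image_eq_zero_of_notMem_tsupport h', mul_zero]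
      · rw [image_eq_zero_of_notMem_tsupport h, zero_mul], fun _ _ => trivial⟩

theorem tensorTest_lineDeriv {χ₁ χ₂ : ℝ → ℝ} (h₁ : ContDiff ℝ ((⊤ : ℕ∞) : WithTop ℕ∞) χ₁)
    (h₂ : ContDiff ℝ ((⊤ : ℕ∞) : WithTop ℕ∞) χ₂) (hc₁ : HasCompactSupport χ₁)
    (hc₂ : HasCompactSupport χ₂) (q : ℝ × ℝ) :
    (∂_{((0 : ℝ), (1 : ℝ))} (∂_{((1 : ℝ), (0 : ℝ))} (tensorTest h₁ h₂ hc₁ hc₂))) q =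
      deriv χ₁ q.1 * deriv χ₂ q.2 := by
  have d₁ : ∀ x, HasDerivAt χ₁ (deriv χ₁ x) x := fun x =>
    (h₁.differentiable (by simp)).differentiableAt.hasDerivAt
  have d₂ : ∀ x, HasDerivAt χ₂ (deriv χ₂ x) x := fun x =>
    (h₂.differentiable (by simp)).differentiableAt.hasDerivAt
  have e : ∀ (ψ : TestPlane) (v q : ℝ × ℝ),
      (∂_{v} ψ) q = lineDeriv ℝ ψ q v := fun ψ v q => by
    rw [TestFunction.lineDerivOp_eq_lineDerivCLM ℝ, TestFunction.lineDerivCLM_apply_of_le (by simp)]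
  have e1 : ((∂_{((1 : ℝ), (0 : ℝ))} (tensorTest h₁ h₂ hc₁ hc₂) : TestPlane) : ℝ × ℝ → ℝ) =
      fun q => deriv χ₁ q.1 * χ₂ q.2 := by
    ext q
    rw [e, lineDeriv]
    have h3 := ((d₁ (q.1 + 0)).comp_const_add q.1 0).mul_const (χ₂ q.2)
    rw [add_zero] at h3
    have h4 : (fun t : ℝ => (tensorTest h₁ h₂ hc₁ hc₂) (q + t • ((1 : ℝ), (0 : ℝ)))) =
        fun t => χ₁ (q.1 + t) * χ₂ q.2 := by
      ext t
      change χ₁ _ * χ₂ _ = _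
      simp
    rw [h4]
    exact h3.deriv
  rw [e, e1, lineDeriv]
  have h3 := ((d₂ (q.2 + 0)).comp_const_add q.2 0).const_mul (deriv χ₁ q.1)
  rw [add_zero] at h3
  have h4 : (fun t : ℝ => (fun q : ℝ × ℝ => deriv χ₁ q.1 * χ₂ q.2) (q + t • ((0 : ℝ), (1 : ℝ)))) =
      fun t => deriv χ₁ q.1 * χ₂ (q.2 + t) := by
    ext t
    simp
  rw [h4]
  exact h3.deriv

/-! ### An approximate identity from the smooth transition function -/

theorem deriv_smoothTransition_eq_zero {x : ℝ} (hx : x ∉ Icc (0 : ℝ) 1) :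
    deriv Real.smoothTransition x = 0 := by
  by_cases h : x < 0
  · have : Real.smoothTransition =ᶠ[𝓝 x] fun _ => 0 := by
      filter_upwards [gt_mem_nhds h] with y hy using Real.smoothTransition.zero_of_nonpos hy.le
    rw [this.deriv_eq]; simp
  · have h1 : 1 < x := by
      by_contra h1
      exact hx ⟨not_lt.1 h, not_lt.1 h1⟩
    have : Real.smoothTransition =ᶠ[𝓝 x] fun _ => 1 := by
      filter_upwards [lt_mem_nhds h1] with y hy using Real.smoothTransition.one_of_one_le hy.le
    rw [this.deriv_eq]; simp

theorem continuous_deriv_smoothTransition : Continuous (deriv Real.smoothTransition) :=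
  (Real.smoothTransition.contDiff (n := 1)).continuous_deriv (by simp)

theorem hasCompactSupport_deriv_smoothTransition :
    HasCompactSupport (deriv Real.smoothTransition) :=
  HasCompactSupport.intro isCompact_Icc fun _ => deriv_smoothTransition_eq_zero

theorem integral_deriv_smoothTransition : ∫ x, deriv Real.smoothTransition x = 1 := by
  have h := integral_of_hasDerivAt_of_tendsto (f := Real.smoothTransition) (m := 0) (n := 1)
    (fun x => ((Real.smoothTransition.contDiff (n := 1)).differentiable
      (by simp)).differentiableAt.hasDerivAt)
    (continuous_deriv_smoothTransition.integrable_of_hasCompactSupport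
      hasCompactSupport_deriv_smoothTransition)
    (tendsto_const_nhds.congr' ?_) (tendsto_const_nhds.congr' ?_)
  · simpa using h
  · filter_upwards [eventually_le_atBot 0] with x hx
    exact (Real.smoothTransition.zero_of_nonpos hx).symm
  · filter_upwards [eventually_ge_atTop 1] with x hx
    exact (Real.smoothTransition.one_of_one_le hx).symm

/-- A bump function of height of order `n` and width `1 / n` at the right of `a`. -/
noncomputable def rightBump (n : ℕ) (a x : ℝ) : ℝ := n * deriv Real.smoothTransition (n * (x - a))

theorem continuous_rightBump (n : ℕ) (a : ℝ) : Continuous (rightBump n a) :=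
  continuous_const.mul (continuous_deriv_smoothTransition.comp (by fun_prop))

theorem rightBump_eq_zero {n : ℕ} (hn : n ≠ 0) {a x : ℝ} (hx : x ∉ Icc a (a + 1)) :
    rightBump n a x = 0 := by
  have hn' : (1 : ℝ) ≤ n := by exact_mod_cast Nat.one_le_iff_ne_zero.2 hn
  rw [rightBump, deriv_smoothTransition_eq_zero, mul_zero]
  rintro ⟨h1, h2⟩
  refine hx ⟨?_, ?_⟩ <;> nlinarith

/-- After the substitution q ↦ (a, c) + q/n the kernel no longer depends on n, and dominated
convergence applies. -/
theorem tendsto_integral_rightBump {u : ℝ × ℝ → ℝ} (hu : Continuous u) {C : ℝ}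
    (hC : ∀ q, |u q| ≤ C) (a c : ℝ) :
    Tendsto (fun n : ℕ => ∫ q : ℝ × ℝ, rightBump n a q.1 * rightBump n c q.2 * u q) atTop
      (𝓝 (u (a, c))) := by
  set ρ := deriv Real.smoothTransition with hρ
  have hρc : Continuous ρ := continuous_deriv_smoothTransition
  have hρi : Integrable ρ :=
    hρc.integrable_of_hasCompactSupport hasCompactSupport_deriv_smoothTransition
  have hρρ : Integrable fun q : ℝ × ℝ => ρ q.1 * ρ q.2 := hρi.mul_prod hρi
  have e : ∀ᶠ n : ℕ in atTop, ∫ q : ℝ × ℝ, ρ q.1 * ρ q.2 * u ((a, c) + (n : ℝ)⁻¹ • q) =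
      ∫ q : ℝ × ℝ, rightBump n a q.1 * rightBump n c q.2 * u q := by
    filter_upwards [eventually_ne_atTop 0] with n hn
    have hn' : (n : ℝ) ≠ 0 := by exact_mod_cast hn
    rw [← integral_add_left_eq_self
      (fun q : ℝ × ℝ => rightBump n a q.1 * rightBump n c q.2 * u q) ((a, c) : ℝ × ℝ)]
    have h1 := Measure.integral_comp_smul (volume : Measure (ℝ × ℝ))
      (fun q : ℝ × ℝ => ρ q.1 * ρ q.2 * u ((a, c) + (n : ℝ)⁻¹ • q)) (n : ℝ)
    have h2 : ∀ q : ℝ × ℝ, rightBump n a ((a, c) + q).1 * rightBump n c ((a, c) + q).2 *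
        u ((a, c) + q) = (n : ℝ) ^ 2 * (ρ ((n : ℝ) • q).1 * ρ ((n : ℝ) • q).2 *
          u ((a, c) + (n : ℝ)⁻¹ • ((n : ℝ) • q))) := by
      intro q
      rw [smul_smul, inv_mul_cancel₀ hn', one_smul]
      simp only [rightBump, Prod.fst_add, Prod.snd_add, add_sub_cancel_left, Prod.smul_fst,
        Prod.smul_snd, smul_eq_mul]
      ring
    simp_rw [h2]
    rw [integral_const_mul, h1]
    simp only [Module.finrank_prod, Module.finrank_self, Nat.reduceAdd, smul_eq_mul]
    rw [abs_of_pos (by positivity), ← mul_assoc, mul_inv_cancel₀ (by positivity), one_mul]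
  refine Tendsto.congr' e ?_
  have hlim : ∫ q : ℝ × ℝ, ρ q.1 * ρ q.2 * u (a, c) = u (a, c) := by
    have := integral_prod_mul (μ := (volume : Measure ℝ)) (ν := (volume : Measure ℝ)) ρ ρ
    rw [integral_mul_const, show (volume : Measure (ℝ × ℝ)) = volume.prod volume from rfl, this,
      integral_deriv_smoothTransition]
    ring
  rw [← hlim]
  refine tendsto_integral_of_dominated_convergence (fun q => |ρ q.1 * ρ q.2| * C) (fun n => ?_)
    (hρρ.abs.mul_const C) (fun n => ae_of_all _ fun q => ?_) (ae_of_all _ fun q => ?_)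
  · exact Continuous.aestronglyMeasurable (by fun_prop)
  · rw [Real.norm_eq_abs, abs_mul]
    exact mul_le_mul_of_nonneg_left (hC _) (abs_nonneg _)
  · have h1 : Tendsto (fun n : ℕ => (a, c) + (n : ℝ)⁻¹ • q) atTop (𝓝 ((a, c) + (0 : ℝ) • q)) :=
      (tendsto_inv_atTop_nhds_zero_nat.smul_const q).const_add _
    rw [zero_smul, add_zero] at h1
    exact ((hu.tendsto _).comp h1).const_mul _

/-! ### Uniqueness of primitives and primitives of reflected distributions -/

theorem continuous_toExt : Continuous toExt :=
  (continuous_coe_real_ereal.comp continuous_fst).prodMk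
    (continuous_coe_real_ereal.comp continuous_snd)

theorem denseRange_coe_ereal : DenseRange ((↑) : ℝ → EReal) :=
  dense_of_exists_between fun _ _ h =>
    let ⟨x, hx⟩ := EReal.lt_iff_exists_real_btwn.1 h
    ⟨x, mem_range_self x, hx⟩

theorem denseRange_toExt : DenseRange toExt :=
  denseRange_coe_ereal.prodMap denseRange_coe_ereal

/-- The double differences of a function with vanishing mixed derivative are zero. -/
theorem incr_eq_zero_of_partial12 {u : ℝ × ℝ → ℝ} (hu : Continuous u) {C : ℝ}
    (hC : ∀ q, |u q| ≤ C) (h : partial12 (distOfFun u) = 0) (a b c d : ℝ) :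
    u (a, c) - u (b, c) - u (a, d) + u (b, d) = 0 := by
  -- A smooth approximation to the indicator of [a, b], up to sign. The mixed derivative of a
  -- product of two such functions is a combination of four bumps near the corners (a,c), (b,c),
  -- (a,d), (b,d).
  let χ : ℕ → ℝ → ℝ → ℝ → ℝ := fun n a b x =>
    Real.smoothTransition (n * (x - a)) - Real.smoothTransition (n * (x - b))
  have hχ : ∀ n a b, ContDiff ℝ ((⊤ : ℕ∞) : WithTop ℕ∞) (χ n a b) := fun n a b =>
    (Real.smoothTransition.contDiff.comp (by fun_prop)).sub
      (Real.smoothTransition.contDiff.comp (by fun_prop))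
  have hχc : ∀ n a b, n ≠ 0 → HasCompactSupport (χ n a b) := by
    intro n a b hn
    have hn' : (1 : ℝ) ≤ n := by exact_mod_cast Nat.one_le_iff_ne_zero.2 hn
    refine HasCompactSupport.intro (isCompact_Icc (a := min a b) (b := max a b + 1)) fun x hx => ?_
    by_cases h1 : x < min a b
    · rw [lt_min_iff] at h1
      simp only [χ]
      rw [Real.smoothTransition.zero_of_nonpos (by nlinarith),
        Real.smoothTransition.zero_of_nonpos (by nlinarith), sub_zero]
    · have h2 : max a b + 1 < x := by
        by_contra h2
        exact hx ⟨not_lt.1 h1, not_lt.1 h2⟩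
      have h3 := le_max_left a b
      have h4 := le_max_right a b
      simp only [χ]
      rw [Real.smoothTransition.one_of_one_le (by nlinarith),
        Real.smoothTransition.one_of_one_le (by nlinarith), sub_self]
  have hS : ∀ x, HasDerivAt Real.smoothTransition (deriv Real.smoothTransition x) x := fun x =>
    ((Real.smoothTransition.contDiff (n := 1)).differentiable (by simp)).differentiableAt.hasDerivAt
  have hd : ∀ n a b x, deriv (χ n a b) x = rightBump n a x - rightBump n b x := by
    intro n a b x
    have h1 : ∀ a : ℝ, HasDerivAt (fun x : ℝ => Real.smoothTransition (n * (x - a)))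
        (rightBump n a x) x := fun a => by
      have := (hS (n * (x - a))).comp x (((hasDerivAt_id x).sub_const a).const_mul (n : ℝ))
      rw [mul_one, mul_comm] at this
      exact this
    exact ((h1 a).sub (h1 b)).deriv
  have hint : ∀ n : ℕ, n ≠ 0 → ∀ a c, Integrable fun q : ℝ × ℝ =>
      rightBump n a q.1 * rightBump n c q.2 * u q := by
    intro n hn a c
    refine Continuous.integrable_of_hasCompactSupport ?_ ?_
    · exact (((continuous_rightBump n a).comp continuous_fst).mul
        ((continuous_rightBump n c).comp continuous_snd)).mul hu
    · refine HasCompactSupport.intro ((isCompact_Icc (a := a) (b := a + 1)).prod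
        (isCompact_Icc (a := c) (b := c + 1))) fun q hq => ?_
      by_cases h1 : q.1 ∈ Icc a (a + 1)
      · rw [rightBump_eq_zero hn (x := q.2) fun h2 => hq ⟨h1, h2⟩]; ring
      · rw [rightBump_eq_zero hn h1]; ring
  let W : ℕ → ℝ → ℝ → ℝ := fun n a c =>
    ∫ q : ℝ × ℝ, rightBump n a q.1 * rightBump n c q.2 * u q
  have hW : ∀ᶠ n in atTop, W n a c - W n b c - W n a d + W n b d = 0 := by
    filter_upwards [eventually_ne_atTop 0] with n hn
    have h1 := congrArg (fun T => T (tensorTest (hχ n a b) (hχ n c d) (hχc n a b hn)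
      (hχc n c d hn))) h
    simp only [partial12_distOfFun_apply hu, tensorTest_lineDeriv, hd] at h1
    rw [show ((0 : 𝓓'((⊤ : TopologicalSpace.Opens (ℝ × ℝ)), ℝ)) (tensorTest (hχ n a b) (hχ n c d)
      (hχc n a b hn) (hχc n c d hn))) = 0 from rfl] at h1
    have h2 : ∀ q : ℝ × ℝ, (rightBump n a q.1 - rightBump n b q.1) *
        (rightBump n c q.2 - rightBump n d q.2) * u q =
        (rightBump n a q.1 * rightBump n c q.2 * u q - rightBump n b q.1 * rightBump n c q.2 * u q) -
        (rightBump n a q.1 * rightBump n d q.2 * u q - rightBump n b q.1 * rightBump n d q.2 * u q) :=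
      fun q => by ring
    have h3 : ∀ c, Integrable fun q : ℝ × ℝ => rightBump n a q.1 * rightBump n c q.2 * u q -
        rightBump n b q.1 * rightBump n c q.2 * u q := fun c =>
      (hint n hn a c).sub (hint n hn b c)
    simp_rw [h2] at h1
    rw [integral_sub (h3 c) (h3 d), integral_sub (hint n hn a c) (hint n hn b c),
      integral_sub (hint n hn a d) (hint n hn b d)] at h1
    simp only [W]
    linarith
  have hlim := (((tendsto_integral_rightBump hu hC a c).sub
    (tendsto_integral_rightBump hu hC b c)).sub (tendsto_integral_rightBump hu hC a d)).add
    (tendsto_integral_rightBump hu hC b d)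
  exact tendsto_nhds_unique (hlim.congr' hW) tendsto_const_nhds

theorem tendsto_coe_nhds_bot : Tendsto (fun x : ℝ => (x : EReal)) atBot (𝓝 ⊥) :=
  EReal.tendsto_coe_nhds_bot_iff.2 tendsto_id

/-- All double differences of F′ − F over real points vanish. Sending first one and then the other
lower coordinate to −∞ leaves the value at the upper corner, and real points are dense. -/
theorem primitive_unique {f : 𝓓'((⊤ : TopologicalSpace.Opens (ℝ × ℝ)), ℝ)}
    {F F' : C(EReal × EReal, ℝ)} (h : IsPrimitive f F) (h' : IsPrimitive f F') : F' = F := by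
  have hF : Continuous fun q => F (toExt q) := F.continuous.comp continuous_toExt
  have hF' : Continuous fun q => F' (toExt q) := F'.continuous.comp continuous_toExt
  set D : C(EReal × EReal, ℝ) := F' - F with hD
  have hu : Continuous fun q => D (toExt q) := D.continuous.comp continuous_toExt
  have h0 : partial12 (distOfFun fun q => D (toExt q)) = 0 := by
    ext φ
    rw [partial12_distOfFun_apply hu]
    have h1 : partial12 (distOfFun fun q => F' (toExt q)) φ =
      partial12 (distOfFun fun q => F (toExt q)) φ := by rw [← h.2, ← h'.2]
    rw [partial12_distOfFun_apply hF, partial12_distOfFun_apply hF'] at h1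
    set ψ := ∂_{((0 : ℝ), (1 : ℝ))} (∂_{((1 : ℝ), (0 : ℝ))} φ)
    have h3 : ∀ u : ℝ × ℝ → ℝ, Continuous u → Integrable fun q => ψ q * u q := fun u hu =>
      (ψ.continuous.mul hu).integrable_of_hasCompactSupport ψ.hasCompactSupport.mul_right
    simp only [hD, ContinuousMap.sub_apply, mul_sub]
    rw [integral_sub (h3 _ hF') (h3 _ hF), h1, sub_self]
    rfl
  have hinc : ∀ a b c d : ℝ, D (toExt (a, c)) - D (toExt (b, c)) - D (toExt (a, d)) +
      D (toExt (b, d)) = 0 := fun a b c d =>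
    incr_eq_zero_of_partial12 hu (C := ‖D‖) (fun q => D.norm_coe_le_norm _) h0 a b c d
  have hb : ∀ s : EReal, D (⊥, s) = 0 ∧ D (s, ⊥) = 0 := fun s => by
    simp [hD, (h.1 s).1, (h.1 s).2, (h'.1 s).1, (h'.1 s).2]
  have h1 : ∀ b c d : ℝ, D (toExt (b, d)) - D (toExt (b, c)) = 0 := by
    intro b c d
    have ht : ∀ c : ℝ, Tendsto (fun a : ℝ => D (toExt (a, c))) atBot (𝓝 (D (⊥, (c : EReal)))) :=
      fun c => (D.continuous.tendsto _).comp (tendsto_coe_nhds_bot.prodMk_nhds tendsto_const_nhds)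
    have h2 := (((ht c).sub_const (D (toExt (b, c)))).sub (ht d)).add_const (D (toExt (b, d)))
    simp only [hinc, (hb _).1] at h2
    have := tendsto_nhds_unique h2 tendsto_const_nhds
    linarith
  have h2 : ∀ b d : ℝ, D (toExt (b, d)) = 0 := by
    intro b d
    have ht : Tendsto (fun c : ℝ => D (toExt (b, d)) - D (toExt (b, c))) atBot
        (𝓝 (D (toExt (b, d)) - D ((b : EReal), ⊥))) := tendsto_const_nhds.sub
      ((D.continuous.tendsto _).comp (tendsto_const_nhds.prodMk_nhds tendsto_coe_nhds_bot))
    simp only [h1, (hb _).2, sub_zero] at ht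
    exact tendsto_nhds_unique ht tendsto_const_nhds
  have h3 : (D : EReal × EReal → ℝ) = fun _ => 0 :=
    denseRange_toExt.equalizer D.continuous continuous_const (funext fun q => h2 q.1 q.2)
  ext p
  have := congrFun h3 p
  rw [hD] at this
  exact sub_eq_zero.1 this

theorem primitive_eq {f : 𝓓'((⊤ : TopologicalSpace.Opens (ℝ × ℝ)), ℝ)}
    {F : C(EReal × EReal, ℝ)} (h : IsPrimitive f F) : primitive f = F := by
  have hex : ∃ F, IsPrimitive f F := ⟨F, h⟩
  rw [primitive, dif_pos hex]
  exact primitive_unique h hex.choose_spec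

/-- The function `q ↦ F (p - q)` on the extended plane. -/
noncomputable def reflectMap (F : C(EReal × EReal, ℝ)) (p : ℝ × ℝ) : C(EReal × EReal, ℝ) :=
  F.comp ⟨pointReflection p, continuous_pointReflection p⟩

/-- The part of `F` that vanishes when a coordinate is `-∞`. -/
noncomputable def bcPart (F : C(EReal × EReal, ℝ)) : C(EReal × EReal, ℝ) :=
  F - F.comp ⟨fun p => (⊥, p.2), by fun_prop⟩ - F.comp ⟨fun p => (p.1, ⊥), by fun_prop⟩ +
    ContinuousMap.const _ (F (⊥, ⊥))

theorem bcPart_apply (F : C(EReal × EReal, ℝ)) (p : EReal × EReal) :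
    bcPart F p = F p - F (⊥, p.2) - F (p.1, ⊥) + F (⊥, ⊥) := rfl

theorem bcPart_mem (F : C(EReal × EReal, ℝ)) : bcPart F ∈ BcPlane := by
  intro s
  constructor <;> rw [bcPart_apply] <;> ring

/-- F(p − ·) need not vanish at −∞; the terms that correct this depend on one variable each and are
killed by ∂₁∂₂. -/
theorem isPrimitive_reflectDist {f : 𝓓'((⊤ : TopologicalSpace.Opens (ℝ × ℝ)), ℝ)}
    {F : C(EReal × EReal, ℝ)} (h : IsPrimitive f F) (p : ℝ × ℝ) :
    IsPrimitive (reflectDist f p) (bcPart (reflectMap F p)) := by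
  refine ⟨bcPart_mem _, ?_⟩
  rw [reflectDist, primitive_eq h]
  set G := reflectMap F p with hG
  have e : (fun q => F (toExt (p - q))) = fun q => G (toExt q) := by
    ext q
    rw [← pointReflection_toExt]; rfl
  rw [e]
  symm
  refine partial12_distOfFun_eq_of_sub (a := fun q => -G (⊥, (q.2 : EReal)))
    (b := fun q => -G ((q.1 : EReal), ⊥) + G (⊥, ⊥)) (G.continuous.comp continuous_toExt) ?_ ?_
    (fun q t => by simp) (fun q t => by simp) ?_
  · exact (G.continuous.comp (continuous_const.prodMk
      (continuous_coe_real_ereal.comp continuous_snd))).neg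
  · exact ((G.continuous.comp ((continuous_coe_real_ereal.comp continuous_fst).prodMk
      continuous_const)).neg).add continuous_const
  · ext q
    rw [bcPart_apply]
    simp only [toExt]
    ring

/-! ### A modulus of continuity for functions of finite Hardy--Krause variation -/

/-- The points at which the suprema are approached can be chosen independently. The extra term b
holds the summands already treated in the induction. -/
theorem sum_iSup_add_le {Y : Type*} [Nonempty Y] (a : ℕ → Y → ℝ≥0∞) {C : ℝ≥0∞} (n : ℕ) :
    ∀ b : ℝ≥0∞, (∀ y : ℕ → Y, ∑ i ∈ Finset.range n, a i (y i) + b ≤ C) →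
      ∑ i ∈ Finset.range n, (⨆ y, a i y) + b ≤ C := by
  induction n with
  | zero =>
    intro b h
    simpa using h fun _ => Classical.arbitrary Y
  | succ n ih =>
    intro b h
    rw [Finset.sum_range_succ, add_assoc, ENNReal.iSup_add, ENNReal.add_iSup]
    refine iSup_le fun z => ih _ fun y => ?_
    have := h fun i => if i < n then y i else z
    rw [Finset.sum_range_succ, add_assoc] at this
    simp only [lt_irrefl, if_false] at this
    refine le_trans (le_of_eq ?_) this
    congr 1
    exact Finset.sum_congr rfl fun i hi => by rw [if_pos (Finset.mem_range.1 hi)]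

/-- The curve x ↦ g(x, ·) has finite variation for the uniform distance, and α is its variation
function; hence the bound is independent of y. -/
theorem HKBV.exists_modulus_fst {g : EReal × EReal → ℝ} (hg : HKBV g) :
    ∃ α : EReal → ℝ, Monotone α ∧ ∀ x x' y, |g (x, y) - g (x', y)| ≤ |α x - α x'| := by
  let ψ : EReal → UniformFun EReal ℝ := fun x => UniformFun.ofFun fun y => g (x, y)
  have hψ : eVariationOn ψ univ < ∞ := by
    refine lt_of_le_of_lt (b := variation1 g ⊤ + vitaliVariation g) ?_
      (ENNReal.add_lt_top.2 ⟨hg.variation1_lt_top ⊤, hg.1⟩)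
    refine iSup_le fun q => ?_
    have := sum_iSup_add_le (fun i y => edist (g (q.2.1 (i + 1), y)) (g (q.2.1 i, y))) q.1 0
      (C := variation1 g ⊤ + vitaliVariation g)
      fun y => by rw [add_zero]; exact sum_edist_le g ⊤ q.2.2.1 y q.1
    rwa [add_zero] at this
  obtain ⟨α, hα, h, -⟩ := exists_monotone_edist_bound hψ
  have key : ∀ x x' y, x ≤ x' → |g (x', y) - g (x, y)| ≤ |α x' - α x| := by
    intro x x' y hx
    have h1 : edist (g (x', y)) (g (x, y)) ≤ edist (ψ x') (ψ x) :=
      UniformFun.edist_eval_le (f := ψ x') (g := ψ x)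
    have h2 := h1.trans (h x x' hx)
    rw [edist_dist, ENNReal.ofReal_le_ofReal_iff (sub_nonneg.2 (hα hx)), Real.dist_eq] at h2
    exact h2.trans (le_abs_self _)
  refine ⟨α, hα, fun x x' y => ?_⟩
  rcases le_total x x' with hx | hx
  · rw [abs_sub_comm, abs_sub_comm (α x)]
    exact key x x' y hx
  · exact key x' x y hx

theorem HKBV.exists_modulus {g : EReal × EReal → ℝ} (hg : HKBV g) :
    ∃ α β : EReal → ℝ, Monotone α ∧ Monotone β ∧
      ∀ p q, |g p - g q| ≤ |α p.1 - α q.1| + |β p.2 - β q.2| := by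
  obtain ⟨α, hα, h⟩ := hg.exists_modulus_fst
  obtain ⟨β, hβ, h'⟩ := hg.swap.exists_modulus_fst
  refine ⟨α, β, hα, hβ, fun p q => ?_⟩
  calc |g p - g q| ≤ |g (p.1, p.2) - g (q.1, p.2)| + |g (q.1, p.2) - g (q.1, q.2)| :=
        abs_sub_le _ _ _
    _ ≤ _ := add_le_add (h _ _ _) (h' p.2 q.2 q.1)

theorem HKBV.exists_bound {g : EReal × EReal → ℝ} (hg : HKBV g) : ∃ M, 0 ≤ M ∧ ∀ p, |g p| ≤ M := by
  have h : ⨆ p, ‖g p‖ₑ < ∞ := lt_of_le_of_lt (le_add_right (le_add_right le_self_add))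
    hg.bvENorm_lt_top
  refine ⟨(⨆ p, ‖g p‖ₑ).toReal, ENNReal.toReal_nonneg, fun p => ?_⟩
  have := ENNReal.toReal_mono h.ne (le_iSup (fun p => ‖g p‖ₑ) p)
  simpa using this

/-! ### Limits and measurability from a modulus of continuity -/

theorem tendsto_of_modulus {X : Type*} {l : Filter X} {w a b : X → ℝ} {w₀ a₀ b₀ : ℝ}
    (h : ∀ x, |w x - w₀| ≤ |a x - a₀| + |b x - b₀|) (ha : Tendsto a l (𝓝 a₀))
    (hb : Tendsto b l (𝓝 b₀)) : Tendsto w l (𝓝 w₀) := by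
  rw [tendsto_iff_dist_tendsto_zero]
  refine squeeze_zero (fun _ => dist_nonneg) h ?_
  have h1 := (tendsto_iff_dist_tendsto_zero.1 ha).add (tendsto_iff_dist_tendsto_zero.1 hb)
  simpa [Real.dist_eq] using h1

theorem exists_tendsto_of_modulus {X : Type*} {l : Filter X} [l.NeBot] {w a b : X → ℝ} {a₀ b₀ : ℝ}
    (h : ∀ x x', |w x - w x'| ≤ |a x - a x'| + |b x - b x'|) (ha : Tendsto a l (𝓝 a₀))
    (hb : Tendsto b l (𝓝 b₀)) : ∃ w₀, Tendsto w l (𝓝 w₀) := by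
  refine cauchy_map_iff_exists_tendsto.1 (Metric.cauchy_iff.2 ⟨inferInstance, fun ε hε => ?_⟩)
  have h1 := (Metric.cauchy_iff.1 ha.cauchy_map).2 (ε / 2) (by linarith)
  have h2 := (Metric.cauchy_iff.1 hb.cauchy_map).2 (ε / 2) (by linarith)
  obtain ⟨s, hs, hs'⟩ := h1
  obtain ⟨t, ht, ht'⟩ := h2
  refine ⟨w '' (a ⁻¹' s ∩ b ⁻¹' t), image_mem_map (inter_mem hs ht), ?_⟩
  rintro _ ⟨x, hx, rfl⟩ _ ⟨y, hy, rfl⟩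
  have h3 := hs' _ hx.1 _ hy.1
  have h4 := ht' _ hx.2 _ hy.2
  rw [Real.dist_eq] at h3 h4 ⊢
  linarith [h x y]

theorem ae_fst_snd {P Q : ℝ → Prop} (hP : ∀ᵐ s, P s) (hQ : ∀ᵐ t, Q t) :
    ∀ᵐ q : ℝ × ℝ, P q.1 ∧ Q q.2 := by
  have h1 : ∀ᵐ q : ℝ × ℝ, P q.1 := Measure.quasiMeasurePreserving_fst.ae hP
  have h2 : ∀ᵐ q : ℝ × ℝ, Q q.2 := Measure.quasiMeasurePreserving_snd.ae hQ
  exact h1.and h2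

/-- Rounding the coordinates down to multiples of 1/(n+1) makes `w` factor through ℤ × ℤ, hence
measurable. The rounded functions converge wherever both moduli are continuous, so almost
everywhere. -/
theorem aestronglyMeasurable_of_modulus {w : ℝ × ℝ → ℝ} {a b : ℝ → ℝ}
    (h : ∀ q q', |w q - w q'| ≤ |a q.1 - a q'.1| + |b q.2 - b q'.2|)
    (ha : {x | ¬ContinuousAt a x}.Countable) (hb : {x | ¬ContinuousAt b x}.Countable) :
    AEStronglyMeasurable w := by
  let r : ℕ → ℝ → ℝ := fun n x => ⌊((n : ℝ) + 1) * x⌋ / ((n : ℝ) + 1)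
  have hr : ∀ x, Tendsto (fun n => r n x) atTop (𝓝 x) := by
    intro x
    rw [tendsto_iff_dist_tendsto_zero]
    refine squeeze_zero (fun _ => dist_nonneg) (fun n => ?_) tendsto_one_div_add_atTop_nhds_zero_nat
    have hn : (0 : ℝ) < (n : ℝ) + 1 := by positivity
    have e : r n x - x = (⌊((n : ℝ) + 1) * x⌋ - ((n : ℝ) + 1) * x) / ((n : ℝ) + 1) := by
      simp only [r]; field_simp
    rw [Real.dist_eq, e, abs_div, abs_of_pos hn]
    refine div_le_div_of_nonneg_right ?_ hn.le
    have h1 := Int.floor_le (((n : ℝ) + 1) * x)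
    have h2 := Int.lt_floor_add_one (((n : ℝ) + 1) * x)
    rw [abs_le]
    constructor <;> linarith
  have hmeas : ∀ n, AEStronglyMeasurable (fun q : ℝ × ℝ => w (r n q.1, r n q.2)) := by
    intro n
    have h1 : Measurable fun q : ℝ × ℝ =>
        ((⌊((n : ℝ) + 1) * q.1⌋, ⌊((n : ℝ) + 1) * q.2⌋) : ℤ × ℤ) := by fun_prop
    have h2 : Measurable fun z : ℤ × ℤ => w (z.1 / ((n : ℝ) + 1), z.2 / ((n : ℝ) + 1)) :=
      Measurable.of_discrete
    exact (h2.comp h1).aestronglyMeasurable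
  refine aestronglyMeasurable_of_tendsto_ae atTop hmeas ?_
  have ha' : ∀ᵐ x, ContinuousAt a x := by
    filter_upwards [ha.ae_notMem volume] with x hx using not_not.1 hx
  have hb' : ∀ᵐ x, ContinuousAt b x := by
    filter_upwards [hb.ae_notMem volume] with x hx using not_not.1 hx
  filter_upwards [ae_fst_snd ha' hb'] with q hq
  exact tendsto_of_modulus (fun n => h _ _) (hq.1.tendsto.comp (hr _)) (hq.2.tendsto.comp (hr _))

theorem monotone_add_coe {α : EReal → ℝ} (hα : Monotone α) (x : EReal) :
    Antitone fun s : ℝ => α (x - s) := fun _ _ h =>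
  hα (EReal.sub_le_sub le_rfl (EReal.coe_le_coe_iff.2 h))

theorem HKBV.aestronglyMeasurable_translate {g : EReal × EReal → ℝ} (hg : HKBV g)
    (p : EReal × EReal) :
    AEStronglyMeasurable fun q : ℝ × ℝ => g (p.1 - (q.1 : EReal), p.2 - (q.2 : EReal)) := by
  obtain ⟨α, β, hα, hβ, h⟩ := hg.exists_modulus
  exact aestronglyMeasurable_of_modulus (fun q q' => h _ _)
    (monotone_add_coe hα p.1).countable_not_continuousAt
    (monotone_add_coe hβ p.2).countable_not_continuousAt

theorem HKBV.aestronglyMeasurable_toExt {g : EReal × EReal → ℝ} (hg : HKBV g) :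
    AEStronglyMeasurable fun q : ℝ × ℝ => g (toExt q) := by
  obtain ⟨α, β, hα, hβ, h⟩ := hg.exists_modulus
  exact aestronglyMeasurable_of_modulus (a := fun s => α s) (b := fun s => β s) (fun q q' => h _ _)
    (Monotone.countable_not_continuousAt fun _ _ h => hα (EReal.coe_le_coe_iff.2 h))
    (Monotone.countable_not_continuousAt fun _ _ h => hβ (EReal.coe_le_coe_iff.2 h))

theorem ae_continuousAt_coe {α : EReal → ℝ} (hα : Monotone α) :
    ∀ᵐ s : ℝ, ContinuousAt α (s : EReal) := by
  have h := hα.countable_not_continuousAt.preimage (f := ((↑) : ℝ → EReal)) EReal.coe_injective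
  filter_upwards [h.ae_notMem volume] with x hx using not_not.1 hx

/-! ### Limits at points of the extended line -/

/-- The trace on the real line of the neighbourhoods of a point of the extended line. -/
noncomputable def realNhds (b : EReal) : Filter ℝ := comap (↑) (𝓝 b)

instance (b : EReal) : (realNhds b).NeBot :=
  comap_neBot fun _ hs => by
    obtain ⟨_, hx, x, rfl⟩ := mem_closure_iff_nhds.1 (denseRange_coe_ereal b) _ hs
    exact ⟨x, hx⟩

theorem realNhds_coe (x : ℝ) : realNhds x = 𝓝 x :=
  (EReal.isEmbedding_coe.nhds_eq_comap x).symm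

theorem realNhds_top : realNhds ⊤ = atTop := by
  refine le_antisymm ?_ (tendsto_iff_comap.1 (EReal.tendsto_coe_nhds_top_iff.2 tendsto_id))
  refine le_iInf fun a => le_principal_iff.2 ?_
  exact ⟨Ioi (a : EReal), Ioi_mem_nhds (EReal.coe_lt_top a), fun x hx =>
    (EReal.coe_lt_coe_iff.1 hx).le⟩

theorem realNhds_bot : realNhds ⊥ = atBot := by
  refine le_antisymm ?_ (tendsto_iff_comap.1 tendsto_coe_nhds_bot)
  refine le_iInf fun a => le_principal_iff.2 ?_
  exact ⟨Iio (a : EReal), Iio_mem_nhds (EReal.bot_lt_coe a), fun x hx =>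
    (EReal.coe_lt_coe_iff.1 hx).le⟩

theorem comap_toExt_nhds (b : EReal × EReal) :
    comap toExt (𝓝 b) = realNhds b.1 ×ˢ realNhds b.2 := by
  rw [nhds_prod_eq]
  exact (Filter.prod_comap_comap_eq (m₁ := ((↑) : ℝ → EReal)) (m₂ := ((↑) : ℝ → EReal))).symm

theorem exists_tendsto_atTop_of_monotone {α : EReal → ℝ} (hα : Monotone α) :
    ∃ c, Tendsto (fun x : ℝ => α x) atTop (𝓝 c) :=
  ⟨_, tendsto_atTop_ciSup (fun _ _ h => hα (EReal.coe_le_coe_iff.2 h))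
    ⟨α ⊤, by rintro _ ⟨x, rfl⟩; exact hα le_top⟩⟩

theorem exists_tendsto_atBot_of_monotone {α : EReal → ℝ} (hα : Monotone α) :
    ∃ c, Tendsto (fun x : ℝ => α x) atBot (𝓝 c) :=
  ⟨_, tendsto_atBot_ciInf (fun _ _ h => hα (EReal.coe_le_coe_iff.2 h))
    ⟨α ⊥, by rintro _ ⟨x, rfl⟩; exact hα bot_le⟩⟩

/-- At an infinite b monotonicity gives the limit for every s. At a real x it suffices that α is
continuous at x − s, which fails only for s in a null set. -/
theorem ae_exists_tendsto_translate {α : EReal → ℝ} (hα : Monotone α) (b : EReal) :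
    ∀ᵐ s : ℝ, ∃ c, Tendsto (fun x : ℝ => α ((x - s : ℝ) : EReal)) (realNhds b) (𝓝 c) := by
  induction b with
  | bot =>
    obtain ⟨c, hc⟩ := exists_tendsto_atBot_of_monotone hα
    rw [realNhds_bot]
    exact ae_of_all _ fun s => ⟨c, hc.comp (tendsto_atBot_add_const_right _ (-s) tendsto_id)⟩
  | top =>
    obtain ⟨c, hc⟩ := exists_tendsto_atTop_of_monotone hα
    rw [realNhds_top]
    exact ae_of_all _ fun s => ⟨c, hc.comp (tendsto_atTop_add_const_right _ (-s) tendsto_id)⟩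
  | coe x =>
    rw [realNhds_coe]
    have h := (quasiMeasurePreserving_sub_left volume x).ae (ae_continuousAt_coe hα)
    filter_upwards [h] with s hs
    refine ⟨_, hs.tendsto.comp ?_⟩
    exact (continuous_coe_real_ereal.comp (continuous_id.sub continuous_const)).tendsto x

theorem HKBV.ae_exists_tendsto_translate {g : EReal × EReal → ℝ} (hg : HKBV g)
    (b : EReal × EReal) :
    ∀ᵐ q : ℝ × ℝ, ∃ c, Tendsto (fun p : ℝ × ℝ => g (toExt (p - q))) (comap toExt (𝓝 b)) (𝓝 c) := by
  obtain ⟨α, β, hα, hβ, h⟩ := hg.exists_modulus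
  filter_upwards [ae_fst_snd (_root_.ae_exists_tendsto_translate hα b.1)
    (_root_.ae_exists_tendsto_translate hβ b.2)] with q hq
  obtain ⟨⟨c, hc⟩, c', hc'⟩ := hq
  rw [comap_toExt_nhds]
  exact exists_tendsto_of_modulus (fun p p' => h _ _) (hc.comp tendsto_fst) (hc'.comp tendsto_snd)

theorem HKBV.exists_tendsto_corner {g : EReal × EReal → ℝ} (hg : HKBV g) {l₁ l₂ : Filter ℝ}
    (h₁ : l₁ ∈ ({atBot, atTop} : Set (Filter ℝ))) (h₂ : l₂ ∈ ({atBot, atTop} : Set (Filter ℝ))) :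
    ∃ L : ℝ, Tendsto (fun p : ℝ × ℝ => g (toExt p)) (l₁ ×ˢ l₂) (𝓝 L) := by
  obtain ⟨α, β, hα, hβ, h⟩ := hg.exists_modulus
  have key : ∀ {α : EReal → ℝ}, Monotone α → ∀ {l : Filter ℝ},
      l ∈ ({atBot, atTop} : Set (Filter ℝ)) →
        l.NeBot ∧ ∃ c, Tendsto (fun x : ℝ => α x) l (𝓝 c) := by
    rintro α hα l (rfl | rfl)
    · exact ⟨inferInstance, exists_tendsto_atBot_of_monotone hα⟩
    · exact ⟨inferInstance, exists_tendsto_atTop_of_monotone hα⟩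
  obtain ⟨n₁, c, hc⟩ := key hα h₁
  obtain ⟨n₂, c', hc'⟩ := key hβ h₂
  exact exists_tendsto_of_modulus (fun p p' => h _ _) (hc.comp tendsto_fst) (hc'.comp tendsto_snd)

/-! ### Continuous functions on the extended line with an integrable derivative -/

/-- The continuous extension of the sigmoid function to the extended line. -/
noncomputable def extSigmoid : C(EReal, ℝ) where
  toFun x := ENNReal.orderIsoUnitIntervalBirational (EReal.expOrderIso x)
  continuous_toFun := continuous_subtype_val.comp
    (ENNReal.orderIsoUnitIntervalBirational.continuous.comp EReal.expOrderIso.continuous)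

theorem extSigmoid_apply (x : EReal) : extSigmoid x = ((EReal.exp x)⁻¹ + 1)⁻¹.toReal :=
  ENNReal.orderIsoUnitIntervalBirational_apply_coe _

theorem extSigmoid_strictMono : StrictMono extSigmoid := fun _ _ h =>
  ENNReal.orderIsoUnitIntervalBirational.strictMono (EReal.expOrderIso.strictMono h)

theorem extSigmoid_coe (x : ℝ) : extSigmoid x = Real.sigmoid x := by
  rw [extSigmoid_apply, EReal.exp_coe, Real.sigmoid_def, ← ENNReal.ofReal_inv_of_pos (Real.exp_pos x),
    ← ENNReal.ofReal_one, ← ENNReal.ofReal_add (by positivity) zero_le_one, ENNReal.toReal_inv,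
    ENNReal.toReal_ofReal (by positivity), Real.exp_neg, add_comm]

theorem extSigmoid_bot : extSigmoid ⊥ = 0 := by
  simp [extSigmoid_apply]

theorem extSigmoid_top : extSigmoid ⊤ = 1 := by
  simp [extSigmoid_apply]

theorem extSigmoid_nonneg (x : EReal) : 0 ≤ extSigmoid x := by
  rw [extSigmoid_apply]; exact ENNReal.toReal_nonneg

theorem extSigmoid_le_one (x : EReal) : extSigmoid x ≤ 1 := by
  rw [← extSigmoid_top]; exact extSigmoid_strictMono.monotone le_top

/-- `u` is the integral over `(-∞, ·]` of the integrable function `k`, and a Lipschitz function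
of the sigmoid function. -/
structure IsLinePrimitive (u : C(EReal, ℝ)) (k : ℝ → ℝ) : Prop where
  integrable : Integrable k
  eq_integral : ∀ y, u y = ∫ s in {s : ℝ | (s : EReal) ≤ y}, k s
  lipschitz : ∃ L, 0 ≤ L ∧ ∀ x y, |u x - u y| ≤ L * |extSigmoid x - extSigmoid y|

theorem IsLinePrimitive.bot {u : C(EReal, ℝ)} {k : ℝ → ℝ} (h : IsLinePrimitive u k) : u ⊥ = 0 := by
  rw [h.eq_integral]; simp

theorem IsLinePrimitive.top {u : C(EReal, ℝ)} {k : ℝ → ℝ} (h : IsLinePrimitive u k) :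
    u ⊤ = ∫ s, k s := by
  rw [h.eq_integral]; simp

theorem IsLinePrimitive.integral_Ioc {u : C(EReal, ℝ)} {k : ℝ → ℝ} (h : IsLinePrimitive u k)
    {x y : EReal} (hxy : x ≤ y) :
    ∫ s in {s : ℝ | (s : EReal) ∈ Ioc x y}, k s = u y - u x := by
  have e : {s : ℝ | (s : EReal) ∈ Ioc x y} = {s : ℝ | (s : EReal) ≤ y} \ {s : ℝ | (s : EReal) ≤ x} := by
    ext s; simp [and_comm]
  have hm : MeasurableSet {s : ℝ | (s : EReal) ≤ x} := measurable_coe_real_ereal measurableSet_Iic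
  have hs : {s : ℝ | (s : EReal) ≤ x} ⊆ {s : ℝ | (s : EReal) ≤ y} := fun s hs => le_trans hs hxy
  rw [e, setIntegral_sdiff hm h.integrable.integrableOn hs, h.eq_integral, h.eq_integral]

/-- The kernel is the derivative of the power. It is nonnegative, so convergence of its integrals
over [−x, x] proves integrability. -/
theorem isLinePrimitive_extSigmoid_pow (n : ℕ) : IsLinePrimitive (extSigmoid ^ (n + 1))
    fun s => (n + 1 : ℕ) * Real.sigmoid s ^ n * (Real.sigmoid s * (1 - Real.sigmoid s)) := by
  set k : ℝ → ℝ := fun s => (n + 1 : ℕ) * Real.sigmoid s ^ n *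
    (Real.sigmoid s * (1 - Real.sigmoid s)) with hk
  have hd : ∀ x, HasDerivAt (fun s => Real.sigmoid s ^ (n + 1)) (k x) x := fun x =>
    (Real.hasDerivAt_sigmoid x).pow (n + 1)
  have hcont : Continuous k := by
    have := continuous_sigmoid
    rw [hk]; fun_prop
  have h0 : ∀ x, 0 ≤ k x := fun x => by
    have h1 := Real.sigmoid_nonneg x
    have h2 := Real.sigmoid_le_one x
    exact mul_nonneg (by positivity) (mul_nonneg h1 (by linarith))
  have htop : Tendsto (fun s => Real.sigmoid s ^ (n + 1)) atTop (𝓝 1) := by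
    simpa using Real.tendsto_sigmoid_atTop.pow (n + 1)
  have hbot : Tendsto (fun s => Real.sigmoid s ^ (n + 1)) atBot (𝓝 0) := by
    simpa using Real.tendsto_sigmoid_atBot.pow (n + 1)
  have hint : Integrable k := by
    refine integrable_of_intervalIntegral_norm_tendsto (l := atTop) (a := fun x => -x) (b := id) 1
      (fun i => (hcont.integrableOn_Icc).mono_set Ioc_subset_Icc_self) tendsto_neg_atTop_atBot
      tendsto_id ?_
    have e : ∀ x : ℝ, ∫ s in -x..id x, ‖k s‖ =
        Real.sigmoid x ^ (n + 1) - Real.sigmoid (-x) ^ (n + 1) := fun x => by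
      simp only [Real.norm_of_nonneg (h0 _), id]
      exact intervalIntegral.integral_eq_sub_of_hasDerivAt (fun s _ => hd s)
        (hcont.intervalIntegrable _ _)
    simp only [e]
    simpa using htop.sub (hbot.comp tendsto_neg_atTop_atBot)
  refine ⟨hint, fun y => ?_, n + 1, by positivity, fun x y => ?_⟩
  · induction y with
    | bot => simp [extSigmoid_bot]
    | top =>
      have := integral_of_hasDerivAt_of_tendsto hd hint hbot htop
      simp [extSigmoid_top, this]
    | coe y =>
      have := integral_Iic_of_hasDerivAt_of_tendsto' (fun x _ => hd x) hint.integrableOn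
        (a := y) hbot
      simp only [EReal.coe_le_coe_iff]
      rw [show {s : ℝ | s ≤ y} = Iic y from rfl, this]
      simp [extSigmoid_coe]
  · have key : ∀ (a b : ℝ), 0 ≤ a → a ≤ 1 → 0 ≤ b → b ≤ 1 → ∀ m : ℕ,
        |a ^ m - b ^ m| ≤ m * |a - b| := by
      intro a b ha ha' hb hb' m
      induction m with
      | zero => simp
      | succ m ih =>
        have e : a ^ (m + 1) - b ^ (m + 1) = a * (a ^ m - b ^ m) + b ^ m * (a - b) := by ring
        have h1 : b ^ m ≤ 1 := pow_le_one₀ hb hb'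
        calc |a ^ (m + 1) - b ^ (m + 1)| ≤ |a * (a ^ m - b ^ m)| + |b ^ m * (a - b)| := by
              rw [e]; exact abs_add_le _ _
          _ ≤ 1 * (m * |a - b|) + 1 * |a - b| := by
              rw [abs_mul, abs_mul, abs_of_nonneg ha, abs_of_nonneg (pow_nonneg hb m)]
              gcongr
          _ = (m + 1 : ℕ) * |a - b| := by push_cast; ring
    simpa using key _ _ (extSigmoid_nonneg x) (extSigmoid_le_one x) (extSigmoid_nonneg y)
      (extSigmoid_le_one y) (n + 1)

/-! ### The Stieltjes integral of a tensor product -/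

/-- The function `(x, y) ↦ u x * v y`. -/
noncomputable def tensor (u v : C(EReal, ℝ)) : C(EReal × EReal, ℝ) :=
  u.comp ContinuousMap.fst * v.comp ContinuousMap.snd

@[simp] theorem tensor_apply (u v : C(EReal, ℝ)) (p : EReal × EReal) :
    tensor u v p = u p.1 * v p.2 := rfl

theorem sum_by_parts (u G : ℕ → ℝ) {n : ℕ} (h0 : u 0 = 0) (hn : G n = 0) :
    ∑ i ∈ Finset.range n, u i * (G (i + 1) - G i) =
      -∑ i ∈ Finset.range n, (u (i + 1) - u i) * G (i + 1) := by
  have h := Finset.sum_range_sub (fun i => u i * G i) n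
  rw [h0, hn, mul_zero, zero_mul, sub_zero] at h
  rw [eq_neg_iff_add_eq_zero, ← Finset.sum_add_distrib, ← h]
  exact Finset.sum_congr rfl fun i _ => by ring

/-- Abel summation in each variable; the two signs cancel, and no boundary terms remain since `u`,
`v` vanish at the start and `G` at the end. -/
theorem sum_by_parts_two (u v : ℕ → ℝ) (G : ℕ → ℕ → ℝ) {n : ℕ} (hu : u 0 = 0) (hv : v 0 = 0)
    (h1 : ∀ j, G n j = 0) (h2 : ∀ i, G i n = 0) :
    ∑ i ∈ Finset.range n, ∑ j ∈ Finset.range n,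
        u i * v j * (G i j + G (i + 1) (j + 1) - G i (j + 1) - G (i + 1) j) =
      ∑ i ∈ Finset.range n, ∑ j ∈ Finset.range n,
        (u (i + 1) - u i) * (v (j + 1) - v j) * G (i + 1) (j + 1) := by
  have e1 : ∀ i, ∑ j ∈ Finset.range n,
      u i * v j * (G i j + G (i + 1) (j + 1) - G i (j + 1) - G (i + 1) j) =
        -∑ j ∈ Finset.range n, (v (j + 1) - v j) * (u i * (G (i + 1) (j + 1) - G i (j + 1))) := by
    intro i
    have := sum_by_parts v (fun j => G (i + 1) j - G i j) hv (by rw [h2, h2, sub_zero])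
    calc _ = u i * ∑ j ∈ Finset.range n,
          v j * (G (i + 1) (j + 1) - G i (j + 1) - (G (i + 1) j - G i j)) := by
            rw [Finset.mul_sum]; exact Finset.sum_congr rfl fun j _ => by ring
      _ = _ := by
        rw [this, mul_neg, Finset.mul_sum]
        congr 1
        exact Finset.sum_congr rfl fun j _ => by ring
  simp only [e1, Finset.sum_neg_distrib]
  rw [Finset.sum_comm, Finset.sum_comm (f := fun i j =>
    (u (i + 1) - u i) * (v (j + 1) - v j) * G (i + 1) (j + 1)), ← Finset.sum_neg_distrib]
  refine Finset.sum_congr rfl fun j _ => ?_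
  rw [← Finset.mul_sum, sum_by_parts u (fun i => G i (j + 1)) hu (h1 _), mul_neg, neg_neg,
    Finset.mul_sum]
  exact Finset.sum_congr rfl fun i _ => by ring

theorem exists_cell {t : ℕ → EReal} (ht : Monotone t) {n : ℕ} (h0 : t 0 = ⊥) (hn : t n = ⊤)
    (s : ℝ) : ∃ i < n, (s : EReal) ∈ Ioc (t i) (t (i + 1)) := by
  classical
  have hex : ∃ m, (s : EReal) ≤ t m := ⟨n, hn ▸ le_top⟩
  have hpos : Nat.find hex ≠ 0 := fun h => by
    have := Nat.find_spec hex
    rw [h, h0] at this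
    exact absurd this (not_le.2 (EReal.bot_lt_coe s))
  obtain ⟨i, hi⟩ := Nat.exists_eq_succ_of_ne_zero hpos
  have h1 : ¬ (s : EReal) ≤ t i := Nat.find_min hex (by omega)
  have h2 : (s : EReal) ≤ t (i + 1) := by
    have := Nat.find_spec hex
    rwa [hi] at this
  refine ⟨i, ?_, not_le.1 h1, h2⟩
  by_contra h
  exact h1 (le_trans (hn ▸ le_top) (ht (not_lt.1 h)))

theorem sum_indicator_cell {t : ℕ → EReal} (ht : Monotone t) {n i : ℕ} (hi : i < n) {s : ℝ}
    (hs : (s : EReal) ∈ Ioc (t i) (t (i + 1))) (k : ℝ → ℝ) (w : ℕ → ℝ) :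
    ∑ j ∈ Finset.range n, {s : ℝ | (s : EReal) ∈ Ioc (t j) (t (j + 1))}.indicator k s * w j =
      k s * w i := by
  rw [Finset.sum_eq_single_of_mem i (Finset.mem_range.2 hi), indicator_of_mem (by exact hs)]
  intro j _ hj
  rw [indicator_of_notMem, zero_mul]
  exact fun h => disjoint_left.1 (ht.pairwise_disjoint_on_Ioc_succ hj) h hs

theorem measurableSet_coe_mem_Ioc (x y : EReal) :
    MeasurableSet {s : ℝ | (s : EReal) ∈ Ioc x y} :=
  measurable_coe_real_ereal measurableSet_Ioc

/-- The index c s is that of the cell containing s, so the integrand is k ⊗ l times the step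
function equal to the value of `G` at the upper right corner of each cell. -/
theorem sum_cells_eq_integral {u v : C(EReal, ℝ)} {k l : ℝ → ℝ} (hu : IsLinePrimitive u k)
    (hv : IsLinePrimitive v l) {t : ℕ → EReal} (ht : Monotone t) {n : ℕ} (G : ℕ → ℕ → ℝ)
    {c : ℝ → ℕ} (hc : ∀ s : ℝ, c s < n ∧ (s : EReal) ∈ Ioc (t (c s)) (t (c s + 1))) :
    (AEStronglyMeasurable fun q : ℝ × ℝ => k q.1 * l q.2 * G (c q.1 + 1) (c q.2 + 1)) ∧
    ∑ i ∈ Finset.range n, ∑ j ∈ Finset.range n,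
        (u (t (i + 1)) - u (t i)) * (v (t (j + 1)) - v (t j)) * G (i + 1) (j + 1) =
      ∫ q : ℝ × ℝ, k q.1 * l q.2 * G (c q.1 + 1) (c q.2 + 1) := by
  let A : ℕ → Set ℝ := fun i => {s : ℝ | (s : EReal) ∈ Ioc (t i) (t (i + 1))}
  have hA : ∀ i, MeasurableSet (A i) := fun i => measurableSet_coe_mem_Ioc _ _
  have hk : ∀ i, Integrable ((A i).indicator k) := fun i => hu.integrable.indicator (hA i)
  have hl : ∀ i, Integrable ((A i).indicator l) := fun i => hv.integrable.indicator (hA i)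
  have hpt : (fun q : ℝ × ℝ => k q.1 * l q.2 * G (c q.1 + 1) (c q.2 + 1)) = fun q : ℝ × ℝ =>
      ∑ i ∈ Finset.range n, ∑ j ∈ Finset.range n,
        (A i).indicator k q.1 * (A j).indicator l q.2 * G (i + 1) (j + 1) := by
    funext q
    have h1 : ∀ i, ∑ j ∈ Finset.range n,
        (A i).indicator k q.1 * (A j).indicator l q.2 * G (i + 1) (j + 1) =
          (A i).indicator k q.1 * (l q.2 * G (i + 1) (c q.2 + 1)) := by
      intro i
      rw [← sum_indicator_cell ht (hc q.2).1 (hc q.2).2 l fun j => G (i + 1) (j + 1),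
        Finset.mul_sum]
      exact Finset.sum_congr rfl fun j _ => by ring
    simp only [h1]
    rw [sum_indicator_cell ht (hc q.1).1 (hc q.1).2 k fun i => l q.2 * G (i + 1) (c q.2 + 1)]
    ring
  have hint : ∀ i j, Integrable fun q : ℝ × ℝ =>
      (A i).indicator k q.1 * (A j).indicator l q.2 * G (i + 1) (j + 1) := fun i j =>
    ((hk i).mul_prod (hl j)).mul_const _
  rw [hpt]
  refine ⟨(integrable_finsetSum _ fun i _ => integrable_finsetSum _ fun j _ =>
    hint i j).aestronglyMeasurable, ?_⟩
  rw [integral_finsetSum _ fun i _ => integrable_finsetSum _ fun j _ => hint i j]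
  refine Finset.sum_congr rfl fun i _ => ?_
  rw [integral_finsetSum _ fun j _ => hint i j]
  refine Finset.sum_congr rfl fun j _ => ?_
  rw [integral_mul_const]
  congr 1
  rw [Measure.volume_eq_prod, integral_prod_mul, integral_indicator (hA i), integral_indicator (hA j),
    hu.integral_Ioc (ht (Nat.le_succ i)), hv.integral_Ioc (ht (Nat.le_succ j))]

/-- Summation by parts writes Riemann sums on fine grids as Lebesgue integrals of k ⊗ l against step
functions made from `G`. These are bounded and converge to `G` at almost every real point, by the
modulus. -/
theorem stieltjes_tensor {u v : C(EReal, ℝ)} {k l : ℝ → ℝ} (hu : IsLinePrimitive u k)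
    (hv : IsLinePrimitive v l) {G : EReal × EReal → ℝ} (hG : HKBV G)
    (h1 : ∀ y, G (⊤, y) = 0) (h2 : ∀ x, G (x, ⊤) = 0) :
    stieltjes (tensor u v) G = ∫ q : ℝ × ℝ, k q.1 * l q.2 * G (toExt q) := by
  obtain ⟨M, hM0, hM⟩ := hG.exists_bound
  obtain ⟨α, β, hα, hβ, hmod⟩ := hG.exists_modulus
  obtain ⟨L, hL0, hL⟩ := hu.lipschitz
  obtain ⟨L', hL0', hL'⟩ := hv.lipschitz
  set V := (vitaliVariation G).toReal
  have hlim : Tendsto (fun n : ℕ => 1 / ((n : ℝ) + 1)) atTop (𝓝 0) :=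
    tendsto_one_div_add_atTop_nhds_zero_nat
  choose m t ht h0 hm hosc using fun n : ℕ => exists_small_oscillation_line extSigmoid.continuous
    (show 0 < 1 / ((n : ℝ) + 1) by positivity)
  choose c hc using fun n => exists_cell (ht n) (h0 n) (hm n)
  have hub : ∀ x, |u x| ≤ L := fun x => by
    have := hL x ⊥
    rw [hu.bot, extSigmoid_bot, sub_zero, sub_zero, abs_of_nonneg (extSigmoid_nonneg x)] at this
    exact this.trans (mul_le_of_le_one_right hL0 (extSigmoid_le_one x))
  have hvb : ∀ x, |v x| ≤ L' := fun x => by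
    have := hL' x ⊥
    rw [hv.bot, extSigmoid_bot, sub_zero, sub_zero, abs_of_nonneg (extSigmoid_nonneg x)] at this
    exact this.trans (mul_le_of_le_one_right hL0' (extSigmoid_le_one x))
  let S : ℕ → ℝ := fun n => ∫ q : ℝ × ℝ,
    k q.1 * l q.2 * G (t n (c n q.1 + 1), t n (c n q.2 + 1))
  have hS : ∀ n, |S n - stieltjes (tensor u v) G| ≤ 2 * L * L' * (1 / ((n : ℝ) + 1)) * V := by
    intro n
    have hdiv := (isLineDiv_of_monotone (ht n) (h0 n) (hm n)).prod
      (κ := fun _ : Fin (m n) => Fin (m n)) (fun _ => isLineDiv_of_monotone (ht n) (h0 n) (hm n))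
    have h := isRiemannLimit_stieltjes (tensor u v) hG.1 _ _ _
      (2 * L * L' * (1 / ((n : ℝ) + 1))) hdiv hdiv.lowerLeft_mem ?_
    · convert h using 3
      rw [Fintype.sum_sigma]
      have h3 := sum_by_parts_two (fun i => u (t n i)) (fun j => v (t n j))
        (fun i j => G (t n i, t n j)) (n := m n) (by simp [h0, hu.bot]) (by simp [h0, hv.bot])
        (by simp [hm, h1]) (by simp [hm, h2])
      rw [(sum_cells_eq_integral hu hv (ht n) (fun i j => G (t n i, t n j)) (hc n)).2] at h3
      refine h3.symm.trans ?_
      rw [Finset.sum_range]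
      refine Finset.sum_congr rfl fun i _ => ?_
      rw [Finset.sum_range]
      rfl
    · rintro ⟨i, j⟩ p ⟨hp1, hp2⟩
      have ha := hosc n i i.2 _ hp1 _ (left_mem_Icc.2 (ht n (Nat.le_succ _)))
      have hb := hosc n j j.2 _ hp2 _ (left_mem_Icc.2 (ht n (Nat.le_succ _)))
      have ha' := (hL p.1 (t n i)).trans (mul_le_mul_of_nonneg_left ha hL0)
      have hb' := (hL' p.2 (t n j)).trans (mul_le_mul_of_nonneg_left hb hL0')
      simp only [tensor_apply]
      calc |u p.1 * v p.2 - u (t n i) * v (t n j)|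
          = |u p.1 * (v p.2 - v (t n j)) + (u p.1 - u (t n i)) * v (t n j)| := by
            congr 1; ring
        _ ≤ |u p.1| * |v p.2 - v (t n j)| + |u p.1 - u (t n i)| * |v (t n j)| := by
            rw [← abs_mul, ← abs_mul]; exact abs_add_le _ _
        _ ≤ L * (L' * (1 / ((n : ℝ) + 1))) + (L * (1 / ((n : ℝ) + 1))) * L' := by
            gcongr
            · exact hub _
            · exact hvb _
        _ = 2 * L * L' * (1 / ((n : ℝ) + 1)) := by ring
  have hSlim : Tendsto S atTop (𝓝 (stieltjes (tensor u v) G)) := by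
    rw [tendsto_iff_dist_tendsto_zero]
    refine squeeze_zero (fun _ => dist_nonneg) hS ?_
    simpa using (hlim.const_mul (2 * L * L')).mul_const V
  refine tendsto_nhds_unique hSlim ?_
  -- The sigmoid embeds the extended line, so cells of small sigmoid oscillation shrink to s in its
  -- topology.
  have hct : ∀ s : ℝ, Tendsto (fun n => t n (c n s + 1)) atTop (𝓝 (s : EReal)) := by
    intro s
    rw [(extSigmoid.continuous.isClosedEmbedding
      extSigmoid_strictMono.injective).isInducing.tendsto_nhds_iff, tendsto_iff_dist_tendsto_zero]
    refine squeeze_zero (fun _ => dist_nonneg) (fun n => ?_) hlim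
    exact hosc n (c n s) (hc n s).1 _ (right_mem_Icc.2 (ht n (Nat.le_succ _))) _
      (Ioc_subset_Icc_self (hc n s).2)
  refine tendsto_integral_of_dominated_convergence (fun q => |k q.1 * l q.2| * M)
    (fun n => (sum_cells_eq_integral hu hv (ht n) (fun i j => G (t n i, t n j)) (hc n)).1)
    ((hu.integrable.mul_prod hv.integrable).abs.mul_const M)
    (fun n => ae_of_all _ fun q => ?_) ?_
  · rw [Real.norm_eq_abs, abs_mul]
    exact mul_le_mul_of_nonneg_left (hM _) (abs_nonneg _)
  · filter_upwards [ae_fst_snd (ae_continuousAt_coe hα) (ae_continuousAt_coe hβ)] with q hq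
    refine Tendsto.const_mul _ ?_
    exact tendsto_of_modulus (fun n => hmod _ _) (hq.1.tendsto.comp (hct q.1))
      (hq.2.tendsto.comp (hct q.2))

/-! ### Density of linear combinations of tensor products -/

theorem bcPart_add (F F' : C(EReal × EReal, ℝ)) : bcPart (F + F') = bcPart F + bcPart F' := by
  ext p; simp only [bcPart_apply, ContinuousMap.add_apply]; ring

theorem bcPart_smul (c : ℝ) (F : C(EReal × EReal, ℝ)) : bcPart (c • F) = c • bcPart F := by
  ext p; simp only [bcPart_apply, ContinuousMap.smul_apply, smul_eq_mul]; ring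

theorem bcPart_sub (F F' : C(EReal × EReal, ℝ)) : bcPart (F - F') = bcPart F - bcPart F' := by
  ext p; simp only [bcPart_apply, ContinuousMap.sub_apply]; ring

theorem bcPart_eq_self {F : C(EReal × EReal, ℝ)} (hF : F ∈ BcPlane) : bcPart F = F := by
  ext p; simp [bcPart_apply, (hF _).1, (hF _).2]

theorem norm_bcPart_le (F : C(EReal × EReal, ℝ)) : ‖bcPart F‖ ≤ 4 * ‖F‖ := by
  refine (ContinuousMap.norm_le _ (by positivity)).2 fun p => ?_
  have h : ∀ q, |F q| ≤ ‖F‖ := F.norm_coe_le_norm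
  have h1 := abs_le.1 (h p)
  have h2 := abs_le.1 (h (⊥, p.2))
  have h3 := abs_le.1 (h (p.1, ⊥))
  have h4 := abs_le.1 (h (⊥, ⊥))
  rw [bcPart_apply, Real.norm_eq_abs, abs_le]
  constructor <;> linarith

theorem tensor_mem {u v : C(EReal, ℝ)} (hu : u ⊥ = 0) (hv : v ⊥ = 0) : tensor u v ∈ BcPlane :=
  fun s => by simp [hu, hv]

/-- By Stone–Weierstrass polynomials in the two sigmoids are dense. `bcPart` is a bounded projection
onto `BcPlane`, and it annihilates the monomials in which one of the variables is absent. -/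
theorem bcPart_induction {P : C(EReal × EReal, ℝ) → Prop}
    (hadd : ∀ F ∈ BcPlane, ∀ F' ∈ BcPlane, P F → P F' → P (F + F'))
    (hsmul : ∀ (c : ℝ), ∀ F ∈ BcPlane, P F → P (c • F))
    (hlim : ∀ F ∈ BcPlane, (∀ ε > 0, ∃ F' ∈ BcPlane, P F' ∧ ‖F - F'‖ ≤ ε) → P F)
    (htensor : ∀ u v k l, IsLinePrimitive u k → IsLinePrimitive v l → P (tensor u v))
    {F : C(EReal × EReal, ℝ)} (hF : F ∈ BcPlane) : P F := by
  let X : C(EReal × EReal, ℝ) := extSigmoid.comp ContinuousMap.fst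
  let Y : C(EReal × EReal, ℝ) := extSigmoid.comp ContinuousMap.snd
  have hX : ∀ p, X p = extSigmoid p.1 := fun _ => rfl
  have hY : ∀ p, Y p = extSigmoid p.2 := fun _ => rfl
  have hprim := isLinePrimitive_extSigmoid_pow
  have hP0 : P 0 := by
    have := hsmul 0 _ (tensor_mem (hprim 0).bot (hprim 0).bot)
      (htensor _ _ _ _ (hprim 0) (hprim 0))
    rwa [zero_smul] at this
  have hmono : ∀ i j : ℕ, P (bcPart (X ^ i * Y ^ j)) := by
    intro i j
    rcases i with _ | i
    · convert hP0
      ext p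
      simp [bcPart_apply, hY]
    rcases j with _ | j
    · convert hP0
      ext p
      simp [bcPart_apply, hX]
    · have e : X ^ (i + 1) * Y ^ (j + 1) = tensor (extSigmoid ^ (i + 1)) (extSigmoid ^ (j + 1)) := by
        ext p; simp [hX, hY]
      rw [e, bcPart_eq_self (tensor_mem (hprim i).bot (hprim j).bot)]
      exact htensor _ _ _ _ (hprim i) (hprim j)
  have hA : ∀ G ∈ Algebra.adjoin ℝ {X, Y}, P (bcPart G) := by
    intro G hG
    have hG' : G ∈ Submodule.span ℝ (Submonoid.closure {X, Y} : Set C(EReal × EReal, ℝ)) := by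
      rw [← Algebra.adjoin_eq_span]; exact hG
    clear hG
    induction hG' using Submodule.span_induction with
    | mem G hG =>
      obtain ⟨i, j, rfl⟩ := (Submonoid.mem_closure_pair _ _ _).1 hG
      exact hmono i j
    | zero => convert hP0; ext p; simp [bcPart_apply]
    | add G G' h h' ih ih' =>
      rw [bcPart_add]
      exact hadd _ (bcPart_mem _) _ (bcPart_mem _) ih ih'
    | smul c G h ih =>
      rw [bcPart_smul]
      exact hsmul _ _ (bcPart_mem _) ih
  have hsep : (Algebra.adjoin ℝ {X, Y}).SeparatesPoints := by
    intro p q hpq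
    by_cases h : p.1 = q.1
    · have h' : p.2 ≠ q.2 := fun h' => hpq (Prod.ext h h')
      exact ⟨Y, ⟨Y, Algebra.subset_adjoin (by simp), rfl⟩, extSigmoid_strictMono.injective.ne h'⟩
    · exact ⟨X, ⟨X, Algebra.subset_adjoin (by simp), rfl⟩, extSigmoid_strictMono.injective.ne h⟩
  refine hlim F hF fun ε hε => ?_
  -- The approximation is to within ε/4 because `bcPart` has norm at most 4.
  obtain ⟨G, hG⟩ := ContinuousMap.exists_mem_subalgebra_near_continuousMap_of_separatesPoints
    _ hsep F (ε / 4) (by positivity)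
  refine ⟨bcPart G, bcPart_mem _, hA _ G.2, ?_⟩
  rw [norm_sub_rev] at hG
  calc ‖F - bcPart G‖ = ‖bcPart (F - G)‖ := by rw [bcPart_sub, bcPart_eq_self hF]
    _ ≤ 4 * ‖F - G‖ := norm_bcPart_le _
    _ ≤ ε := by linarith

/-! ### The convolution as a functional of the primitive -/

theorem HKBV.cutReal {g : EReal × EReal → ℝ} (hg : HKBV g) : HKBV (cutReal g) := by
  rw [cutReal_eq]
  exact (hg.cutTop.reflectFun 0).cutTop.reflectFun 0

/-- The value at `p` of the convolution of `∂₁₂ F` and `g`. -/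
noncomputable def convFun (F : C(EReal × EReal, ℝ)) (g : EReal × EReal → ℝ) (p : ℝ × ℝ) : ℝ :=
  stieltjes F (cutReal (reflectFun g p))

section

variable {f : 𝓓'((⊤ : TopologicalSpace.Opens (ℝ × ℝ)), ℝ)} {F F' : C(EReal × EReal, ℝ)}
  {g : EReal × EReal → ℝ}

theorem convFun_add (hg : HKBV g) (p : ℝ × ℝ) :
    convFun (F + F') g p = convFun F g p + convFun F' g p :=
  stieltjes_add _ _ (hg.reflectFun p).cutReal.1

theorem convFun_smul (hg : HKBV g) (c : ℝ) (p : ℝ × ℝ) :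
    convFun (c • F) g p = c * convFun F g p :=
  stieltjes_smul _ _ (hg.reflectFun p).cutReal.1

theorem convFun_sub (hg : HKBV g) (p : ℝ × ℝ) :
    convFun (F - F') g p = convFun F g p - convFun F' g p :=
  stieltjes_sub _ _ (hg.reflectFun p).cutReal.1

theorem sub_mem_bcPlane (hF : F ∈ BcPlane) (hF' : F' ∈ BcPlane) : F - F' ∈ BcPlane := fun s => by
  simp [(hF s).1, (hF s).2, (hF' s).1, (hF' s).2]

theorem abs_convFun_le (hF : F ∈ BcPlane) (hg : HKBV g) (p : ℝ × ℝ) :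
    |convFun F g p| ≤ ‖F‖ * (bvENorm g).toReal := by
  -- The estimate goes through `cutTop`, for which the Vitali variation is at most the norm with
  -- constant one.
  rw [convFun, ← stieltjes_cutTop_eq_cutReal hF (hg.reflectFun p)]
  refine (abs_stieltjes_le F (vitaliVariation_cutTop_lt_top (hg.reflectFun p))).trans ?_
  refine mul_le_mul_of_nonneg_left (ENNReal.toReal_mono hg.bvENorm_lt_top.ne ?_) (norm_nonneg _)
  exact (vitaliVariation_cutTop_le (hg.reflectFun p)).trans (bvENorm_reflectFun_le g p)

theorem abs_convFun_sub_le (hF : F ∈ BcPlane) (hF' : F' ∈ BcPlane) (hg : HKBV g) (p : ℝ × ℝ) :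
    |convFun F g p - convFun F' g p| ≤ ‖F - F'‖ * (bvENorm g).toReal := by
  rw [← convFun_sub hg]
  exact abs_convFun_le (sub_mem_bcPlane hF hF') hg p

theorem convFun_tensor {u v : C(EReal, ℝ)} {k l : ℝ → ℝ} (hu : IsLinePrimitive u k)
    (hv : IsLinePrimitive v l) (hg : HKBV g) (p : ℝ × ℝ) :
    convFun (tensor u v) g p = ∫ q : ℝ × ℝ, k q.1 * l q.2 * g (toExt (p - q)) := by
  rw [convFun, stieltjes_tensor hu hv (hg.reflectFun p).cutReal (fun _ => by simp [cutReal])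
    (fun _ => by simp [cutReal])]
  refine integral_congr_ae (ae_of_all _ fun q => ?_)
  simp only
  rw [cutReal_toExt, reflectFun_eq, Function.comp_apply, pointReflection_toExt]

/-- The correction terms in `bcPart` depend on at most one variable, and `cutReal g` vanishes at all
infinite points, so they integrate to zero. Reflection of the main term gives `convFun`. -/
theorem stieltjes_bcPart_reflectMap (F : C(EReal × EReal, ℝ)) (hg : HKBV g) (p : ℝ × ℝ) :
    stieltjes (bcPart (reflectMap F p)) (cutTop g) = convFun F g p := by
  have hG := hg.cutReal.1
  have h1 : ∀ t, cutReal g (⊤, t) = 0 := fun _ => by simp [cutReal]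
  have h2 : ∀ t, cutReal g (⊥, t) = 0 := fun _ => by simp [cutReal]
  have h3 : ∀ t, cutReal g (t, ⊤) = 0 := fun _ => by simp [cutReal]
  have h4 : ∀ t, cutReal g (t, ⊥) = 0 := fun _ => by simp [cutReal]
  rw [stieltjes_cutTop_eq_cutReal (bcPart_mem _) hg, bcPart, stieltjes_add _ _ hG,
    stieltjes_sub _ _ hG, stieltjes_sub _ _ hG,
    stieltjes_eq_zero_of_snd ((reflectMap F p).comp ⟨fun p => (⊥, p.2), by fun_prop⟩) hG
      (fun _ _ => rfl) fun t => by rw [h1, h2],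
    stieltjes_eq_zero_of_fst ((reflectMap F p).comp ⟨fun p => (p.1, ⊥), by fun_prop⟩) hG
      (fun _ _ => rfl) fun t => by rw [h3, h4], stieltjes_const _ hG,
    reflectMap, stieltjes_comp_pointReflection F hG, cutReal_reflectFun]
  simp [ExtRect.incr, extPlane, h1, h2, convFun]

theorem hasIntegralMul_reflectDist_iff (hF : IsPrimitive f F) (hg : HKBV g) (p : ℝ × ℝ) {A : ℝ} :
    HasIntegralMul (reflectDist f p) g extPlane A ↔ A = convFun F g p := by
  have h := isPrimitive_reflectDist hF p
  rw [hasIntegralMul_iff h (fun _ h' => primitive_unique h h') hg, stieltjes_bcPart_reflectMap F hg]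

theorem hasIntegralMul_reflectFun_iff (hF : IsPrimitive f F) (hg : HKBV g) (p : ℝ × ℝ) {A : ℝ} :
    HasIntegralMul f (reflectFun g p) extPlane A ↔ A = convFun F g p := by
  rw [hasIntegralMul_iff hF (fun _ h' => primitive_unique hF h') (hg.reflectFun p),
    stieltjes_cutTop_eq_cutReal hF.1 (hg.reflectFun p), convFun]

theorem convDF_eq (hF : IsPrimitive f F) (hg : HKBV g) : convDF f g = convFun F g := by
  funext p
  have hex : ∃ A, HasIntegralMul (reflectDist f p) g extPlane A :=
    ⟨_, (hasIntegralMul_reflectDist_iff hF hg p).2 rfl⟩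
  rw [convDF, integralMul, dif_pos hex]
  exact (hasIntegralMul_reflectDist_iff hF hg p).1 hex.choose_spec

theorem convFD_eq (hF : IsPrimitive f F) (hg : HKBV g) : convFD g f = convFun F g := by
  funext p
  have hex : ∃ A, HasIntegralMul f (reflectFun g p) extPlane A :=
    ⟨_, (hasIntegralMul_reflectFun_iff hF hg p).2 rfl⟩
  rw [convFD, integralMul, dif_pos hex]
  exact (hasIntegralMul_reflectFun_iff hF hg p).1 hex.choose_spec

theorem iSup_enorm_convFun_le (hF : F ∈ BcPlane) (hg : HKBV g) :
    ⨆ p, ‖convFun F g p‖ₑ ≤ ENNReal.ofReal ‖F‖ * bvENorm g := by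
  refine iSup_le fun p => ?_
  rw [← ENNReal.ofReal_toReal hg.bvENorm_lt_top.ne, ← ENNReal.ofReal_mul (norm_nonneg _),
    Real.enorm_eq_ofReal_abs]
  exact ENNReal.ofReal_le_ofReal (abs_convFun_le hF hg p)

/-! ### Continuous extension and limits -/

theorem integrable_kernel_mul {k l : ℝ → ℝ} (hk : Integrable k) (hl : Integrable l)
    (hg : HKBV g) (p : ℝ × ℝ) :
    Integrable fun q : ℝ × ℝ => k q.1 * l q.2 * g (toExt (p - q)) := by
  obtain ⟨M, -, hM⟩ := hg.exists_bound
  refine (hk.mul_prod hl).mul_bdd (c := M) ?_ (ae_of_all _ fun q => hM _)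
  simpa [toExt] using hg.aestronglyMeasurable_translate (toExt p)

theorem tendsto_convFun_tensor {u v : C(EReal, ℝ)} {k l : ℝ → ℝ} (hu : IsLinePrimitive u k)
    (hv : IsLinePrimitive v l) (hg : HKBV g) {L : Filter (ℝ × ℝ)} [L.IsCountablyGenerated]
    {w : ℝ × ℝ → ℝ}
    (hw : ∀ᵐ q : ℝ × ℝ, Tendsto (fun p => g (toExt (p - q))) L (𝓝 (w q))) :
    Tendsto (convFun (tensor u v) g) L (𝓝 (∫ q : ℝ × ℝ, k q.1 * l q.2 * w q)) := by
  obtain ⟨M, -, hM⟩ := hg.exists_bound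
  rw [show convFun (tensor u v) g = _ from funext (convFun_tensor hu hv hg)]
  refine tendsto_integral_filter_of_dominated_convergence (fun q => |k q.1 * l q.2| * M)
    (Eventually.of_forall fun p => (integrable_kernel_mul hu.integrable hv.integrable hg
      p).aestronglyMeasurable)
    (Eventually.of_forall fun p => ae_of_all _ fun q => ?_)
    ((hu.integrable.mul_prod hv.integrable).abs.mul_const M) ?_
  · rw [Real.norm_eq_abs, abs_mul]
    exact mul_le_mul_of_nonneg_left (hM _) (abs_nonneg _)
  · filter_upwards [hw] with q hq using hq.const_mul _

/-- The estimate in F is uniform in p, so the Cauchy property passes to uniform limits of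
primitives; tensor products are handled by dominated convergence. -/
theorem exists_tendsto_convFun (hF : F ∈ BcPlane) (hg : HKBV g) (b : EReal × EReal) :
    ∃ c, Tendsto (convFun F g) (comap toExt (𝓝 b)) (𝓝 c) := by
  have hne : (comap toExt (𝓝 b)).NeBot := by rw [comap_toExt_nhds]; infer_instance
  refine bcPart_induction (P := fun F => ∃ c, Tendsto (convFun F g) (comap toExt (𝓝 b)) (𝓝 c))
    ?_ ?_ ?_ ?_ hF
  · rintro F - F' - ⟨c, hc⟩ ⟨c', hc'⟩
    exact ⟨c + c', (hc.add hc').congr fun p => (convFun_add hg p).symm⟩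
  · rintro a F - ⟨c, hc⟩
    exact ⟨a * c, (hc.const_mul a).congr fun p => (convFun_smul hg a p).symm⟩
  · intro F hF h
    set V := (bvENorm g).toReal
    have hV : 0 ≤ V := ENNReal.toReal_nonneg
    refine cauchy_map_iff_exists_tendsto.1 (Metric.cauchy_iff.2 ⟨inferInstance, fun ε hε => ?_⟩)
    obtain ⟨F', hF', ⟨c, hc⟩, hFF'⟩ := h (ε / (4 * (V + 1))) (by positivity)
    obtain ⟨s, hs, hs'⟩ := (Metric.cauchy_iff.1 hc.cauchy_map).2 (ε / 2) (by positivity)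
    refine ⟨convFun F g '' (convFun F' g ⁻¹' s), image_mem_map hs, ?_⟩
    have hV' : ‖F - F'‖ * V ≤ ε / 4 := by
      refine (mul_le_mul_of_nonneg_right hFF' hV).trans ?_
      rw [div_mul_eq_mul_div, div_le_div_iff₀ (by positivity) (by positivity)]
      nlinarith
    rintro _ ⟨p, hp, rfl⟩ _ ⟨q, hq, rfl⟩
    have h1 := hs' _ hp _ hq
    have h2 := (abs_convFun_sub_le hF hF' hg p).trans hV'
    have h3 := (abs_convFun_sub_le hF hF' hg q).trans hV'
    rw [Real.dist_eq] at h1 ⊢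
    rw [abs_le] at h2 h3
    rw [abs_lt] at h1 ⊢
    constructor <;> linarith [h1.1, h1.2]
  · intro u v k l hu hv
    have h := hg.ae_exists_tendsto_translate b
    -- At points of a null set the limit may fail to exist, and `limUnder` then has a value that
    -- plays no role.
    let w : ℝ × ℝ → ℝ := fun q => limUnder (comap toExt (𝓝 b)) fun p => g (toExt (p - q))
    exact ⟨_, tendsto_convFun_tensor hu hv hg (w := w) (h.mono fun q hq => tendsto_nhds_limUnder hq)⟩

theorem isDenseInducing_toExt : IsDenseInducing toExt :=
  ⟨(EReal.isEmbedding_coe.prodMap EReal.isEmbedding_coe).isInducing, denseRange_toExt⟩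

theorem exists_extension_convFun (hF : F ∈ BcPlane) (hg : HKBV g) :
    ∃ H : C(EReal × EReal, ℝ), ∀ p : ℝ × ℝ, H (toExt p) = convFun F g p := by
  have h := exists_tendsto_convFun hF hg
  have hcont : Continuous (isDenseInducing_toExt.extend (convFun F g)) :=
    isDenseInducing_toExt.continuous_extend h
  refine ⟨⟨_, hcont⟩, fun p => ?_⟩
  obtain ⟨c, hc⟩ := h (toExt p)
  -- The filter at a real point is not punctured, so the limit there is the value itself: `convFun`
  -- is continuous on the real plane and the extension agrees with it.
  have h2 : c = convFun F g p := by
    rw [← isDenseInducing_toExt.nhds_eq_comap] at hc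
    exact tendsto_nhds_unique (hc.mono_left (pure_le_nhds p)) (tendsto_pure_nhds _ _)
  exact (isDenseInducing_toExt.extend_eq_of_tendsto hc).trans h2

theorem tendsto_convFun_corner (hF : F ∈ BcPlane) (hg : HKBV g) {l₁ l₂ : Filter ℝ}
    (h₁ : l₁ ∈ ({atBot, atTop} : Set (Filter ℝ))) (h₂ : l₂ ∈ ({atBot, atTop} : Set (Filter ℝ)))
    {L : ℝ} (hL : Tendsto (fun p : ℝ × ℝ => g (toExt p)) (l₁ ×ˢ l₂) (𝓝 L)) :
    Tendsto (convFun F g) (l₁ ×ˢ l₂) (𝓝 (L * F (⊤, ⊤))) := by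
  have key : ∀ {l : Filter ℝ}, l ∈ ({atBot, atTop} : Set (Filter ℝ)) →
      l.IsCountablyGenerated ∧ ∀ s : ℝ, Tendsto (fun x => x - s) l l := by
    rintro l (rfl | rfl)
    · exact ⟨inferInstance, fun s => tendsto_atBot_add_const_right _ (-s) tendsto_id⟩
    · exact ⟨inferInstance, fun s => tendsto_atTop_add_const_right _ (-s) tendsto_id⟩
  obtain ⟨c₁, hs₁⟩ := key h₁
  obtain ⟨c₂, hs₂⟩ := key h₂
  refine bcPart_induction
    (P := fun F => Tendsto (convFun F g) (l₁ ×ˢ l₂) (𝓝 (L * F (⊤, ⊤)))) ?_ ?_ ?_ ?_ hF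
  · intro F _ F' _ h h'
    rw [ContinuousMap.add_apply, mul_add]
    exact (h.add h').congr fun p => (convFun_add hg p).symm
  · intro a F _ h
    rw [ContinuousMap.smul_apply, smul_eq_mul, mul_left_comm]
    exact (h.const_mul a).congr fun p => (convFun_smul hg a p).symm
  · intro F hF h
    set V := (bvENorm g).toReal
    have hV : 0 ≤ V := ENNReal.toReal_nonneg
    refine Metric.tendsto_nhds.2 fun ε hε => ?_
    obtain ⟨F', hF', hlim, hFF'⟩ := h (ε / (4 * (V + |L| + 1))) (by positivity)
    have hb : ‖F - F'‖ * (V + |L|) ≤ ε / 4 := by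
      refine (mul_le_mul_of_nonneg_right hFF' (by positivity)).trans ?_
      rw [div_mul_eq_mul_div, div_le_div_iff₀ (by positivity) (by positivity)]
      nlinarith
    filter_upwards [Metric.tendsto_nhds.1 hlim (ε / 2) (by positivity)] with p hp
    have h1 := abs_convFun_sub_le hF hF' hg p
    have h2 : |L * F' (⊤, ⊤) - L * F (⊤, ⊤)| ≤ ‖F - F'‖ * |L| := by
      rw [← mul_sub, abs_mul, mul_comm, abs_sub_comm]
      exact mul_le_mul_of_nonneg_right ((F - F').norm_coe_le_norm (⊤, ⊤)) (abs_nonneg _)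
    rw [Real.dist_eq] at hp ⊢
    have h3 := abs_sub_le (convFun F g p) (convFun F' g p) (L * F (⊤, ⊤))
    have h4 := abs_sub_le (convFun F' g p) (L * F' (⊤, ⊤)) (L * F (⊤, ⊤))
    linarith
  · intro u v k l hu hv
    -- Real translations preserve the filters at ±∞, so the pointwise limit is the constant L, and ∬
    -- k ⊗ l = u(+∞) v(+∞).
    have h := tendsto_convFun_tensor hu hv hg (L := l₁ ×ˢ l₂) (w := fun _ => L)
      (ae_of_all _ fun q => hL.comp ((hs₁ q.1).prodMap (hs₂ q.2)))
    rwa [integral_mul_const, Measure.volume_eq_prod, integral_prod_mul, ← hu.top, ← hv.top,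
      mul_comm] at h

/-! ### Convolutions with integrable functions -/

/-- The translate `p ↦ g (p - q)` of a function on the extended plane. -/
noncomputable def translateFun (g : EReal × EReal → ℝ) (q : ℝ × ℝ) (p : EReal × EReal) : ℝ :=
  g (p.1 - (q.1 : EReal), p.2 - (q.2 : EReal))

/-- A translation is a product of two reflections, so the bounds for variations carry over. -/
theorem translateFun_eq (g : EReal × EReal → ℝ) (q : ℝ × ℝ) :
    translateFun g q = reflectFun (reflectFun g 0) q := by
  have h : ∀ (s : EReal) (x : ℝ), s - (x : EReal) = ((0 : ℝ) : EReal) - ((x : EReal) - s) := by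
    intro s x
    induction s with
    | bot => simp
    | top => simp
    | coe s => norm_cast; ring
  funext p
  simp only [translateFun, reflectFun, h p.1, h p.2, Prod.fst_zero, Prod.snd_zero]

theorem vitaliVariation_translateFun_le (g : EReal × EReal → ℝ) (q : ℝ × ℝ) :
    vitaliVariation (translateFun g q) ≤ vitaliVariation g := by
  rw [translateFun_eq]
  exact (vitaliVariation_reflectFun_le _ _).trans (vitaliVariation_reflectFun_le _ _)

theorem variation1_translateFun_top (g : EReal × EReal → ℝ) (q : ℝ × ℝ) :
    variation1 (translateFun g q) ⊤ = variation1 g ⊤ := by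
  rw [translateFun_eq, variation1_reflectFun, variation1_reflectFun]
  simp

theorem variation2_translateFun_top (g : EReal × EReal → ℝ) (q : ℝ × ℝ) :
    variation2 (translateFun g q) ⊤ = variation2 g ⊤ := by
  rw [translateFun_eq, variation2_reflectFun, variation2_reflectFun]
  simp

theorem HKBV.integrable_translateFun_mul (hg : HKBV g) {h : ℝ × ℝ → ℝ} (hh : Integrable h)
    (p : EReal × EReal) : Integrable fun q : ℝ × ℝ => translateFun g q p * h q := by
  obtain ⟨M, -, hM⟩ := hg.exists_bound
  exact hh.bdd_mul (c := M) (hg.aestronglyMeasurable_translate p) (ae_of_all _ fun q => hM _)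

/-- Interchanging sum and integral gives the bound C‖h‖₁. All three variations of g∗h are bounded in
this way, since those of the translates of g are bounded uniformly. -/
theorem sum_enorm_integral_mul_le {ι : Type*} {s : Finset ι} {φ : ι → ℝ × ℝ → ℝ} {h : ℝ × ℝ → ℝ}
    {C : ℝ≥0∞} (hC : C ≠ ∞) (hφ : ∀ i ∈ s, Integrable fun q => φ i q * h q)
    (hb : ∀ q, ∑ i ∈ s, ‖φ i q‖ₑ ≤ C) :
    ∑ i ∈ s, ‖∫ q, φ i q * h q‖ₑ ≤ C * ∫⁻ q, ‖h q‖ₑ := by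
  calc ∑ i ∈ s, ‖∫ q, φ i q * h q‖ₑ ≤ ∑ i ∈ s, ∫⁻ q, ‖φ i q * h q‖ₑ :=
        Finset.sum_le_sum fun i _ => enorm_integral_le_lintegral_enorm _
    _ = ∫⁻ q, ∑ i ∈ s, ‖φ i q * h q‖ₑ :=
        (lintegral_finsetSum' _ fun i hi => (hφ i hi).aestronglyMeasurable.enorm).symm
    _ ≤ ∫⁻ q, C * ‖h q‖ₑ := by
        refine lintegral_mono fun q => ?_
        simp only [enorm_mul, ← Finset.sum_mul]
        exact mul_le_mul_left (hb q) _
    _ = C * ∫⁻ q, ‖h q‖ₑ := lintegral_const_mul' _ _ hC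

theorem incr_convExt (hg : HKBV g) {h : ℝ × ℝ → ℝ} (hh : Integrable h) (R : ExtRect) :
    (Integrable fun q => R.incr (translateFun g q) * h q) ∧
      R.incr (convExt g h) = ∫ q, R.incr (translateFun g q) * h q := by
  have hi := fun p => hg.integrable_translateFun_mul hh p
  have e : (fun q => R.incr (translateFun g q) * h q) = fun q => translateFun g q (R.a, R.c) * h q +
      translateFun g q (R.b, R.d) * h q - translateFun g q (R.a, R.d) * h q -
        translateFun g q (R.b, R.c) * h q := by
    funext q; simp only [ExtRect.incr]; ring
  rw [e]
  have h1 : Integrable fun q => translateFun g q (R.a, R.c) * h q +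
      translateFun g q (R.b, R.d) * h q := (hi _).add (hi _)
  have h2 : Integrable fun q => translateFun g q (R.a, R.c) * h q +
      translateFun g q (R.b, R.d) * h q - translateFun g q (R.a, R.d) * h q := h1.sub (hi _)
  refine ⟨h2.sub (hi _), ?_⟩
  rw [integral_sub h2 (hi _), integral_sub h1 (hi _), integral_add (hi _) (hi _)]
  rfl

theorem edist_convExt (hg : HKBV g) {h : ℝ × ℝ → ℝ} (hh : Integrable h) (p p' : EReal × EReal) :
    (Integrable fun q => (translateFun g q p - translateFun g q p') * h q) ∧
      edist (convExt g h p) (convExt g h p') =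
        ‖∫ q, (translateFun g q p - translateFun g q p') * h q‖ₑ := by
  have hi := fun p => hg.integrable_translateFun_mul hh p
  simp only [sub_mul]
  exact ⟨(hi p).sub (hi p'), by rw [integral_sub (hi p) (hi p'), edist_eq_enorm_sub]; rfl⟩

theorem HKBV.convExt (hg : HKBV g) {h : ℝ × ℝ → ℝ} (hh : Integrable h) : HKBV (convExt g h) := by
  have hfin : ∀ {C : ℝ≥0∞}, C < ∞ → C * ∫⁻ q, ‖h q‖ₑ < ∞ := fun hC => ENNReal.mul_lt_top hC hh.2
  refine ⟨lt_of_le_of_lt (vitaliVariation_le fun n I hI => ?_) (hfin hg.1),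
    ⟨⊤, lt_of_le_of_lt (iSup_le fun u => ?_) (hfin (hg.variation1_lt_top ⊤))⟩,
    ⟨⊤, lt_of_le_of_lt (iSup_le fun u => ?_) (hfin (hg.variation2_lt_top ⊤))⟩⟩
  · simp only [(incr_convExt hg hh _).2]
    exact sum_enorm_integral_mul_le hg.1.ne (fun i _ => (incr_convExt hg hh _).1) fun q =>
      ((isDivision_iff_isDiv.1 hI).sum_enorm_le_vitaliVariation _).trans (vitaliVariation_translateFun_le g q)
  · simp only [(edist_convExt hg hh _ _).2]
    refine sum_enorm_integral_mul_le (hg.variation1_lt_top ⊤).ne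
      (fun i _ => (edist_convExt hg hh _ _).1) fun q => ?_
    rw [← variation1_translateFun_top g q]
    simp only [← edist_eq_enorm_sub]
    exact le_iSup_of_le u le_rfl
  · simp only [(edist_convExt hg hh _ _).2]
    refine sum_enorm_integral_mul_le (hg.variation2_lt_top ⊤).ne
      (fun i _ => (edist_convExt hg hh _ _).1) fun q => ?_
    rw [← variation2_translateFun_top g q]
    simp only [← edist_eq_enorm_sub]
    exact le_iSup_of_le u le_rfl

theorem integrable_convFun_mul (hF : F ∈ BcPlane) (hg : HKBV g) {h : ℝ × ℝ → ℝ}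
    (hh : Integrable h) (p : ℝ × ℝ) : Integrable fun q => convFun F g (p - q) * h q := by
  obtain ⟨H, hH⟩ := exists_extension_convFun hF hg
  refine hh.bdd_mul (c := ‖F‖ * (bvENorm g).toReal) ?_ (ae_of_all _ fun q => abs_convFun_le hF hg _)
  simp only [← hH]
  exact (H.continuous.comp (continuous_toExt.comp (continuous_const.sub
    continuous_id))).aestronglyMeasurable

/-- Both sides are iterated integrals of k ⊗ l ⊗ h times g(p − r − q), in opposite orders, so Fubini
applies. -/
theorem convFun_tensor_convExt {u v : C(EReal, ℝ)} {k l : ℝ → ℝ} (hu : IsLinePrimitive u k)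
    (hv : IsLinePrimitive v l) (hg : HKBV g) {h : ℝ × ℝ → ℝ} (hh : Integrable h) (p : ℝ × ℝ) :
    convFun (tensor u v) (convExt g h) p = ∫ q, convFun (tensor u v) g (p - q) * h q := by
  obtain ⟨M, -, hM⟩ := hg.exists_bound
  rw [convFun_tensor hu hv (hg.convExt hh)]
  simp only [convFun_tensor hu hv hg]
  have e1 : ∀ r : ℝ × ℝ, k r.1 * l r.2 * convExt g h (toExt (p - r)) =
      ∫ q : ℝ × ℝ, k r.1 * l r.2 * h q * g (toExt (p - r - q)) := by
    intro r
    rw [convExt, ← integral_const_mul]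
    refine integral_congr_ae (ae_of_all _ fun q => ?_)
    simp only [toExt, Prod.fst_sub, Prod.snd_sub, EReal.coe_sub]
    ring
  have e2 : ∀ q : ℝ × ℝ, (∫ r : ℝ × ℝ, k r.1 * l r.2 * g (toExt (p - q - r))) * h q =
      ∫ r : ℝ × ℝ, k r.1 * l r.2 * h q * g (toExt (p - r - q)) := by
    intro q
    rw [← integral_mul_const]
    refine integral_congr_ae (ae_of_all _ fun r => ?_)
    simp only [sub_right_comm p q r]
    ring
  simp only [e1, e2]
  refine integral_integral_swap ?_
  refine (Integrable.mul_prod (hu.integrable.mul_prod hv.integrable) hh).mul_bdd (c := M) ?_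
    (ae_of_all _ fun z => hM _)
  -- `g` is only almost everywhere measurable, so composition with (r, q) ↦ p − r − q requires
  -- preimages of null sets to be null.
  have hq : Measure.QuasiMeasurePreserving (fun z : (ℝ × ℝ) × ℝ × ℝ => p - z.1 - z.2)
      (volume.prod volume) volume := by
    simp only [sub_sub]
    exact (quasiMeasurePreserving_sub_left volume p).comp (quasiMeasurePreserving_add volume volume)
  exact hg.aestronglyMeasurable_toExt.comp_quasiMeasurePreserving hq

theorem convFun_convExt (hF : F ∈ BcPlane) (hg : HKBV g) {h : ℝ × ℝ → ℝ} (hh : Integrable h)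
    (p : ℝ × ℝ) : convFun F (convExt g h) p = ∫ q, convFun F g (p - q) * h q := by
  have hgh := hg.convExt hh
  refine bcPart_induction
    (P := fun F => convFun F (convExt g h) p = ∫ q, convFun F g (p - q) * h q) ?_ ?_ ?_ ?_ hF
  · intro F hF F' hF' e e'
    simp only [convFun_add hg, convFun_add hgh, add_mul]
    rw [integral_add (integrable_convFun_mul hF hg hh p) (integrable_convFun_mul hF' hg hh p), e, e']
  · intro c F _ e
    simp only [convFun_smul hg, convFun_smul hgh, mul_assoc]
    rw [integral_const_mul, e]
  · intro F hF happ
    set V := (bvENorm g).toReal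
    set W := (bvENorm (convExt g h)).toReal
    set N := ∫ q, |h q|
    have hV : 0 ≤ V := ENNReal.toReal_nonneg
    have hW : 0 ≤ W := ENNReal.toReal_nonneg
    have hN : 0 ≤ N := integral_nonneg fun _ => abs_nonneg _
    refine eq_of_abs_sub_le_all fun ε hε => ?_
    -- Replacing F by F′ changes the left side by at most W‖F − F′‖ and the right side by at most V
    -- N‖F − F′‖, where N = ‖h‖₁.
    obtain ⟨F', hF', e, hFF'⟩ := happ (ε / (W + V * N + 1)) (by positivity)
    have hi := integrable_convFun_mul hF hg hh p
    have hi' := integrable_convFun_mul hF' hg hh p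
    have h1 := abs_convFun_sub_le hF hF' hgh p
    have h2 : |(∫ q, convFun F' g (p - q) * h q) - ∫ q, convFun F g (p - q) * h q| ≤
        ‖F - F'‖ * (V * N) := by
      rw [← integral_sub hi' hi, ← mul_assoc, ← integral_const_mul, ← Real.norm_eq_abs]
      refine norm_integral_le_of_norm_le (hh.abs.const_mul _) (ae_of_all _ fun q => ?_)
      rw [← sub_mul, norm_mul, Real.norm_eq_abs, Real.norm_eq_abs, abs_sub_comm]
      exact mul_le_mul_of_nonneg_right (abs_convFun_sub_le hF hF' hg _) (abs_nonneg _)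
    rw [e] at h1
    have h3 := abs_sub_le (convFun F (convExt g h) p) (∫ q, convFun F' g (p - q) * h q)
      (∫ q, convFun F g (p - q) * h q)
    have h4 : ‖F - F'‖ * (W + V * N) ≤ ε := by
      refine (mul_le_mul_of_nonneg_right hFF' (by positivity)).trans ?_
      rw [div_mul_eq_mul_div, div_le_iff₀ (by positivity)]
      nlinarith
    linarith
  · intro u v k l hu hv
    exact convFun_tensor_convExt hu hv hg hh p

end

/-! ### The convolution theorem -/

theorem theorem15p1
    (f : 𝓓'((⊤ : TopologicalSpace.Opens (ℝ × ℝ)), ℝ)) (hf : f ∈ AcPlane)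
    (F : C(EReal × EReal, ℝ)) (hF : IsPrimitive f F)
    (g : EReal × EReal → ℝ) (hg : HKBV g) :
    -- (a) existence (and uniqueness of the value)
    (∀ p : ℝ × ℝ, ∃! A : ℝ, HasIntegralMul (reflectDist f p) g extPlane A) ∧
    -- (b) commutativity
    ((∀ p : ℝ × ℝ, ∃! A : ℝ, HasIntegralMul f (reflectFun g p) extPlane A) ∧
      ∀ p : ℝ × ℝ, convDF f g p = convFD g f p) ∧
    -- (c) the norm inequality
    (bvENorm g < ∞ ∧
      (⨆ p : ℝ × ℝ, ‖convDF f g p‖ₑ) ≤ ENNReal.ofReal (alexNorm f) * bvENorm g) ∧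
    -- (d) continuity on the extended plane, and the limits at the corners
    (∃ H : C(EReal × EReal, ℝ), ∀ p : ℝ × ℝ, H (toExt p) = convDF f g p) ∧
    (∀ l₁ ∈ ({atBot, atTop} : Set (Filter ℝ)), ∀ l₂ ∈ ({atBot, atTop} : Set (Filter ℝ)),
      ∃ L : ℝ, Tendsto (fun p : ℝ × ℝ => g (toExt p)) (l₁ ×ˢ l₂) (𝓝 L) ∧
        Tendsto (convDF f g) (l₁ ×ˢ l₂) (𝓝 (L * F (⊤, ⊤)))) ∧
    -- (e) associativity with integrable functions
    (∀ h : ℝ × ℝ → ℝ, Integrable h →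
      (∀ p : EReal × EReal,
        Integrable fun q : ℝ × ℝ => g (p.1 - (q.1 : EReal), p.2 - (q.2 : EReal)) * h q) ∧
      (∀ p : ℝ × ℝ, ∃! A : ℝ, HasIntegralMul (reflectDist f p) (convExt g h) extPlane A) ∧
      (∀ p : ℝ × ℝ, Integrable fun q : ℝ × ℝ => convDF f g (p - q) * h q) ∧
      (∀ p : ℝ × ℝ, convDF f (convExt g h) p = convPlane (convDF f g) h p) ∧
      ∃ K : C(EReal × EReal, ℝ), ∀ p : ℝ × ℝ, K (toExt p) = convDF f (convExt g h) p) := by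
  have huniq : ∀ {g' : EReal × EReal → ℝ}, HKBV g' →
      ∀ p, ∃! A : ℝ, HasIntegralMul (reflectDist f p) g' extPlane A := fun hg' p =>
    ⟨_, (hasIntegralMul_reflectDist_iff hF hg' p).2 rfl, fun _ h =>
      (hasIntegralMul_reflectDist_iff hF hg' p).1 h⟩
  rw [convDF_eq hF hg, convFD_eq hF hg, alexNorm, primitive_eq hF]
  refine ⟨huniq hg, ⟨fun p => ⟨_, (hasIntegralMul_reflectFun_iff hF hg p).2 rfl, fun _ h =>
    (hasIntegralMul_reflectFun_iff hF hg p).1 h⟩, fun _ => rfl⟩,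
    ⟨hg.bvENorm_lt_top, iSup_enorm_convFun_le hF.1 hg⟩, exists_extension_convFun hF.1 hg,
    fun l₁ h₁ l₂ h₂ => ?_, fun h hh => ?_⟩
  · obtain ⟨L, hL⟩ := hg.exists_tendsto_corner h₁ h₂
    exact ⟨L, hL, tendsto_convFun_corner hF.1 hg h₁ h₂ hL⟩
  · have hgh := hg.convExt hh
    rw [convDF_eq hF hgh]
    exact ⟨hg.integrable_translateFun_mul hh, huniq hgh, integrable_convFun_mul hF.1 hg hh,
      convFun_convExt hF.1 hg hh, exists_extension_convFun hF.1 hgh⟩
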